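/- **Setting.** Observe $X_i=\mu_n(i/n)+Z_i$, $i=1,\dots,n$. *Noise.* $Z_i=g(\dots,\varepsilon_{i-1},\varepsilon_i)$, where $(\varepsilon_i)_{i\in\mathbb Z}$ are i.i.d. and $g$ is measurable and real-valued. Let $Z_{i,\{0\}}$ be $Z_i$ with $\varepsilon_0$ replaced by an independent copy, $\gamma_k=\mathrm{Cov}(Z_0,Z_k)$ and $v=\sum_{k\in\mathbb Z}\gamma_k$. *Mean.* $\mu_n(t)=c_n(t)+\sum_{j=0}^{\mathcal J_n}\xi_{n,j}\mathbb 1(T_{n,j}/n\le t<T_{n,j+1}/n)$ with $c_n$ continuous on $[0,1]$, integers $1=T_{n,0}<T_{n,1}<\dots<T_{n,\mathcal J_n}<T_{n,\mathcal J_n+1}=n+1$, and $\xi_{n,j}\ne\xi_{n,j-1}$ for $1\le j\le\mathcal J_n$. Put $\mathcal C_n=\sup_{0\le t'<t\le1}|c_n(t)-c_n(t')|/(t-t')$ and $\mathcal S_n=\max_{1\le j\le\mathcal J_n}|\xi_{n,j}-\xi_{n,j-1}|$ (with $\mathcal S_n=0$ if $\mathcal J_n=0$). *Class.* For $q\in\mathbb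 N=\{1,2,\dots\}$, let $\mathcal P_q$ be the class of all data generating mechanisms (mean and noise) such that $\mathbb E Z_1=0$; $\mathbb E|Z_1|^r<\infty$ for some $r>4$; $\sum_{i\ge0}\|Z_i-Z_{i,\{0\}}\|_4<\infty$; $\sum_{k\in\mathbb Z}|k|^q|\gamma_k|<\infty$; and $\mathcal J_n,\mathcal S_n,\mathcal C_n\asymp1$. *Estimator.* Fix $m\ge1$ and $d_0,\dots,d_m\in\mathbb R$ with $\sum_jd_j=0$ and $\sum_jd_j^2=1$; let $\delta_s=\sum_{j=s}^md_jd_{j-s}$ for $0\le s\le m$ and $\delta_s=0$ for $s>m$. Let $K:\mathbb R\to\mathbb R$ be bounded, even, continuous on $(-1,1)$, with $K(0)=1$ and $K(t)=0$ for $|t|\ge1$, and suppose that $\{K(t)-K(0)\}/|t|^q\to B\ne0$ as $t\downarrow0$, where $q\in\mathbb N$. Let $\ell=\ell_n$ and $h=h_n$ be sequences in $\{1,\dots,n\}$, chosen without knowledge of the data generating mechanism, with $1/\ell+(\ell+mh)/n\to0$. With $D_i=\sum_{j=0}^md_jX_{i-jh}$, put $$\widehat v=\sum_{|k|<\ell}K\Big(\frac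 k\ell\Big)\frac1n\sum_{i=mh+|k|+1}^nD_iD_{i-|k|},\qquad \mathrm{MSE}(\widehat v)=\mathbb E(\widehat v-v)^2 .$$ *Terminology.* $\widehat v$ is *inconsistent* if $\mathrm{MSE}(\widehat v)\not\to0$ for some mechanism in $\mathcal P_q$. It is *rate optimal* if $\mathrm{MSE}(\widehat v)=O(n^{-2q/(1+2q)})$ for every mechanism in $\mathcal P_q$, and *rate suboptimal* otherwise. $\widehat v$ *attains* the rate $r_n$ if $\mathrm{MSE}(\widehat v)=O(r_n)$ for every mechanism in $\mathcal P_q$ and $\mathrm{MSE}(\widehat v)\asymp r_n$ for some mechanism in $\mathcal P_q$. **Theorem.** 1. If $h/\ell\to0$, then $\widehat v$ is inconsistent. 2. If $h/\ell\to\lambda_\infty\in(0,1)$ and, with $\lambda=h/\ell$, $2\sum_{s=1}^{\lfloor1/\lambda\rfloor}\delta_sK(\lambda s)$ converges to a nonzero limit, then $\widehat v$ is inconsistent. 3. Suppose $h/\ell\to1$, $|h-\ell|=O(1)$, and $\{K(1)-K(1-t)\}/|t|^{q'}\to B'\ne0$ as $t\downarrow0$ for some $q'\in\mathbb N$. Let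 $q_*=q\wedge q'$. If $\ell\asymp n^{1/(1+2q_*)}$, then $\widehat v$ attains the rate $n^{-2q_*/(1+2q_*)}$. This is best possible, provided that $\delta_1\ne0$ in the case $q'<q$: for every choice of $(\ell,h)$ in this regime there is a mechanism in $\mathcal P_q$ for which $\mathrm{MSE}(\widehat v)$ is not $o(n^{-2q_*/(1+2q_*)})$; and unless $q=q'$ and $B=\delta_1B'$, there is one for which $\mathrm{MSE}(\widehat v)\gtrsim n^{-2q_*/(1+2q_*)}$. 4. Suppose $h/\ell\to\lambda_\infty\in(1,\infty)$. If $\ell\asymp n^{1/(1+2q)}$, then $\widehat v$ attains the rate $n^{-2q/(1+2q)}$. This is best possible: for every choice of $(\ell,h)$ in this regime there is a mechanism in $\mathcal P_q$ for which $\mathrm{MSE}(\widehat v)\gtrsim n^{-2q/(1+2q)}$. 5. Suppose $h/\ell\to\infty$. (a) If $q=1$ and $\int_{-1}^1K(t)\,dt\ne0$, then $\widehat v$ is rate suboptimal. (b) If $q>1$, $\ell\asymp n^{1/(1+2q)}$ and $n^{1/(1+2q)}\ll h\lesssim n^{q/(1+2q)}$, then $\widehat v$ attains the rate $n^{-2q/(1+2q)}$.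 This is best possible: for $q>1$ and every choice of $(\ell,h)$ in this regime there is a mechanism in $\mathcal P_q$ for which $\mathrm{MSE}(\widehat v)\gtrsim n^{-2q/(1+2q)}$. Moreover, if $q>1$, $\int_{-1}^1K(t)\,dt\ne0$ and $\widehat v$ is rate optimal, then $\ell\asymp n^{1/(1+2q)}$ and $h\lesssim n^{q/(1+2q)}$. -/

import Mathlib

open MeasureTheory ProbabilityTheory Filter Topology Asymptotics Finset
open scoped ENNReal

universe u

noncomputable section

namespace DiffVar

/-! ### Noise: causal Bernoulli shifts of i.i.d. innovations -/

/-- Noise `Z_i = g(…, ε_{i-1}, ε_i)`, where the innovations `(ε_i)_{i ∈ ℤ}` are i.i.d. with law `ν`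
on a measurable space `E`. They are realised as the coordinates of `E^ℤ` with the product law
(all quantities below depend on the law of the innovations only); the argument of `g` lists
the innovations backwards in time. Such a sequence is strictly stationary. -/
structure NoiseModel where
  E : Type u
  [mE : MeasurableSpace E]
  ν : Measure E
  [prob : IsProbabilityMeasure ν]
  g : (ℕ → E) → ℝ
  measurable_g : Measurable g

attribute [instance] NoiseModel.mE NoiseModel.prob

namespace NoiseModel

variable (N : NoiseModel.{u})

/-- The law of the two-sided innovation sequence. -/
def P : Measure (ℤ → N.E) := Measure.infinitePi fun _ : ℤ => N.ν

/-- `Z_i = g(ε_i, ε_{i-1}, …)`. -/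
def Z (i : ℤ) (ω : ℤ → N.E) : ℝ := N.g fun j : ℕ => ω (i - j)

/-- The physical dependence measure `θ_{p,i} = ‖Z_i - Z_{i,{0}}‖_p`, where `Z_{i,{0}}` is `Z_i` with
`ε_0` replaced by an independent copy. -/
def theta (p : ℝ≥0∞) (i : ℕ) : ℝ≥0∞ :=
  eLpNorm (fun x : (ℤ → N.E) × N.E => N.Z i x.1 - N.Z i (Function.update x.1 0 x.2)) p
    (N.P.prod N.ν)

/-- `Θ_p = ∑_{i ≥ 0} θ_{p,i}`. -/
def Theta (p : ℝ≥0∞) : ℝ≥0∞ := ∑' i : ℕ, N.theta p i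

/-- The autocovariance function `γ_k = Cov(Z_0, Z_k)`. -/
def acvf (k : ℤ) : ℝ := covariance (N.Z 0) (N.Z k) N.P

/-- The long-run variance `v = ∑_{k ∈ ℤ} γ_k`. -/
def lrv : ℝ := ∑' k : ℤ, N.acvf k

/-- Weak dependence: zero mean, a finite moment of some order `r > 4`, and `Θ_4 < ∞`. -/
structure WeaklyDependent : Prop where
  moment : ∃ r : ℝ, 4 < r ∧ MemLp (N.Z 1) (ENNReal.ofReal r) N.P
  mean_zero : ∫ ω, N.Z 1 ω ∂N.P = 0
  stable : N.Theta 4 < ∞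

/-- `u_q = ∑_{k ∈ ℤ} |k|^q |γ_k| < ∞`. -/
def FiniteU (q : ℕ) : Prop := Summable fun k : ℤ => |(k : ℝ)| ^ q * |N.acvf k|

end NoiseModel

/-! ### Mean functions: continuous part plus step part, both possibly dependent on `n` -/

/-- For each `n`: the continuous part `c`, the number of discontinuities `J`, the levels
`ξ_0, …, ξ_J` and the times `1 = T_0 < T_1 < ⋯ < T_J < T_{J+1} = n + 1`. -/
structure MeanModel where
  c : ℕ → ℝ → ℝ
  J : ℕ → ℕ
  ξ : ℕ → ℕ → ℝ
  T : ℕ → ℕ → ℕ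
  continuous_c : ∀ n, ContinuousOn (c n) (Set.Icc 0 1)
  T_zero : ∀ n, 1 ≤ n → T n 0 = 1
  T_last : ∀ n, 1 ≤ n → T n (J n + 1) = n + 1
  T_lt : ∀ n, 1 ≤ n → ∀ j ≤ J n, T n j < T n (j + 1)
  ξ_ne : ∀ n, 1 ≤ n → ∀ j < J n, ξ n (j + 1) ≠ ξ n j

namespace MeanModel

variable (M : MeanModel)

/-- The step part `s(t) = ∑_{j=0}^J ξ_j 1(T_j/n ≤ t < T_{j+1}/n)`. -/
def s (n : ℕ) (t : ℝ) : ℝ :=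
  ∑ j ∈ range (M.J n + 1),
    Set.indicator (Set.Ico ((M.T n j : ℝ) / n) ((M.T n (j + 1) : ℝ) / n)) (fun _ => M.ξ n j) t

/-- The mean function `μ = c + s` at sample size `n`. -/
def mu (n : ℕ) (t : ℝ) : ℝ := M.c n t + M.s n t

/-- The Lipschitz constant of `c` on `[0,1]`. -/
def smoothness (n : ℕ) : ℝ≥0∞ :=
  ⨆ (t' ∈ Set.Icc (0 : ℝ) 1) (t ∈ Set.Icc (0 : ℝ) 1) (_ : t' < t),
    ENNReal.ofReal |(M.c n t - M.c n t') / (t - t')|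

/-- The largest jump magnitude of `s`. -/
def jumpSize (n : ℕ) : ℝ≥0∞ :=
  ⨆ j ∈ range (M.J n), ENNReal.ofReal |M.ξ n (j + 1) - M.ξ n j|

end MeanModel

/-- `a_n ≍ 1`, for sequences that may take the value `∞`. -/
def OrderOne (a : ℕ → ℝ≥0∞) : Prop :=
  ∃ A : ℝ, 0 < A ∧ ∀ᶠ n in atTop, ENNReal.ofReal (1 / A) ≤ a n ∧ a n ≤ ENNReal.ofReal A

/-- A data generating mechanism `X_i = μ(i/n) + Z_i`. -/
structure DGM where
  noise : NoiseModel.{u}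
  mean : MeanModel

/-- The class of data generating mechanisms: weakly dependent noise with `u_q < ∞`, and a mean
function whose number of jumps, largest jump and Lipschitz constant are of exact order one. -/
structure DGM.InClass (G : DGM.{u}) (q : ℕ) : Prop where
  weak : G.noise.WeaklyDependent
  finite_u : G.noise.FiniteU q
  jumps : OrderOne fun n => (G.mean.J n : ℝ≥0∞)
  jumpSize : OrderOne G.mean.jumpSize
  smoothness : OrderOne G.mean.smoothness

/-! ### The estimator -/

/-- A kernel: `K(0) = 1`, even, zero outside `(-1,1)`, continuous on `(-1,1)`, and bounded. -/
structure IsKernel (K : ℝ → ℝ) : Prop where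
  zero : K 0 = 1
  even : ∀ t, K (-t) = K t
  support : ∀ t, 1 ≤ |t| → K t = 0
  cont : ContinuousOn K (Set.Ioo (-1) 1)
  bounded : ∃ A : ℝ, ∀ t, |K t| ≤ A

/-- Near-origin property with exponent `q` and constant `B ≠ 0`. -/
structure NearOrigin (K : ℝ → ℝ) (q : ℕ) (B : ℝ) : Prop where
  pos : 1 ≤ q
  ne : B ≠ 0
  lim : Tendsto (fun t : ℝ => (K t - K 0) / |t| ^ q) (𝓝[>] 0) (𝓝 B)

/-- Near-boundary property with exponent `q'` and constant `B' ≠ 0`. -/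
structure NearBoundary (K : ℝ → ℝ) (q' : ℕ) (B' : ℝ) : Prop where
  pos : 1 ≤ q'
  ne : B' ≠ 0
  lim : Tendsto (fun t : ℝ => (K 1 - K (1 - t)) / |t| ^ q') (𝓝[>] 0) (𝓝 B')

/-- `d_0, …, d_m` is a normalized difference sequence of order `m`. -/
structure IsDiffSeq (m : ℕ) (d : ℕ → ℝ) : Prop where
  sum_zero : ∑ j ∈ range (m + 1), d j = 0
  sum_sq : ∑ j ∈ range (m + 1), d j ^ 2 = 1

/-- `δ_s = ∑_{j=s}^m d_j d_{j-s}` (zero for `s > m`). -/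
def delta (m : ℕ) (d : ℕ → ℝ) (s : ℕ) : ℝ := ∑ j ∈ Icc s m, d j * d (j - s)

/-- Bandwidths `ℓ_n` and lags `h_n` in `{1, …, n}` with `1/ℓ + (ℓ + m h)/n → 0`. -/
structure Admissible (m : ℕ) (ℓ h : ℕ → ℕ) : Prop where
  range_ℓ : ∀ n, 1 ≤ n → 1 ≤ ℓ n ∧ ℓ n ≤ n
  range_h : ∀ n, 1 ≤ n → 1 ≤ h n ∧ h n ≤ n
  lim : Tendsto (fun n : ℕ => 1 / (ℓ n : ℝ) + ((ℓ n : ℝ) + m * h n) / n) atTop (𝓝 0)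

/-- `λ_n = h_n / ℓ_n`. -/
def ratio (ℓ h : ℕ → ℕ) (n : ℕ) : ℝ := (h n : ℝ) / ℓ n

/-- Unambiguity: `2 ∑_{s=1}^{⌊1/λ⌋} δ_s K(λ s)` converges to a nonzero limit. -/
def Unambiguous (K : ℝ → ℝ) (m : ℕ) (d : ℕ → ℝ) (ℓ h : ℕ → ℕ) : Prop :=
  ∃ Ω : ℝ, Ω ≠ 0 ∧
    Tendsto (fun n : ℕ => 2 * ∑ s ∈ Icc 1 ⌊1 / ratio ℓ h n⌋₊, delta m d s * K (ratio ℓ h n * s))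
      atTop (𝓝 Ω)

namespace DGM

variable (G : DGM.{u})

/-- `X_i = μ(i/n) + Z_i`. -/
def X (n : ℕ) (i : ℤ) (ω : ℤ → G.noise.E) : ℝ := G.mean.mu n ((i : ℝ) / n) + G.noise.Z i ω

/-- The lag-`h` difference statistic `D_i = ∑_{j=0}^m d_j X_{i-jh}`. -/
def D (m : ℕ) (d : ℕ → ℝ) (n h : ℕ) (i : ℤ) (ω : ℤ → G.noise.E) : ℝ :=
  ∑ j ∈ range (m + 1), d j * G.X n (i - (j : ℤ) * h) ω

/-- `γ̂_k^D = n⁻¹ ∑_{i=mh+|k|+1}^n D_i D_{i-|k|}`. -/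
def gammaHat (m : ℕ) (d : ℕ → ℝ) (n h : ℕ) (k : ℤ) (ω : ℤ → G.noise.E) : ℝ :=
  1 / (n : ℝ) * ∑ i ∈ Icc ((m : ℤ) * h + |k| + 1) n, G.D m d n h i ω * G.D m d n h (i - |k|) ω

/-- `v̂ = ∑_{|k| < ℓ} K(k/ℓ) γ̂_k^D`. -/
def vHat (K : ℝ → ℝ) (m : ℕ) (d : ℕ → ℝ) (n ℓ h : ℕ) (ω : ℤ → G.noise.E) : ℝ :=
  ∑ k ∈ Ioo (-(ℓ : ℤ)) ℓ, K ((k : ℝ) / ℓ) * G.gammaHat m d n h k ω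

/-- `MSE_μ(v̂) = E (v̂ - v)²` at sample size `n`. -/
def mse (K : ℝ → ℝ) (m : ℕ) (d : ℕ → ℝ) (ℓ h : ℕ → ℕ) (n : ℕ) : ℝ :=
  ∫ ω, (G.vHat K m d n (ℓ n) (h n) ω - G.noise.lrv) ^ 2 ∂G.noise.P

end DGM

/-- `n^{-2q/(1+2q)}`. -/
def rate (q n : ℕ) : ℝ := (n : ℝ) ^ (-(2 * (q : ℝ)) / (1 + 2 * (q : ℝ)))

/-- `n^{1/(1+2q)}`. -/
def bw (q n : ℕ) : ℝ := (n : ℝ) ^ (1 / (1 + 2 * (q : ℝ)))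

/-- Inconsistency in `L²`: for some mechanism of the class, the MSE does not tend to zero. -/
def Inconsistent (K : ℝ → ℝ) (m : ℕ) (d : ℕ → ℝ) (ℓ h : ℕ → ℕ) (q : ℕ) : Prop :=
  ∃ G : DGM.{0}, G.InClass q ∧ ¬ Tendsto (G.mse K m d ℓ h) atTop (𝓝 0)

/-- The MSE is `O(r_n)` for every mechanism of the class. -/
def MSEBigO (K : ℝ → ℝ) (m : ℕ) (d : ℕ → ℝ) (ℓ h : ℕ → ℕ) (q : ℕ) (r : ℕ → ℝ) : Prop :=
  ∀ G : DGM.{u}, G.InClass q → G.mse K m d ℓ h =O[atTop] r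

/-- Rate optimality in `L²`: the MSE is `O(n^{-2q/(1+2q)})` for every mechanism of the class. -/
def RateOptimal (K : ℝ → ℝ) (m : ℕ) (d : ℕ → ℝ) (ℓ h : ℕ → ℕ) (q : ℕ) : Prop :=
  MSEBigO.{u} K m d ℓ h q (rate q)

/-- The worst-case order of the MSE is exactly `r_n`: it is `O(r_n)` for every mechanism of the
class, and `≍ r_n` for some mechanism of the class. -/
def Attains (K : ℝ → ℝ) (m : ℕ) (d : ℕ → ℝ) (ℓ h : ℕ → ℕ) (q : ℕ) (r : ℕ → ℝ) : Prop :=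
  MSEBigO.{u} K m d ℓ h q r ∧
    ∃ G : DGM.{0}, G.InClass q ∧ G.mse K m d ℓ h =Θ[atTop] r

/-- For some mechanism of the class, the MSE is bounded below by a multiple of `r_n`, for all
large `n`. -/
def MSELowerBound (K : ℝ → ℝ) (m : ℕ) (d : ℕ → ℝ) (ℓ h : ℕ → ℕ) (q : ℕ) (r : ℕ → ℝ) : Prop :=
  ∃ G : DGM.{0}, G.InClass q ∧ r =O[atTop] G.mse K m d ℓ h

/-- For some mechanism of the class, the MSE is not of smaller order than `r_n`. -/
def NotSmaller (K : ℝ → ℝ) (m : ℕ) (d : ℕ → ℝ) (ℓ h : ℕ → ℕ) (q : ℕ) (r : ℕ → ℝ) : Prop :=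
  ∃ G : DGM.{0}, G.InClass q ∧ ¬ G.mse K m d ℓ h =o[atTop] r

end DiffVar

end

open DiffVar

/-! Splitting the differences into mean and noise turns `v̂ - v` into a bias, a centred linear form
and a centred quadratic form in the differenced noise. The bias has a noise part `∑ₓ γₓ (w(x) - 1)`,
where `w` is `acvfWeight`, and a mean part, which is the quadratic form of the differenced mean. Up
to `O((mh + ℓ)/n)`, `w(x)` equals `K(x/ℓ) + ∑ₛ δₛ {K((x - sh)/ℓ) + K((x + sh)/ℓ)}`: the usual kernel
weight plus the price of differencing. The size of the extra terms at fixed lags `x` decides the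
regime. If `h/ℓ → λ < 1` they need not vanish in the limit; if `|h - ℓ| = O(1)` they are of order
`ℓ^{-q'}`; if `h/ℓ` stays above `1` they are eventually zero.

Upper bound (`mse_isBigO`). An Efron–Stein inequality on the infinite product space gives fourth
moments of linear forms (`fourth_moment_le`) and variances of quadratic forms
(`InfluenceBound.quadratic_variance_le`) in terms of the `L⁴` influences of the innovations, which
are summable by assumption. The differenced mean is bounded with absolute sum `O(h)`. Hence the MSE
is at most a multiple of `ℓ/n + (ℓ/n)(ℓh/n) + ℓ^{-2p} + (ℓh/n)²`, where `p` is the order up to which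
`w(x) - 1` is small (`OffDiag`).

Lower bounds come from moving averages of coin tosses and a mean with a linear trend and one jump.
The variance is at least of order `ℓ/n` by Bessel's inequality for the orthonormal products `ε_p
ε_{p+r}` (`exists_mul_le_mse`). When `ℓ` is small, a two-tap moving average has noise bias of exact
order `ℓ^{-p}`. The scale of the mean may depend on `n` and is chosen so that the mean part cannot
cancel the noise part (`mseLowerBound_of_bias`). Inconsistency follows by comparing two white noises
with the same mean: the mean part drops out and `w(0)` would have to tend to one
(`inconsistent_of_rawWeight`).

Necessary conditions. If the MSE is `O(r_n)` throughout the class, the Banach–Steinhaus theorem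
makes the pointwise bound on the bias uniform: `|w(k) - 1| ≤ C k^q √r_n`
(`exists_acvfWeight_le_of_mseBigO`). Since `w` vanishes at some lag of order `ℓ` in the regimes
considered, `ℓ` is at least of order `n^{1/(1+2q)}`. If `h/ℓ → ∞` and `∫K ≠ 0`, a single jump forces
a bias of exact order `ℓh/n` (`isBigO_qform_midJump`), which bounds `h` and excludes `q = 1`. -/

noncomputable section

namespace DiffVar

/-! ### Cauchy–Schwarz for integrals -/

section CauchySchwarz

variable {Ω : Type*} [MeasurableSpace Ω] {μ : Measure Ω}

lemma integrable_mul_of_memLp_two {u v : Ω → ℝ} (hu : MemLp u 2 μ) (hv : MemLp v 2 μ) :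
    Integrable (fun ω => u ω * v ω) μ :=
  hu.integrable_mul hv

lemma sq_integral_mul_le {u v : Ω → ℝ} (hu : MemLp u 2 μ) (hv : MemLp v 2 μ) :
    (∫ ω, u ω * v ω ∂μ) ^ 2 ≤ (∫ ω, u ω ^ 2 ∂μ) * ∫ ω, v ω ^ 2 ∂μ := by
  have huv := integrable_mul_of_memLp_two hu hv
  have hquad : ∀ t : ℝ, 0 ≤ (∫ ω, v ω ^ 2 ∂μ) * (t * t) + (2 * ∫ ω, u ω * v ω ∂μ) * t
      + ∫ ω, u ω ^ 2 ∂μ := by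
    intro t
    have h1 : 0 ≤ ∫ ω, (u ω + t * v ω) ^ 2 ∂μ := integral_nonneg fun ω => sq_nonneg _
    have h2 : (fun ω => (u ω + t * v ω) ^ 2)
        = fun ω => (t * t * v ω ^ 2 + 2 * t * (u ω * v ω)) + u ω ^ 2 := by
      funext ω; ring
    have i1 : Integrable (fun ω => t * t * v ω ^ 2) μ := hv.integrable_sq.const_mul _
    have i2 : Integrable (fun ω => 2 * t * (u ω * v ω)) μ := huv.const_mul _
    have i3 : Integrable (fun ω => t * t * v ω ^ 2 + 2 * t * (u ω * v ω)) μ := i1.add i2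
    rw [h2, integral_add i3 hu.integrable_sq, integral_add i1 i2, integral_const_mul,
      integral_const_mul] at h1
    linarith
  have := discrim_le_zero hquad
  rw [discrim] at this
  nlinarith

lemma integral_mul_le_sqrt {u v : Ω → ℝ} (hu : MemLp u 2 μ) (hv : MemLp v 2 μ) :
    ∫ ω, u ω * v ω ∂μ ≤ √(∫ ω, u ω ^ 2 ∂μ) * √(∫ ω, v ω ^ 2 ∂μ) := by
  rw [← Real.sqrt_mul (integral_nonneg fun ω => sq_nonneg _)]
  exact Real.le_sqrt_of_sq_le (sq_integral_mul_le hu hv)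

lemma sq_integral_le [IsProbabilityMeasure μ] {u : Ω → ℝ} (hu : MemLp u 2 μ) :
    (∫ ω, u ω ∂μ) ^ 2 ≤ ∫ ω, u ω ^ 2 ∂μ := by
  simpa using sq_integral_mul_le hu (memLp_const (1 : ℝ))

end CauchySchwarz

/-! ### The Efron–Stein inequality on a product of probability spaces -/

section EfronStein

variable {ι : Type*} {E : Type*} [MeasurableSpace E] (ν : Measure E) [IsProbabilityMeasure ν]

/-- Both measures agree on rectangles of square cylinders, a generating π-system. The doubled space
carries a sample and an independent copy of every coordinate at once, so that all resamplings become
swaps on one space. -/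
lemma measurePreserving_unzip :
    MeasurePreserving (fun w : ι → E × E => ((fun i => (w i).1, fun i => (w i).2) :
        (ι → E) × (ι → E)))
      (Measure.infinitePi fun _ : ι => ν.prod ν)
      ((Measure.infinitePi fun _ : ι => ν).prod (Measure.infinitePi fun _ : ι => ν)) := by
  classical
  have hmeas : Measurable (fun w : ι → E × E => ((fun i => (w i).1, fun i => (w i).2) :
        (ι → E) × (ι → E))) := by fun_prop
  refine ⟨hmeas, ?_⟩
  have huniv : (Set.univ : Set (ι → E)) ∈ squareCylinders fun _ : ι => {s : Set E | MeasurableSet s} :=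
    ⟨∅, fun _ => Set.univ, by simp, by simp⟩
  have hspan : (Measure.infinitePi fun _ : ι => ν).FiniteSpanningSetsIn
      (squareCylinders fun _ : ι => {s : Set E | MeasurableSet s}) :=
    ⟨fun _ => Set.univ, fun _ => huniv, fun _ => measure_lt_top _ _, Set.iUnion_const _⟩
  have hpi : IsPiSystem (squareCylinders fun _ : ι => {s : Set E | MeasurableSet s}) :=
    isPiSystem_squareCylinders (fun _ => MeasurableSpace.isPiSystem_measurableSet) (by simp)
  refine (Measure.prod_eq_generateFrom generateFrom_squareCylinders generateFrom_squareCylinders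
    hpi hpi hspan hspan ?_).symm
  rintro _ ⟨I, s, hs, rfl⟩ _ ⟨J, t, ht, rfl⟩
  have hs' : ∀ i, MeasurableSet (s i) := fun i => hs i (Set.mem_univ i)
  have ht' : ∀ i, MeasurableSet (t i) := fun i => ht i (Set.mem_univ i)
  rw [Measure.map_apply hmeas ((MeasurableSet.pi I.countable_toSet fun i _ => hs' i).prod
    (MeasurableSet.pi J.countable_toSet fun i _ => ht' i))]
  have hset : (fun w : ι → E × E => ((fun i => (w i).1, fun i => (w i).2) :
        (ι → E) × (ι → E))) ⁻¹' (((I : Set ι).pi s) ×ˢ ((J : Set ι).pi t))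
      = ((I ∪ J : Finset ι) : Set ι).pi
        fun i => (if i ∈ I then s i else Set.univ) ×ˢ (if i ∈ J then t i else Set.univ) := by
    ext w
    simp only [Set.mem_preimage, Set.mem_prod, Set.mem_pi, Finset.mem_coe, Finset.mem_union]
    constructor
    · rintro ⟨h1, h2⟩ i hi
      constructor
      · split_ifs with h
        · exact h1 i h
        · trivial
      · split_ifs with h
        · exact h2 i h
        · trivial
    · intro h
      refine ⟨fun i hi => ?_, fun i hi => ?_⟩
      · have := (h i (Or.inl hi)).1
        rwa [if_pos hi] at this
      · have := (h i (Or.inr hi)).2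
        rwa [if_pos hi] at this
  rw [hset, Measure.infinitePi_pi, Measure.infinitePi_pi _ (fun i _ => hs' i),
    Measure.infinitePi_pi _ (fun i _ => ht' i)]
  · simp only [Measure.prod_prod, Finset.prod_mul_distrib]
    congr 1
    · rw [← Finset.prod_subset (Finset.subset_union_left (s₁ := I) (s₂ := J))]
      · exact Finset.prod_congr rfl fun i hi => by rw [if_pos hi]
      · intro i _ hi; rw [if_neg hi, measure_univ]
    · rw [← Finset.prod_subset (Finset.subset_union_right (s₁ := I) (s₂ := J))]
      · exact Finset.prod_congr rfl fun i hi => by rw [if_pos hi]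
      · intro i _ hi; rw [if_neg hi, measure_univ]
  · intro i _
    refine MeasurableSet.prod ?_ ?_
    · split_ifs
      exacts [hs' i, MeasurableSet.univ]
    · split_ifs
      exacts [ht' i, MeasurableSet.univ]

/-- Exchange the two components of the coordinates in `S`. -/
def swapOn (S : Set ι) (w : ι → E × E) : ι → E × E :=
  open Classical in fun i => if i ∈ S then (w i).swap else w i

lemma measurePreserving_swapOn (S : Set ι) :
    MeasurePreserving (swapOn (E := E) S) (Measure.infinitePi fun _ : ι => ν.prod ν)
      (Measure.infinitePi fun _ : ι => ν.prod ν) := by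
  classical
  have hf : ∀ i : ι, Measurable fun x : E × E => if i ∈ S then x.swap else x := by
    intro i
    split_ifs
    exacts [measurable_swap, measurable_id]
  have heq : swapOn (E := E) S = fun w i => (fun x : E × E => if i ∈ S then x.swap else x) (w i) := by
    funext w i
    simp only [swapOn]
  refine ⟨by rw [heq]; exact measurable_pi_lambda _ fun i => (hf i).comp (measurable_pi_apply i), ?_⟩
  rw [heq, Measure.infinitePi_map_pi _ hf]
  congr 1
  funext i
  split_ifs
  exacts [Measure.prod_swap, Measure.map_id]

/-- The first components. -/
def firsts (w : ι → E × E) : ι → E := fun i => (w i).1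

lemma measurePreserving_firsts :
    MeasurePreserving (firsts (ι := ι) (E := E)) (Measure.infinitePi fun _ : ι => ν.prod ν)
      (Measure.infinitePi fun _ : ι => ν) :=
  measurePreserving_fst.comp (measurePreserving_unzip ν)

lemma measurePreserving_resample (k : ι) :
    MeasurePreserving (fun w : ι → E × E => (firsts w, (w k).2))
      (Measure.infinitePi fun _ : ι => ν.prod ν)
      ((Measure.infinitePi fun _ : ι => ν).prod ν) :=
  ((MeasurePreserving.id _).prod (measurePreserving_eval_infinitePi (fun _ : ι => ν) k)).comp
    (measurePreserving_unzip ν)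

lemma firsts_swapOn_singleton [DecidableEq ι] (k : ι) (w : ι → E × E) :
    firsts (swapOn {k} w) = Function.update (firsts w) k (w k).2 := by
  funext i
  by_cases hi : i = k
  · subst hi; simp [firsts, swapOn]
  · simp [firsts, swapOn, hi]

lemma swapOn_insert {S : Set ι} {k : ι} (hk : k ∉ S) (w : ι → E × E) :
    swapOn (insert k S) w = swapOn S (swapOn {k} w) := by
  funext i
  by_cases hi : i = k
  · subst hi; simp [swapOn, hk]
  · by_cases hS : i ∈ S
    · have : i ∈ insert k S := Set.mem_insert_of_mem k hS
      simp [swapOn, hi, hS, this]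
    · have : i ∉ insert k S := fun h => (Set.mem_insert_iff.1 h).elim hi hS
      simp [swapOn, hi, hS, this]

lemma swapOn_insert' {S : Set ι} {k : ι} (hk : k ∉ S) (w : ι → E × E) :
    swapOn (insert k S) (swapOn {k} w) = swapOn S w := by
  funext i
  by_cases hi : i = k
  · subst hi; simp [swapOn, hk]
  · by_cases hS : i ∈ S
    · have : i ∈ insert k S := Set.mem_insert_of_mem k hS
      simp [swapOn, hi, hS, this]
    · have : i ∉ insert k S := fun h => (Set.mem_insert_iff.1 h).elim hi hS
      simp [swapOn, hi, hS, this]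

/-- Square-integrable functions on a product space are approximated by functions of finitely many
coordinates. -/
lemma exists_dependsOn_approx {f : (ι → E) → ℝ}
    (hf : MemLp f 2 (Measure.infinitePi fun _ : ι => ν)) {ε : ℝ≥0∞} (hε : ε ≠ 0) :
    ∃ g : (ι → E) → ℝ, eLpNorm (f - g) 2 (Measure.infinitePi fun _ : ι => ν) ≤ ε ∧
      MemLp g 2 (Measure.infinitePi fun _ : ι => ν) ∧ ∃ I : Finset ι, DependsOn g (I : Set ι) := by
  classical
  set P := Measure.infinitePi fun _ : ι => ν with hP
  refine MemLp.induction_dense (by simp)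
    (fun g => MemLp g 2 P ∧ ∃ I : Finset ι, DependsOn g (I : Set ι)) ?_ ?_
    (fun g hg => hg.1.1) hf hε
  · intro c s hs _ ε hε
    obtain ⟨η, hη, hη'⟩ := exists_eLpNorm_indicator_le (p := 2) (μ := P) (by simp) c hε
    -- Cylinders form an algebra generating the product σ-algebra, so they approximate every
    -- measurable set in measure; indicators suffice by density.
    have hdense : P.MeasureDense (measurableCylinders fun _ : ι => E) :=
      Measure.MeasureDense.of_generateFrom_isSetAlgebra_finite P isSetAlgebra_measurableCylinders
        generateFrom_measurableCylinders.symm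
    obtain ⟨t, ht, hst⟩ := hdense.approx s hs (measure_ne_top _ _) η (by exact_mod_cast hη)
    have htm := hdense.measurable t ht
    refine ⟨t.indicator fun _ => c, ?_, memLp_indicator_const 2 htm c (Or.inr (measure_ne_top _ _)), ?_⟩
    · have : eLpNorm (t.indicator (fun _ => c) - s.indicator fun _ => c) 2 P
          = eLpNorm ((symmDiff s t).indicator fun _ => c) 2 P := by
        refine eLpNorm_congr_norm_ae (Eventually.of_forall fun x => ?_)
        by_cases h1 : x ∈ s <;> by_cases h2 : x ∈ t <;> simp [h1, h2, Set.mem_symmDiff]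
      rw [this]
      refine hη' _ (hst.le.trans (le_of_eq ?_))
      simp
    · obtain ⟨I, S, _, rfl⟩ := (mem_measurableCylinders t).1 ht
      exact ⟨I, dependsOn_cylinder_indicator_const (α := fun _ : ι => E) S c⟩
  · rintro f g ⟨hf, I, hI⟩ ⟨hg, J, hJ⟩
    refine ⟨hf.add hg, I ∪ J, fun x y hxy => ?_⟩
    simp only [Pi.add_apply]
    rw [hI fun i hi => hxy i (by simp [Finset.mem_coe.1 hi]), hJ fun i hi => hxy i (by simp [Finset.mem_coe.1 hi])]

end EfronStein

/-! ### Norms as moments, and Cauchy–Schwarz for fourth moments -/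

section Norms

variable {Ω : Type*} [MeasurableSpace Ω] {μ : Measure Ω}

/-- Bridge between the two languages used below: the triangle inequality lives in `eLpNorm`, the
algebraic identities in integrals. -/
lemma eLpNorm_le_ofReal_iff {p : ℕ} (hp : p ≠ 0) {f : Ω → ℝ} (hf : MemLp f p μ) {c : ℝ}
    (hc : 0 ≤ c) : eLpNorm f p μ ≤ ENNReal.ofReal c ↔ ∫ ω, |f ω| ^ p ∂μ ≤ c ^ p := by
  have hp' : (p : ℝ≥0∞) ≠ 0 := by exact_mod_cast hp
  rw [hf.eLpNorm_eq_integral_rpow_norm hp' (by simp), ENNReal.ofReal_le_ofReal_iff hc]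
  simp only [ENNReal.toReal_natCast, Real.norm_eq_abs, Real.rpow_natCast]
  have h0 : 0 ≤ ∫ ω, |f ω| ^ p ∂μ := integral_nonneg fun ω => by positivity
  constructor
  · intro h
    have := pow_le_pow_left₀ (by positivity) h p
    rwa [← Real.rpow_natCast, ← Real.rpow_mul h0, inv_mul_cancel₀ (by exact_mod_cast hp),
      Real.rpow_one] at this
  · intro h
    calc (∫ ω, |f ω| ^ p ∂μ) ^ ((p : ℝ)⁻¹) ≤ (c ^ p) ^ ((p : ℝ)⁻¹) :=
          Real.rpow_le_rpow h0 h (by positivity)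
      _ = c := Real.pow_rpow_inv_natCast hc hp

lemma integral_comp_measurePreserving {Ω' : Type*} [MeasurableSpace Ω'] {μ' : Measure Ω'}
    {φ : Ω → Ω'} (hφ : MeasurePreserving φ μ μ') {g : Ω' → ℝ} (hg : AEStronglyMeasurable g μ') :
    ∫ ω, g (φ ω) ∂μ = ∫ ω, g ω ∂μ' := by
  rw [← hφ.map_eq, integral_map hφ.measurable.aemeasurable (by rwa [hφ.map_eq])]

lemma memLp_four_sq {f : Ω → ℝ} (hf : MemLp f 4 μ) : MemLp (fun ω => f ω ^ 2) 2 μ := by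
  have h4 : ENNReal.HolderTriple 4 4 2 := ⟨by
    rw [show (4 : ℝ≥0∞) = 2 * 2 by norm_num, ENNReal.mul_inv (by simp) (by simp), ← mul_add,
      ENNReal.inv_two_add_inv_two, mul_one]⟩
  have := hf.mul hf (hpqr := h4)
  simp only [sq]
  exact this

lemma memLp_four_mul {f g : Ω → ℝ} (hf : MemLp f 4 μ) (hg : MemLp g 4 μ) :
    MemLp (fun ω => f ω * g ω) 2 μ := by
  have h4 : ENNReal.HolderTriple 4 4 2 := ⟨by
    rw [show (4 : ℝ≥0∞) = 2 * 2 by norm_num, ENNReal.mul_inv (by simp) (by simp), ← mul_add,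
      ENNReal.inv_two_add_inv_two, mul_one]⟩
  exact hg.mul hf (hpqr := h4)

lemma integral_sq_mul_sq_le {u v : Ω → ℝ} (hu : MemLp u 4 μ) (hv : MemLp v 4 μ) :
    ∫ ω, (u ω * v ω) ^ 2 ∂μ ≤ √(∫ ω, u ω ^ 4 ∂μ) * √(∫ ω, v ω ^ 4 ∂μ) := by
  have := integral_mul_le_sqrt (memLp_four_sq hu) (memLp_four_sq hv)
  simpa only [← mul_pow, ← pow_mul, Nat.reduceMul] using this

lemma memLp_two_of_four [IsFiniteMeasure μ] {f : Ω → ℝ} (hf : MemLp f 4 μ) : MemLp f 2 μ :=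
  hf.mono_exponent (by norm_num)

end Norms

/-! ### Swapping coordinates one at a time -/

section EfronStein

variable {ι : Type*} [DecidableEq ι] {E : Type*} [MeasurableSpace E] {ν : Measure E}
  [IsProbabilityMeasure ν]

lemma swapOn_singleton_swapOn {S : Set ι} {k : ι} (hk : k ∉ S) (w : ι → E × E) :
    swapOn {k} (swapOn S w) = swapOn (insert k S) w := by
  funext i
  by_cases hi : i = k
  · subst hi; simp [swapOn, hk]
  · by_cases hS : i ∈ S
    · have : i ∈ insert k S := Set.mem_insert_of_mem k hS
      simp [swapOn, hi, hS, this]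
    · have : i ∉ insert k S := fun h => (Set.mem_insert_iff.1 h).elim hi hS
      simp [swapOn, hi, hS, this]

lemma measurePreserving_update (k : ι) :
    MeasurePreserving (fun x : (ι → E) × E => Function.update x.1 k x.2)
      ((Measure.infinitePi fun _ : ι => ν).prod ν) (Measure.infinitePi fun _ : ι => ν) := by
  have hm : Measurable fun x : (ι → E) × E => Function.update x.1 k x.2 := by
    refine measurable_pi_lambda _ fun i => ?_
    by_cases hi : i = k
    · subst hi; simpa using measurable_snd
    · simp only [Function.update_of_ne hi]
      exact (measurable_pi_apply i).comp measurable_fst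
  refine ⟨hm, ?_⟩
  rw [← (measurePreserving_resample ν k).map_eq,
    Measure.map_map hm (measurePreserving_resample ν k).measurable]
  have : ((fun x : (ι → E) × E => Function.update x.1 k x.2) ∘
      fun w : ι → E × E => (firsts w, (w k).2)) = firsts ∘ swapOn {k} := by
    funext w
    simp only [Function.comp, firsts_swapOn_singleton]
  rw [this]
  exact ((measurePreserving_firsts ν).comp (measurePreserving_swapOn ν {k})).map_eq

lemma integral_resample {f : (ι → E) → ℝ}
    (hf : AEStronglyMeasurable f (Measure.infinitePi fun _ : ι => ν)) (k : ι)
    {φ : ℝ → ℝ → ℝ} (hφ : Continuous fun p : ℝ × ℝ => φ p.1 p.2) :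
    ∫ x, φ (f x.1) (f (Function.update x.1 k x.2)) ∂((Measure.infinitePi fun _ : ι => ν).prod ν)
      = ∫ w, φ (f (firsts w)) (f (firsts (swapOn {k} w)))
        ∂(Measure.infinitePi fun _ : ι => ν.prod ν) := by
  rw [← (measurePreserving_resample ν k).map_eq, integral_map]
  · simp only [firsts_swapOn_singleton]
  · exact (measurePreserving_resample ν k).measurable.aemeasurable
  · rw [(measurePreserving_resample ν k).map_eq]
    exact hφ.comp_aestronglyMeasurable
      ((hf.comp_measurePreserving measurePreserving_fst).prodMk
        (hf.comp_measurePreserving (measurePreserving_update k)))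

/-- Telescoping over the coordinates of `S`: each further swap lowers the correlation of `f` with
its swapped version by at most half the mean squared effect of resampling that coordinate. -/
lemma efronStein_finset {f : (ι → E) → ℝ} (hf : MemLp f 2 (Measure.infinitePi fun _ : ι => ν))
    (S : Finset ι) :
    (∫ w, f (firsts w) ^ 2 ∂(Measure.infinitePi fun _ : ι => ν.prod ν))
      - ∫ w, f (firsts w) * f (firsts (swapOn S w)) ∂(Measure.infinitePi fun _ : ι => ν.prod ν)
      ≤ ∑ k ∈ S, (∫ x, (f x.1 - f (Function.update x.1 k x.2)) ^ 2
        ∂((Measure.infinitePi fun _ : ι => ν).prod ν)) / 2 := by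
  set ρ := Measure.infinitePi fun _ : ι => ν.prod ν with hR
  have hF : MemLp (fun w => f (firsts w)) 2 ρ :=
    hf.comp_measurePreserving (measurePreserving_firsts ν)
  have hFS : ∀ T : Set ι, MemLp (fun w => f (firsts (swapOn T w))) 2 ρ := fun T =>
    hF.comp_measurePreserving (measurePreserving_swapOn ν T)
  induction S using Finset.induction_on with
  | empty =>
    have : ∀ w : ι → E × E, swapOn ((∅ : Finset ι) : Set ι) w = w := by
      intro w; funext i; simp [swapOn]
    simp only [this, sq, sub_self, Finset.sum_empty, le_refl]
  | insert k S hk ih =>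
    rw [Finset.sum_insert hk]
    have hk' : k ∉ (S : Set ι) := by simpa using hk
    rw [integral_resample hf.1 k (φ := fun a b => (a - b) ^ 2) (by fun_prop)]
    set F := fun w => f (firsts w) with hFdef
    have hU : MemLp (fun w => F w - F (swapOn {k} w)) 2 ρ := hF.sub (hFS {k})
    have hV : MemLp (fun w => F (swapOn S w) - F (swapOn (insert k (S : Set ι)) w)) 2 ρ :=
      (hFS S).sub (hFS _)
    -- Swapping coordinate `k` preserves the measure, turns `F` into its swapped version and
    -- reverses the sign of the increment.
    have e1 : ∫ w, F w * (F (swapOn S w) - F (swapOn (insert k (S : Set ι)) w)) ∂ρ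
        = ∫ w, F (swapOn {k} w) * (F (swapOn (insert k (S : Set ι)) w) - F (swapOn S w)) ∂ρ := by
      have hmp := measurePreserving_swapOn (E := E) ν ({k} : Set ι)
      rw [← integral_comp_measurePreserving hmp
        (integrable_mul_of_memLp_two hF hV).aestronglyMeasurable]
      simp only [← swapOn_insert hk', swapOn_insert' hk', hR]
    -- The increment is `F - F ∘ swapOn {k}` composed with the measure-preserving `swapOn S`.
    have e2 : ∫ w, (F (swapOn S w) - F (swapOn (insert k (S : Set ι)) w)) ^ 2 ∂ρ
        = ∫ w, (F w - F (swapOn {k} w)) ^ 2 ∂ρ := by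
      have hmp := measurePreserving_swapOn (E := E) ν (S : Set ι)
      rw [← integral_comp_measurePreserving hmp hU.integrable_sq.aestronglyMeasurable]
      simp only [swapOn_singleton_swapOn hk', hR]
    -- Averaging the two forms in `e1` gives a product of two increments, which by `e2` have equal
    -- second moments; `ab ≤ (a² + b²)/2` finishes.
    have e3 : 2 * ∫ w, F w * (F (swapOn S w) - F (swapOn (insert k (S : Set ι)) w)) ∂ρ
        ≤ ∫ w, (F w - F (swapOn {k} w)) ^ 2 ∂ρ := by
      have i1 := integrable_mul_of_memLp_two hF hV
      have i2 : Integrable (fun w => F (swapOn {k} w) *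
          (F (swapOn (insert k (S : Set ι)) w) - F (swapOn S w))) ρ :=
        integrable_mul_of_memLp_two (hFS {k}) ((hFS _).sub (hFS S))
      have i3 : 2 * ∫ w, F w * (F (swapOn S w) - F (swapOn (insert k (S : Set ι)) w)) ∂ρ
          = ∫ w, (F w - F (swapOn {k} w)) *
            (F (swapOn S w) - F (swapOn (insert k (S : Set ι)) w)) ∂ρ := by
        rw [two_mul]
        nth_rewrite 2 [e1]
        rw [← integral_add i1 i2]
        congr 1; funext w; ring
      have i4 : ∫ w, (F w - F (swapOn {k} w)) *
            (F (swapOn S w) - F (swapOn (insert k (S : Set ι)) w)) ∂ρ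
          ≤ ∫ w, ((F w - F (swapOn {k} w)) ^ 2 / 2 +
            (F (swapOn S w) - F (swapOn (insert k (S : Set ι)) w)) ^ 2 / 2) ∂ρ := by
        refine integral_mono (integrable_mul_of_memLp_two hU hV)
          ((hU.integrable_sq.div_const 2).add (hV.integrable_sq.div_const 2)) fun w => ?_
        nlinarith [sq_nonneg ((F w - F (swapOn {k} w)) -
          (F (swapOn S w) - F (swapOn (insert k (S : Set ι)) w)))]
      rw [integral_add (hU.integrable_sq.div_const 2) (hV.integrable_sq.div_const 2),
        integral_div, integral_div, e2] at i4
      linarith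
    have e4 : ∫ w, F w * (F (swapOn S w) - F (swapOn (insert k (S : Set ι)) w)) ∂ρ
        = (∫ w, F w * F (swapOn S w) ∂ρ) - ∫ w, F w * F (swapOn (insert k (S : Set ι)) w) ∂ρ := by
      rw [← integral_sub (integrable_mul_of_memLp_two hF (hFS S))
        (integrable_mul_of_memLp_two hF (hFS _))]
      congr 1; funext w; ring
    have e5 : (∫ w, F w * F (swapOn ((insert k S : Finset ι) : Set ι) w) ∂ρ)
        = ∫ w, F w * F (swapOn (insert k (S : Set ι)) w) ∂ρ := by
      rw [Finset.coe_insert]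
    simp only [hFdef] at *
    linarith

/-- For a centred function, the correlation with its resampled version on a large finite set of
coordinates is small. -/
lemma exists_finset_correlation_le {f : (ι → E) → ℝ}
    (hf : MemLp f 2 (Measure.infinitePi fun _ : ι => ν))
    (h0 : ∫ ω, f ω ∂(Measure.infinitePi fun _ : ι => ν) = 0) {ε : ℝ} (hε : 0 < ε) :
    ∃ S : Finset ι, ∫ w, f (firsts w) * f (firsts (swapOn S w))
      ∂(Measure.infinitePi fun _ : ι => ν.prod ν)
      ≤ 2 * ε * √(∫ ω, f ω ^ 2 ∂(Measure.infinitePi fun _ : ι => ν)) + 2 * ε ^ 2 := by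
  obtain ⟨g, hfg, hg, S, hS⟩ := exists_dependsOn_approx ν hf (ε := ENNReal.ofReal ε) (by simpa)
  refine ⟨S, ?_⟩
  set P := Measure.infinitePi fun _ : ι => ν with hP
  set ρ := Measure.infinitePi fun _ : ι => ν.prod ν with hR
  have hr : MemLp (fun ω => f ω - g ω) 2 P := hf.sub hg
  have hr2 : ∫ ω, (f ω - g ω) ^ 2 ∂P ≤ ε ^ 2 := by
    have := (eLpNorm_le_ofReal_iff (p := 2) two_ne_zero (by exact_mod_cast hr) hε.le).1
      (by exact_mod_cast hfg)
    simpa only [sq_abs] using this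
  have hmf := measurePreserving_firsts (ι := ι) (E := E) ν
  have hms := measurePreserving_swapOn (E := E) ν (S : Set ι)
  have lift : ∀ {u : (ι → E) → ℝ}, MemLp u 2 P →
      MemLp (fun w => u (firsts w)) 2 ρ ∧ MemLp (fun w => u (firsts (swapOn S w))) 2 ρ ∧
      (∫ w, u (firsts w) ^ 2 ∂ρ = ∫ ω, u ω ^ 2 ∂P) ∧
      (∫ w, u (firsts (swapOn S w)) ^ 2 ∂ρ = ∫ ω, u ω ^ 2 ∂P) := by
    intro u hu
    have h1 : MemLp (fun w => u (firsts w)) 2 ρ := hu.comp_measurePreserving hmf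
    refine ⟨h1, h1.comp_measurePreserving hms, ?_, ?_⟩
    · exact integral_comp_measurePreserving hmf hu.integrable_sq.1
    · exact integral_comp_measurePreserving (hmf.comp hms) hu.integrable_sq.1
  obtain ⟨f1, f2, f3, f4⟩ := lift hf
  obtain ⟨g1, g2, g3, g4⟩ := lift hg
  obtain ⟨r1, r2, r3, r4⟩ := lift hr
  have sq_r : √(∫ ω, (f ω - g ω) ^ 2 ∂P) ≤ ε := Real.sqrt_le_iff.2 ⟨hε.le, hr2⟩
  have b1 : ∫ w, (f (firsts w) - g (firsts w)) * f (firsts (swapOn S w)) ∂ρ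
      ≤ ε * √(∫ ω, f ω ^ 2 ∂P) := by
    refine (integral_mul_le_sqrt r1 f2).trans ?_
    rw [r3, f4]
    exact mul_le_mul_of_nonneg_right sq_r (Real.sqrt_nonneg _)
  have b2 : ∫ w, f (firsts w) * (f (firsts (swapOn S w)) - g (firsts (swapOn S w))) ∂ρ
      ≤ √(∫ ω, f ω ^ 2 ∂P) * ε := by
    refine (integral_mul_le_sqrt f1 r2).trans ?_
    rw [r4, f3]
    exact mul_le_mul_of_nonneg_left sq_r (Real.sqrt_nonneg _)
  have b3 : - ∫ w, (f (firsts w) - g (firsts w)) *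
      (f (firsts (swapOn S w)) - g (firsts (swapOn S w))) ∂ρ ≤ ε ^ 2 := by
    have := integral_mul_le_sqrt r1.neg r2
    simp only [Pi.neg_apply, neg_mul, integral_neg, neg_sq] at this
    refine this.trans ?_
    rw [r3, r4, Real.mul_self_sqrt (integral_nonneg fun _ => sq_nonneg _)]
    exact hr2
  -- Since `g` depends only on coordinates in `S`, swapping them makes its argument independent of
  -- the original, and the integral factorizes into `(∫ g)²`. As `f` is centred, `∫ g` is minus the
  -- mean of `f - g`.
  have b4 : ∫ w, g (firsts w) * g (firsts (swapOn S w)) ∂ρ ≤ ε ^ 2 := by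
    have hmu := measurePreserving_unzip (ι := ι) (E := E) ν
    have e1 : ∀ w : ι → E × E, g (firsts (swapOn S w)) = g (fun i => (w i).2) := by
      intro w
      refine hS fun i hi => ?_
      simp [firsts, swapOn, Finset.mem_coe.1 hi]
    have e2 : ∫ w, g (firsts w) * g (firsts (swapOn S w)) ∂ρ = (∫ ω, g ω ∂P) * ∫ ω, g ω ∂P := by
      simp only [e1]
      have := integral_map (μ := ρ) hmu.measurable.aemeasurable
        (f := fun z : (ι → E) × (ι → E) => g z.1 * g z.2) (by
          rw [hmu.map_eq]
          exact ((hg.comp_measurePreserving measurePreserving_fst).1).mul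
            ((hg.comp_measurePreserving measurePreserving_snd).1))
      rw [hmu.map_eq, integral_prod_mul] at this
      exact this.symm
    have e3 : ∫ ω, g ω ∂P = - ∫ ω, (f ω - g ω) ∂P := by
      rw [integral_sub (hf.integrable (by norm_num)) (hg.integrable (by norm_num)), h0]; ring
    rw [e2, e3]
    have := sq_integral_le hr
    nlinarith
  have key : ∫ w, f (firsts w) * f (firsts (swapOn S w)) ∂ρ
      = (∫ w, (f (firsts w) - g (firsts w)) * f (firsts (swapOn S w)) ∂ρ)
        + (∫ w, f (firsts w) * (f (firsts (swapOn S w)) - g (firsts (swapOn S w))) ∂ρ)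
        + (- ∫ w, (f (firsts w) - g (firsts w)) *
          (f (firsts (swapOn S w)) - g (firsts (swapOn S w))) ∂ρ)
        + ∫ w, g (firsts w) * g (firsts (swapOn S w)) ∂ρ := by
    have j1 := integrable_mul_of_memLp_two r1 f2
    have j2 := integrable_mul_of_memLp_two f1 r2
    have j3 := integrable_mul_of_memLp_two r1 r2
    have j4 := integrable_mul_of_memLp_two g1 g2
    rw [← integral_add j1 j2, ← sub_eq_add_neg, ← integral_sub (by exact j1.add j2) j3,
      ← integral_add (by exact (j1.add j2).sub j3) j4]
    congr 1; funext w; ring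
  rw [key]
  linarith

/-- A large finite `S` makes the correlation term of `efronStein_finset` as small as desired, while
the sum over `S` stays below the full series. -/
lemma efronStein_of_integral_eq_zero {f : (ι → E) → ℝ}
    (hf : MemLp f 2 (Measure.infinitePi fun _ : ι => ν))
    (h0 : ∫ ω, f ω ∂(Measure.infinitePi fun _ : ι => ν) = 0) {β : ι → ℝ} (hβ : Summable β)
    (h : ∀ k, ∫ x, (f x.1 - f (Function.update x.1 k x.2)) ^ 2
        ∂((Measure.infinitePi fun _ : ι => ν).prod ν) ≤ β k) :
    ∫ ω, f ω ^ 2 ∂(Measure.infinitePi fun _ : ι => ν) ≤ (∑' k, β k) / 2 := by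
  set P := Measure.infinitePi fun _ : ι => ν with hP
  set ρ := Measure.infinitePi fun _ : ι => ν.prod ν with hR
  have hβ0 : ∀ k, 0 ≤ β k := fun k => (integral_nonneg fun _ => sq_nonneg _).trans (h k)
  have hmf := measurePreserving_firsts (ι := ι) (E := E) ν
  have hsq : ∫ w, f (firsts w) ^ 2 ∂ρ = ∫ ω, f ω ^ 2 ∂P :=
    integral_comp_measurePreserving hmf hf.integrable_sq.1
  have bound : ∀ ε : ℝ, 0 < ε → ∫ ω, f ω ^ 2 ∂P
      ≤ (∑' k, β k) / 2 + (2 * ε * √(∫ ω, f ω ^ 2 ∂P) + 2 * ε ^ 2) := by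
    intro ε hε
    obtain ⟨S, hS⟩ := exists_finset_correlation_le hf h0 hε
    have h1 := efronStein_finset hf S
    have h2 : ∑ k ∈ S, (∫ x, (f x.1 - f (Function.update x.1 k x.2)) ^ 2 ∂(P.prod ν)) / 2
        ≤ (∑' k, β k) / 2 := by
      rw [← Finset.sum_div]
      exact div_le_div_of_nonneg_right ((Finset.sum_le_sum fun k _ => h k).trans
        (hβ.sum_le_tsum S fun k _ => hβ0 k)) (by norm_num)
    rw [hsq] at h1
    linarith
  have hlim : Tendsto (fun ε : ℝ => (∑' k, β k) / 2 + (2 * ε * √(∫ ω, f ω ^ 2 ∂P) + 2 * ε ^ 2))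
      (𝓝[>] 0) (𝓝 ((∑' k, β k) / 2 + (2 * 0 * √(∫ ω, f ω ^ 2 ∂P) + 2 * 0 ^ 2))) := by
    refine tendsto_nhdsWithin_of_tendsto_nhds (Continuous.tendsto ?_ 0)
    fun_prop
  have := ge_of_tendsto hlim (eventually_nhdsWithin_of_forall fun ε hε => bound ε hε)
  simpa using this

/-- **Efron–Stein inequality** on an arbitrary product of copies of a probability space. -/
theorem efronStein {f : (ι → E) → ℝ} (hf : MemLp f 2 (Measure.infinitePi fun _ : ι => ν))
    {β : ι → ℝ} (hβ : Summable β)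
    (h : ∀ k, ∫ x, (f x.1 - f (Function.update x.1 k x.2)) ^ 2
        ∂((Measure.infinitePi fun _ : ι => ν).prod ν) ≤ β k) :
    ∫ ω, (f ω - ∫ ω', f ω' ∂(Measure.infinitePi fun _ : ι => ν)) ^ 2
      ∂(Measure.infinitePi fun _ : ι => ν) ≤ (∑' k, β k) / 2 := by
  refine efronStein_of_integral_eq_zero (hf.sub (memLp_const _)) ?_ hβ ?_
  · simp [integral_sub (hf.integrable (by norm_num)) (integrable_const _)]
  · simpa using h

end EfronStein

/-! ### Moments of linear and quadratic forms through influences of coordinates -/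

section Moments

variable {ι : Type*} [DecidableEq ι] {E : Type*} [MeasurableSpace E] {ν : Measure E}
  [IsProbabilityMeasure ν]

lemma memLp_comp_fst {f : (ι → E) → ℝ} {p : ℝ≥0∞}
    (hf : MemLp f p (Measure.infinitePi fun _ : ι => ν)) :
    MemLp (fun x : (ι → E) × E => f x.1) p ((Measure.infinitePi fun _ : ι => ν).prod ν) :=
  hf.comp_measurePreserving measurePreserving_fst

lemma memLp_comp_update {f : (ι → E) → ℝ} {p : ℝ≥0∞}
    (hf : MemLp f p (Measure.infinitePi fun _ : ι => ν)) (k : ι) :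
    MemLp (fun x : (ι → E) × E => f (Function.update x.1 k x.2)) p
      ((Measure.infinitePi fun _ : ι => ν).prod ν) :=
  hf.comp_measurePreserving (measurePreserving_update k)

lemma integral_fourth_add_le {f : (ι → E) → ℝ}
    (hf : MemLp f 4 (Measure.infinitePi fun _ : ι => ν)) (k : ι) :
    ∫ x, (f x.1 + f (Function.update x.1 k x.2)) ^ 4 ∂((Measure.infinitePi fun _ : ι => ν).prod ν)
      ≤ 16 * ∫ ω, f ω ^ 4 ∂(Measure.infinitePi fun _ : ι => ν) := by
  have h4 : Integrable (fun ω => f ω ^ 4) (Measure.infinitePi fun _ : ι => ν) := by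
    have := (memLp_four_sq hf).integrable_sq
    simpa only [← pow_mul] using this
  have e1 := integral_comp_measurePreserving
    (measurePreserving_fst (μ := Measure.infinitePi fun _ : ι => ν) (ν := ν)) h4.1
  have e2 := integral_comp_measurePreserving (measurePreserving_update (ν := ν) k) h4.1
  have i1 : Integrable (fun x : (ι → E) × E => f x.1 ^ 4)
      ((Measure.infinitePi fun _ : ι => ν).prod ν) := measurePreserving_fst.integrable_comp_of_integrable h4
  have i2 : Integrable (fun x : (ι → E) × E => f (Function.update x.1 k x.2) ^ 4)
      ((Measure.infinitePi fun _ : ι => ν).prod ν) :=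
    (measurePreserving_update (ν := ν) k).integrable_comp_of_integrable h4
  have : ∫ x, (f x.1 + f (Function.update x.1 k x.2)) ^ 4
        ∂((Measure.infinitePi fun _ : ι => ν).prod ν)
      ≤ ∫ x, (8 * f x.1 ^ 4 + 8 * f (Function.update x.1 k x.2) ^ 4)
        ∂((Measure.infinitePi fun _ : ι => ν).prod ν) := by
    refine integral_mono ?_ ((i1.const_mul 8).add (i2.const_mul 8)) fun x => ?_
    · have := (memLp_four_sq ((memLp_comp_fst hf).add (memLp_comp_update hf k))).integrable_sq
      simpa only [Pi.add_apply, ← pow_mul, Nat.reduceMul] using this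
    · nlinarith [sq_nonneg (f x.1 - f (Function.update x.1 k x.2)),
        sq_nonneg (f x.1 + f (Function.update x.1 k x.2)),
        sq_nonneg (f x.1 ^ 2 - f (Function.update x.1 k x.2) ^ 2)]
  rw [integral_add (i1.const_mul 8) (i2.const_mul 8), integral_const_mul, integral_const_mul, e1,
    e2] at this
  linarith

lemma integral_sq_le_of_fourth {Ω : Type*} [MeasurableSpace Ω] {μ : Measure Ω}
    [IsProbabilityMeasure μ] {u : Ω → ℝ} (hu : MemLp u 4 μ) {c : ℝ}
    (h : ∫ ω, u ω ^ 4 ∂μ ≤ c ^ 4) : ∫ ω, u ω ^ 2 ∂μ ≤ c ^ 2 := by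
  have h1 := sq_integral_le (memLp_four_sq hu)
  simp only [← pow_mul, Nat.reduceMul] at h1
  refine abs_le_of_sq_le_sq' ?_ (sq_nonneg c) |>.2
  calc (∫ ω, u ω ^ 2 ∂μ) ^ 2 ≤ c ^ 4 := h1.trans h
    _ = (c ^ 2) ^ 2 := by ring

lemma variance_le_of_diff_four {f : (ι → E) → ℝ}
    (hf : MemLp f 4 (Measure.infinitePi fun _ : ι => ν))
    (h0 : ∫ ω, f ω ∂(Measure.infinitePi fun _ : ι => ν) = 0) {β : ι → ℝ}
    (hβ : Summable fun k => β k ^ 2)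
    (h : ∀ k, ∫ x, (f x.1 - f (Function.update x.1 k x.2)) ^ 4
        ∂((Measure.infinitePi fun _ : ι => ν).prod ν) ≤ β k ^ 4) :
    ∫ ω, f ω ^ 2 ∂(Measure.infinitePi fun _ : ι => ν) ≤ (∑' k, β k ^ 2) / 2 :=
  efronStein_of_integral_eq_zero (memLp_two_of_four hf) h0 hβ fun k =>
    integral_sq_le_of_fourth ((memLp_comp_fst hf).sub (memLp_comp_update hf k)) (h k)

/-- A fourth moment bound in terms of the `L⁴` influences of the coordinates. -/
theorem fourth_moment_le {f : (ι → E) → ℝ}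
    (hf : MemLp f 4 (Measure.infinitePi fun _ : ι => ν))
    (h0 : ∫ ω, f ω ∂(Measure.infinitePi fun _ : ι => ν) = 0) {β : ι → ℝ}
    (hβ : Summable fun k => β k ^ 2)
    (h : ∀ k, ∫ x, (f x.1 - f (Function.update x.1 k x.2)) ^ 4
        ∂((Measure.infinitePi fun _ : ι => ν).prod ν) ≤ β k ^ 4) :
    ∫ ω, f ω ^ 4 ∂(Measure.infinitePi fun _ : ι => ν) ≤ (3 * ∑' k, β k ^ 2) ^ 2 := by
  set P := Measure.infinitePi fun _ : ι => ν with hP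
  set A := ∑' k, β k ^ 2 with hA
  have hA0 : 0 ≤ A := tsum_nonneg fun k => sq_nonneg _
  have hvar := variance_le_of_diff_four hf h0 hβ h
  have hm0 : 0 ≤ ∫ ω, f ω ^ 4 ∂P := integral_nonneg fun ω => by positivity
  set x := √(∫ ω, f ω ^ 4 ∂P) with hx
  have hx2 : x ^ 2 = ∫ ω, f ω ^ 4 ∂P := Real.sq_sqrt hm0
  have hx0 : 0 ≤ x := Real.sqrt_nonneg _
  -- Efron–Stein for `f²`: write `f² - f'² = (f - f')(f + f')`. Cauchy–Schwarz bounds its second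
  -- moment by `β k ^ 2` times `4x`, the factor `4` coming from `integral_fourth_add_le`.
  have hes := efronStein (memLp_four_sq hf) (β := fun k => 4 * x * β k ^ 2) (hβ.mul_left _) (by
    intro k
    have hu := (memLp_comp_fst hf).sub (memLp_comp_update hf k)
    have hv := (memLp_comp_fst hf).add (memLp_comp_update hf k)
    have h1 := integral_sq_mul_sq_le hu hv
    simp only [Pi.sub_apply, Pi.add_apply] at h1
    have e : ∀ x : (ι → E) × E, (f x.1 ^ 2 - f (Function.update x.1 k x.2) ^ 2) ^ 2
        = ((f x.1 - f (Function.update x.1 k x.2)) * (f x.1 + f (Function.update x.1 k x.2))) ^ 2 :=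
      fun x => by ring
    simp only [e]
    refine h1.trans ?_
    have h2 : √(∫ x, (f x.1 - f (Function.update x.1 k x.2)) ^ 4 ∂(P.prod ν)) ≤ β k ^ 2 :=
      Real.sqrt_le_iff.2 ⟨sq_nonneg _, (h k).trans (by rw [← pow_mul])⟩
    have h3 : √(∫ x, (f x.1 + f (Function.update x.1 k x.2)) ^ 4 ∂(P.prod ν)) ≤ 4 * x := by
      refine Real.sqrt_le_iff.2 ⟨by positivity, (integral_fourth_add_le hf k).trans ?_⟩
      rw [mul_pow, hx2, ← hP]; norm_num
    calc _ ≤ β k ^ 2 * (4 * x) := mul_le_mul h2 h3 (Real.sqrt_nonneg _) (sq_nonneg _)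
      _ = 4 * x * β k ^ 2 := by ring)
  rw [tsum_mul_left, ← hA] at hes
  have hexp : ∫ ω, (f ω ^ 2 - ∫ ω', f ω' ^ 2 ∂P) ^ 2 ∂P
      = (∫ ω, f ω ^ 4 ∂P) - (∫ ω, f ω ^ 2 ∂P) ^ 2 := by
    set c := ∫ ω, f ω ^ 2 ∂P with hc
    have j1 : Integrable (fun ω => f ω ^ 4) P := by
      have := (memLp_four_sq hf).integrable_sq
      simpa only [← pow_mul] using this
    have j2 : Integrable (fun ω => f ω ^ 2) P := (memLp_two_of_four hf).integrable_sq
    have : ∀ ω, (f ω ^ 2 - c) ^ 2 = f ω ^ 4 - 2 * c * f ω ^ 2 + c ^ 2 := fun ω => by ring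
    simp only [this]
    rw [integral_add (by exact j1.sub (j2.const_mul (2 * c))) (integrable_const _),
      integral_sub j1 (j2.const_mul (2 * c)), integral_const_mul, ← hc]
    simp; ring
  rw [hexp] at hes
  have hv0 : 0 ≤ ∫ ω, f ω ^ 2 ∂P := integral_nonneg fun ω => sq_nonneg _
  rw [← hx2] at hes ⊢
  -- Since `E f² ≤ A/2`, the inequality reads `x² ≤ 2xA + A²/4`, which is impossible for `x > 3A`.
  have : x ≤ 3 * A := by
    by_contra hlt
    push Not at hlt
    nlinarith
  exact pow_le_pow_left₀ hx0 this 2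

/-- A finite family of centred functions with `L⁴` influences `t i k` whose row and column sums are
at most `Θ`. -/
structure InfluenceBound {κ : Type*} (ν : Measure E) [IsProbabilityMeasure ν] (I : Finset κ)
    (W : κ → (ι → E) → ℝ) (t : κ → ι → ℝ) (Θ : ℝ) : Prop where
  memLp : ∀ i ∈ I, MemLp (W i) 4 (Measure.infinitePi fun _ : ι => ν)
  mean : ∀ i ∈ I, ∫ ω, W i ω ∂(Measure.infinitePi fun _ : ι => ν) = 0
  nonneg : ∀ i k, 0 ≤ t i k
  diff : ∀ i ∈ I, ∀ k, eLpNorm (fun x : (ι → E) × E => W i x.1 - W i (Function.update x.1 k x.2)) 4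
    ((Measure.infinitePi fun _ : ι => ν).prod ν) ≤ ENNReal.ofReal (t i k)
  summable : ∀ i ∈ I, Summable (t i)
  row : ∀ i ∈ I, ∑' k, t i k ≤ Θ
  col : ∀ k, ∑ i ∈ I, t i k ≤ Θ

namespace InfluenceBound

variable {κ : Type*} {I : Finset κ} {W : κ → (ι → E) → ℝ} {t : κ → ι → ℝ} {Θ : ℝ}

lemma linear_memLp (H : InfluenceBound ν I W t Θ) (b : κ → ℝ) :
    MemLp (fun ω => ∑ i ∈ I, b i * W i ω) 4 (Measure.infinitePi fun _ : ι => ν) :=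
  memLp_finsetSum I fun i hi => (H.memLp i hi).const_mul (b i)

lemma linear_mean (H : InfluenceBound ν I W t Θ) (b : κ → ℝ) :
    ∫ ω, ∑ i ∈ I, b i * W i ω ∂(Measure.infinitePi fun _ : ι => ν) = 0 := by
  rw [integral_finsetSum I fun i hi => ((H.memLp i hi).integrable (by norm_num)).const_mul (b i)]
  refine Finset.sum_eq_zero fun i hi => ?_
  rw [integral_const_mul, H.mean i hi, mul_zero]

lemma linear_diff (H : InfluenceBound ν I W t Θ) (b : κ → ℝ) (k : ι) :
    ∫ x, ((∑ i ∈ I, b i * W i x.1) - ∑ i ∈ I, b i * W i (Function.update x.1 k x.2)) ^ 4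
      ∂((Measure.infinitePi fun _ : ι => ν).prod ν) ≤ (∑ i ∈ I, |b i| * t i k) ^ 4 := by
  have hmem := (memLp_comp_fst (H.linear_memLp b)).sub (memLp_comp_update (H.linear_memLp b) k)
  have h0 : 0 ≤ ∑ i ∈ I, |b i| * t i k :=
    Finset.sum_nonneg fun i _ => mul_nonneg (abs_nonneg _) (H.nonneg i k)
  have := (eLpNorm_le_ofReal_iff (p := 4) (by norm_num) (by exact_mod_cast hmem) h0).1 ?_
  · simpa only [Pi.sub_apply, Even.pow_abs (show Even 4 by decide)] using this
  · have e : ((fun x : (ι → E) × E => ∑ i ∈ I, b i * W i x.1) -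
        fun x => ∑ i ∈ I, b i * W i (Function.update x.1 k x.2))
        = ∑ i ∈ I, b i • fun x : (ι → E) × E => W i x.1 - W i (Function.update x.1 k x.2) := by
      funext x
      simp only [Pi.sub_apply, Finset.sum_apply, Pi.smul_apply, smul_eq_mul, mul_sub,
        Finset.sum_sub_distrib]
    rw [e, ENNReal.ofReal_sum_of_nonneg fun i _ => mul_nonneg (abs_nonneg _) (H.nonneg i k)]
    refine (eLpNorm_sum_le (fun i hi => ?_) (by norm_num)).trans (Finset.sum_le_sum fun i hi => ?_)
    · exact (((memLp_comp_fst (H.memLp i hi)).sub (memLp_comp_update (H.memLp i hi) k)).const_smul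
        (b i)).1
    · rw [eLpNorm_const_smul, ENNReal.ofReal_mul (abs_nonneg _), ← Real.enorm_eq_ofReal_abs]
      exact mul_le_mul_right (H.diff i hi k) _

/-- A Schur test: Cauchy–Schwarz with weights `t i k` uses the column sums, and the sum over `k`
then uses the row sums. -/
lemma sum_sq_le (H : InfluenceBound ν I W t Θ) (b : κ → ℝ) (hΘ : 0 ≤ Θ) :
    (Summable fun k => (∑ i ∈ I, |b i| * t i k) ^ 2) ∧
      ∑' k, (∑ i ∈ I, |b i| * t i k) ^ 2 ≤ Θ ^ 2 * ∑ i ∈ I, b i ^ 2 := by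
  have hpt : ∀ k, (∑ i ∈ I, |b i| * t i k) ^ 2 ≤ Θ * ∑ i ∈ I, b i ^ 2 * t i k := by
    intro k
    have h1 : (∑ i ∈ I, |b i| * t i k) ^ 2 ≤ (∑ i ∈ I, b i ^ 2 * t i k) * ∑ i ∈ I, t i k := by
      refine Finset.sum_sq_le_sum_mul_sum_of_sq_le_mul I
        (fun i _ => mul_nonneg (sq_nonneg _) (H.nonneg i k)) (fun i _ => H.nonneg i k) fun i _ => ?_
      rw [mul_pow, sq_abs]; exact le_of_eq (by ring)
    refine h1.trans ?_
    rw [mul_comm]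
    exact mul_le_mul_of_nonneg_right (H.col k)
      (Finset.sum_nonneg fun i _ => mul_nonneg (sq_nonneg _) (H.nonneg i k))
  have hs : ∀ i ∈ I, Summable fun k => b i ^ 2 * t i k := fun i hi => (H.summable i hi).mul_left _
  have hsum : Summable fun k => Θ * ∑ i ∈ I, b i ^ 2 * t i k := (summable_sum hs).mul_left Θ
  have hS := Summable.of_nonneg_of_le (fun k => sq_nonneg _) hpt hsum
  refine ⟨hS, (hS.tsum_le_tsum hpt hsum).trans ?_⟩
  rw [tsum_mul_left, Summable.tsum_finsetSum hs, sq, mul_assoc]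
  refine mul_le_mul_of_nonneg_left ?_ hΘ
  rw [Finset.mul_sum]
  refine Finset.sum_le_sum fun i hi => ?_
  rw [tsum_mul_left, mul_comm]
  exact mul_le_mul_of_nonneg_right (H.row i hi) (sq_nonneg _)

lemma linear_sq_le (H : InfluenceBound ν I W t Θ) (hΘ : 0 ≤ Θ) (b : κ → ℝ) :
    ∫ ω, (∑ i ∈ I, b i * W i ω) ^ 2 ∂(Measure.infinitePi fun _ : ι => ν)
      ≤ Θ ^ 2 * ∑ i ∈ I, b i ^ 2 := by
  obtain ⟨h1, h2⟩ := H.sum_sq_le b hΘ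
  refine (variance_le_of_diff_four (H.linear_memLp b) (H.linear_mean b) h1
    (H.linear_diff b)).trans ?_
  have : 0 ≤ ∑' k, (∑ i ∈ I, |b i| * t i k) ^ 2 := tsum_nonneg fun k => sq_nonneg _
  linarith

lemma linear_fourth_le (H : InfluenceBound ν I W t Θ) (hΘ : 0 ≤ Θ) (b : κ → ℝ) :
    ∫ ω, (∑ i ∈ I, b i * W i ω) ^ 4 ∂(Measure.infinitePi fun _ : ι => ν)
      ≤ (3 * (Θ ^ 2 * ∑ i ∈ I, b i ^ 2)) ^ 2 := by
  obtain ⟨h1, h2⟩ := H.sum_sq_le b hΘ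
  refine (fourth_moment_le (H.linear_memLp b) (H.linear_mean b) h1
    (H.linear_diff b)).trans ?_
  have : 0 ≤ ∑' k, (∑ i ∈ I, |b i| * t i k) ^ 2 := tsum_nonneg fun k => sq_nonneg _
  gcongr

/-- By symmetry of `a` the mixed terms cancel, and resampling changes the form by `∑ᵢ Uᵢ Yᵢ`, with
`Uᵢ` the change of `Wᵢ` and `Yᵢ` the sum of the old and new values of the linear form with
coefficients `a i`. Hölder with `L⁴` norms then bounds each product. -/
lemma quadratic_diff (H : InfluenceBound ν I W t Θ) (hΘ : 0 ≤ Θ) {a : κ → κ → ℝ}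
    (ha : ∀ i j, a i j = a j i) {c : ℝ} (hc : ∀ i ∈ I, ∑ j ∈ I, a i j ^ 2 ≤ c) (hc0 : 0 ≤ c)
    (k : ι) :
    ∫ x, ((∑ i ∈ I, ∑ j ∈ I, a i j * (W i x.1 * W j x.1)) -
        ∑ i ∈ I, ∑ j ∈ I, a i j * (W i (Function.update x.1 k x.2) *
          W j (Function.update x.1 k x.2))) ^ 2
      ∂((Measure.infinitePi fun _ : ι => ν).prod ν)
      ≤ 12 * Θ ^ 3 * c * ∑ i ∈ I, t i k := by
  set Q := (Measure.infinitePi fun _ : ι => ν).prod ν with hQ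
  -- `lam` bounds the `L⁴` norm of each linear form with coefficients `a i`, by `linear_fourth_le`;
  -- hence `Y i` has `L⁴` norm at most `2 * lam`.
  set lam := √(3 * (Θ ^ 2 * c)) with hlam
  have hlam0 : 0 ≤ lam := Real.sqrt_nonneg _
  have hlam2 : lam ^ 2 = 3 * (Θ ^ 2 * c) := Real.sq_sqrt (by positivity)
  set U : κ → (ι → E) × E → ℝ := fun i x => W i x.1 - W i (Function.update x.1 k x.2) with hU
  set Y : κ → (ι → E) × E → ℝ := fun i x => (∑ j ∈ I, a i j * W j x.1) +
    ∑ j ∈ I, a i j * W j (Function.update x.1 k x.2) with hY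
  have hUm : ∀ i ∈ I, MemLp (U i) 4 Q := fun i hi =>
    (memLp_comp_fst (H.memLp i hi)).sub (memLp_comp_update (H.memLp i hi) k)
  have hYm : ∀ i ∈ I, MemLp (Y i) 4 Q := fun i hi =>
    (memLp_comp_fst (H.linear_memLp (a i))).add (memLp_comp_update (H.linear_memLp (a i)) k)
  have e : ∀ x : (ι → E) × E, (∑ i ∈ I, ∑ j ∈ I, a i j * (W i x.1 * W j x.1)) -
        ∑ i ∈ I, ∑ j ∈ I, a i j * (W i (Function.update x.1 k x.2) *
          W j (Function.update x.1 k x.2)) = ∑ i ∈ I, U i x * Y i x := by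
    intro x
    have h1 : ∑ i ∈ I, ∑ j ∈ I, a i j * (W i x.1 * W j (Function.update x.1 k x.2))
        = ∑ i ∈ I, ∑ j ∈ I, a i j * (W i (Function.update x.1 k x.2) * W j x.1) := by
      rw [Finset.sum_comm]
      refine Finset.sum_congr rfl fun i _ => Finset.sum_congr rfl fun j _ => ?_
      rw [ha j i]; ring
    have h2 : ∑ i ∈ I, U i x * Y i x
        = (∑ i ∈ I, ∑ j ∈ I, a i j * (W i x.1 * W j x.1))
          + (∑ i ∈ I, ∑ j ∈ I, a i j * (W i x.1 * W j (Function.update x.1 k x.2)))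
          - (∑ i ∈ I, ∑ j ∈ I, a i j * (W i (Function.update x.1 k x.2) * W j x.1))
          - ∑ i ∈ I, ∑ j ∈ I, a i j * (W i (Function.update x.1 k x.2) *
            W j (Function.update x.1 k x.2)) := by
      simp only [← Finset.sum_add_distrib, ← Finset.sum_sub_distrib, hU, hY, Finset.mul_sum]
      refine Finset.sum_congr rfl fun i _ => Finset.sum_congr rfl fun j _ => ?_
      ring
    rw [h2, h1]; ring
  simp only [e]
  have hterm : ∀ i ∈ I, eLpNorm (fun x => U i x * Y i x) 2 Q ≤ ENNReal.ofReal (2 * lam * t i k) := by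
    intro i hi
    have ht := H.nonneg i k
    refine (eLpNorm_le_ofReal_iff (p := 2) two_ne_zero
      (by exact_mod_cast memLp_four_mul (hUm i hi) (hYm i hi)) (by positivity)).2 ?_
    simp only [sq_abs]
    refine (integral_sq_mul_sq_le (hUm i hi) (hYm i hi)).trans ?_
    have h1 : √(∫ x, U i x ^ 4 ∂Q) ≤ t i k ^ 2 := by
      have := (eLpNorm_le_ofReal_iff (p := 4) (by norm_num) (by exact_mod_cast hUm i hi) ht).1
        (by exact_mod_cast H.diff i hi k)
      simp only [Even.pow_abs (show Even 4 by decide)] at this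
      exact Real.sqrt_le_iff.2 ⟨sq_nonneg _, this.trans (by rw [← pow_mul])⟩
    have h2 : √(∫ x, Y i x ^ 4 ∂Q) ≤ 4 * lam ^ 2 := by
      refine Real.sqrt_le_iff.2 ⟨by positivity,
        (integral_fourth_add_le (H.linear_memLp (a i)) k).trans ?_⟩
      have h3 : 3 * (Θ ^ 2 * ∑ j ∈ I, a i j ^ 2) ≤ lam ^ 2 := by
        rw [hlam2]; have := hc i hi; gcongr
      have h4 := pow_le_pow_left₀ (by positivity) h3 2
      have := (H.linear_fourth_le hΘ (a i)).trans h4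
      linarith
    calc _ ≤ t i k ^ 2 * (4 * lam ^ 2) := mul_le_mul h1 h2 (Real.sqrt_nonneg _) (sq_nonneg _)
      _ = (2 * lam * t i k) ^ 2 := by ring
  have ht0 : 0 ≤ ∑ i ∈ I, t i k := Finset.sum_nonneg fun i _ => H.nonneg i k
  have hsum : eLpNorm (fun x => ∑ i ∈ I, U i x * Y i x) 2 Q
      ≤ ENNReal.ofReal (2 * lam * ∑ i ∈ I, t i k) := by
    have e2 : (fun x => ∑ i ∈ I, U i x * Y i x) = ∑ i ∈ I, fun x => U i x * Y i x := by
      funext x; simp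
    rw [e2, Finset.mul_sum, ENNReal.ofReal_sum_of_nonneg fun i _ =>
      mul_nonneg (mul_nonneg two_pos.le hlam0) (H.nonneg i k)]
    exact (eLpNorm_sum_le (fun i hi => (memLp_four_mul (hUm i hi) (hYm i hi)).1)
      (by norm_num)).trans (Finset.sum_le_sum hterm)
  have hfin := (eLpNorm_le_ofReal_iff (p := 2) two_ne_zero (by
    exact_mod_cast memLp_finsetSum I fun i hi => memLp_four_mul (hUm i hi) (hYm i hi))
    (c := 2 * lam * ∑ i ∈ I, t i k) (by positivity)).1 (by exact_mod_cast hsum)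
  simp only [sq_abs] at hfin
  refine hfin.trans ?_
  have := H.col k
  calc (2 * lam * ∑ i ∈ I, t i k) ^ 2 = 4 * lam ^ 2 * ((∑ i ∈ I, t i k) * ∑ i ∈ I, t i k) := by ring
    _ ≤ 4 * lam ^ 2 * (Θ * ∑ i ∈ I, t i k) := by gcongr
    _ = 12 * Θ ^ 3 * c * ∑ i ∈ I, t i k := by rw [hlam2]; ring

lemma quadratic_memLp (H : InfluenceBound ν I W t Θ) (a : κ → κ → ℝ) :
    MemLp (fun ω => ∑ i ∈ I, ∑ j ∈ I, a i j * (W i ω * W j ω)) 2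
      (Measure.infinitePi fun _ : ι => ν) :=
  memLp_finsetSum I fun i hi => memLp_finsetSum I fun j hj =>
    (memLp_four_mul (H.memLp i hi) (H.memLp j hj)).const_mul (a i j)

/-- The variance of a quadratic form. -/
theorem quadratic_variance_le (H : InfluenceBound ν I W t Θ) (hΘ : 0 ≤ Θ) {a : κ → κ → ℝ}
    (ha : ∀ i j, a i j = a j i) {c : ℝ} (hc : ∀ i ∈ I, ∑ j ∈ I, a i j ^ 2 ≤ c) (hc0 : 0 ≤ c) :
    ∫ ω, ((∑ i ∈ I, ∑ j ∈ I, a i j * (W i ω * W j ω)) -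
        ∫ ω', ∑ i ∈ I, ∑ j ∈ I, a i j * (W i ω' * W j ω')
          ∂(Measure.infinitePi fun _ : ι => ν)) ^ 2 ∂(Measure.infinitePi fun _ : ι => ν)
      ≤ 6 * Θ ^ 4 * c * I.card := by
  have hs : Summable fun k => 12 * Θ ^ 3 * c * ∑ i ∈ I, t i k :=
    (summable_sum H.summable).mul_left _
  refine (efronStein (H.quadratic_memLp a) hs (H.quadratic_diff hΘ ha hc hc0)).trans ?_
  rw [tsum_mul_left, Summable.tsum_finsetSum H.summable]
  have : ∑ i ∈ I, ∑' k, t i k ≤ I.card * Θ := by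
    refine (Finset.sum_le_sum H.row).trans ?_
    simp
  calc 12 * Θ ^ 3 * c * (∑ i ∈ I, ∑' k, t i k) / 2 ≤ 12 * Θ ^ 3 * c * (I.card * Θ) / 2 := by gcongr
    _ = 6 * Θ ^ 4 * c * I.card := by ring

end InfluenceBound

end Moments

/-! ### Stationarity and influences of the noise -/

namespace NoiseModel

variable (N : NoiseModel.{u})

instance : IsProbabilityMeasure N.P := by unfold P; infer_instance

/-- The time shift. -/
def shift {E : Type*} (k : ℤ) (ω : ℤ → E) : ℤ → E := fun j => ω (j + k)

lemma measurePreserving_shift (k : ℤ) : MeasurePreserving (shift (E := N.E) k) N.P N.P := by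
  have h : shift (E := N.E) k = MeasurableEquiv.piCongrLeft (fun _ : ℤ => N.E) (Equiv.subRight k) := by
    funext ω j
    have := Equiv.piCongrLeft_apply_apply (fun _ : ℤ => N.E) (Equiv.subRight k) ω (j + k)
    simp only [Equiv.subRight_apply, add_sub_cancel_right] at this
    rw [MeasurableEquiv.coe_piCongrLeft, this, shift]
  refine ⟨by rw [h]; exact MeasurableEquiv.measurable _, ?_⟩
  rw [h]
  exact Measure.infinitePi_map_piCongrLeft (fun _ : ℤ => N.ν) (Equiv.subRight k)

lemma Z_add (i k : ℤ) (ω : ℤ → N.E) : N.Z (i + k) ω = N.Z i (shift k ω) := by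
  simp only [Z, shift]
  congr 1; funext j; congr 1; ring

lemma measurable_Z (i : ℤ) : Measurable (N.Z i) :=
  N.measurable_g.comp (measurable_pi_lambda _ fun _ => measurable_pi_apply _)

variable {N}

lemma WeaklyDependent.memLp (hN : N.WeaklyDependent) (i : ℤ) : MemLp (N.Z i) 4 N.P := by
  obtain ⟨r, hr, hmem⟩ := hN.moment
  have h1 : MemLp (N.Z 1) 4 N.P := hmem.mono_exponent (by
    rw [show (4 : ℝ≥0∞) = ENNReal.ofReal 4 by simp]
    exact ENNReal.ofReal_le_ofReal hr.le)
  have := h1.comp_measurePreserving (N.measurePreserving_shift (i - 1))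
  have e : N.Z 1 ∘ shift (i - 1) = N.Z i := by
    funext ω
    rw [Function.comp, ← Z_add]; congr 1; ring
  rwa [e] at this

lemma WeaklyDependent.mean (hN : N.WeaklyDependent) (i : ℤ) : ∫ ω, N.Z i ω ∂N.P = 0 := by
  rw [← hN.mean_zero, ← integral_comp_measurePreserving (N.measurePreserving_shift (i - 1))
    (N.measurable_Z 1).aestronglyMeasurable]
  congr 1; funext ω
  rw [← Z_add]; congr 1; ring

lemma WeaklyDependent.integral_mul (hN : N.WeaklyDependent) (i j : ℤ) :
    ∫ ω, N.Z i ω * N.Z j ω ∂N.P = N.acvf (j - i) := by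
  have h1 : N.acvf (j - i) = ∫ ω, N.Z 0 ω * N.Z (j - i) ω ∂N.P := by
    rw [acvf, covariance, hN.mean, hN.mean]; simp
  rw [h1, ← integral_comp_measurePreserving (N.measurePreserving_shift i)
    (g := fun ω => N.Z 0 ω * N.Z (j - i) ω)
    ((N.measurable_Z 0).mul (N.measurable_Z (j - i))).aestronglyMeasurable]
  congr 1; funext ω
  simp only [← Z_add]
  congr 2 <;> ring

lemma WeaklyDependent.acvf_neg (hN : N.WeaklyDependent) (k : ℤ) : N.acvf (-k) = N.acvf k := by
  have h1 := hN.integral_mul 0 k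
  have h2 := hN.integral_mul k 0
  simp only [sub_zero, zero_sub] at h1 h2
  rw [← h1, ← h2]; congr 1; funext ω; ring

variable (N) in
/-- The influence of `ε_0` on `Z_z`, as a function on `ℤ`. -/
def infl (z : ℤ) : ℝ := if 0 ≤ z then (N.theta 4 z.toNat).toReal else 0

lemma infl_nonneg (z : ℤ) : 0 ≤ N.infl z := by
  unfold infl; split_ifs
  exacts [ENNReal.toReal_nonneg, le_rfl]

lemma WeaklyDependent.summable_infl (hN : N.WeaklyDependent) : Summable N.infl := by
  have h1 : Summable fun n : ℕ => (N.theta 4 n).toReal := ENNReal.summable_toReal hN.stable.ne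
  have h2 := (Nat.cast_injective (R := ℤ)).summable_iff (f := N.infl) (fun z hz => by
    unfold infl
    rw [if_neg]
    intro h0
    exact hz ⟨z.toNat, Int.toNat_of_nonneg h0⟩)
  rw [← h2]
  convert h1 using 2 with n
  simp [infl]

/-- Shifting time by `k` moves the resampled innovation to time zero. An innovation later than `i`
has no effect, by causality. -/
lemma WeaklyDependent.eLpNorm_diff_le (hN : N.WeaklyDependent) (i k : ℤ) :
    eLpNorm (fun x : (ℤ → N.E) × N.E => N.Z i x.1 - N.Z i (Function.update x.1 k x.2)) 4
      (N.P.prod N.ν) ≤ ENNReal.ofReal (N.infl (i - k)) := by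
  by_cases hik : 0 ≤ i - k
  · have hfin : N.theta 4 (i - k).toNat ≠ ∞ := ENNReal.ne_top_of_tsum_ne_top hN.stable.ne _
    rw [infl, if_pos hik, ENNReal.ofReal_toReal hfin, theta, Int.toNat_of_nonneg hik]
    have hmp : MeasurePreserving (Prod.map (shift k) id : (ℤ → N.E) × N.E → (ℤ → N.E) × N.E)
        (N.P.prod N.ν) (N.P.prod N.ν) :=
      (N.measurePreserving_shift k).prod (MeasurePreserving.id _)
    have hm : AEStronglyMeasurable (fun x : (ℤ → N.E) × N.E =>
        N.Z (i - k) x.1 - N.Z (i - k) (Function.update x.1 0 x.2)) (N.P.prod N.ν) :=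
      (((hN.memLp (i - k)).comp_measurePreserving measurePreserving_fst).sub
        ((hN.memLp (i - k)).comp_measurePreserving (measurePreserving_update 0))).1
    rw [← eLpNorm_comp_measurePreserving hm hmp]
    refine le_of_eq (congrArg (fun f => eLpNorm f 4 _) ?_)
    funext x
    have hu : Function.update (shift k x.1) 0 x.2 = shift k (Function.update x.1 k x.2) := by
      funext j
      by_cases hj : j = 0
      · subst hj; simp [shift]
      · have : j + k ≠ k := by omega
        simp [shift, Function.update_of_ne hj, Function.update_of_ne this]
    simp only [Function.comp, Prod.map, id, hu, ← Z_add, sub_add_cancel]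
  · have : ∀ x : (ℤ → N.E) × N.E, N.Z i (Function.update x.1 k x.2) = N.Z i x.1 := by
      intro x
      simp only [Z]
      congr 1; funext j
      rw [Function.update_of_ne]
      omega
    simp [this]

/-- The differenced noise `∑_j d_j Z_{i-jh}`. -/
def W (N : NoiseModel.{u}) (m : ℕ) (d : ℕ → ℝ) (h : ℕ) (i : ℤ) (ω : ℤ → N.E) : ℝ :=
  ∑ j ∈ range (m + 1), d j * N.Z (i - (j : ℤ) * h) ω

/-- The bound for the total influence in the differenced noise. -/
def totalInfl (N : NoiseModel.{u}) (m : ℕ) (d : ℕ → ℝ) : ℝ :=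
  (∑ j ∈ range (m + 1), |d j|) * ∑' z, N.infl z

lemma totalInfl_nonneg (m : ℕ) (d : ℕ → ℝ) : 0 ≤ N.totalInfl m d :=
  mul_nonneg (Finset.sum_nonneg fun _ _ => abs_nonneg _) (tsum_nonneg fun _ => infl_nonneg _)

/-- Rows and columns are weighted sums of translates of the single summable sequence `infl`. The
resulting bound involves neither `h` nor the index set, so the moment bounds are uniform in `n`. -/
theorem WeaklyDependent.influenceBound (hN : N.WeaklyDependent) (m : ℕ) (d : ℕ → ℝ) (h : ℕ)
    (I : Finset ℤ) :
    InfluenceBound N.ν I (N.W m d h)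
      (fun i k => ∑ j ∈ range (m + 1), |d j| * N.infl (i - (j : ℤ) * h - k)) (N.totalInfl m d) where
  memLp i _ := memLp_finsetSum _ fun j _ => (hN.memLp _).const_mul (d j)
  mean i _ := by
    have : ∫ ω, ∑ j ∈ range (m + 1), d j * N.Z (i - (j : ℤ) * h) ω ∂N.P = 0 := by
      rw [integral_finsetSum _ fun (j : ℕ) _ =>
        (((hN.memLp (i - (j : ℤ) * h)).integrable (by norm_num)).const_mul (d j))]
      refine Finset.sum_eq_zero fun j _ => ?_
      rw [integral_const_mul, hN.mean, mul_zero]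
    exact this
  nonneg i k := Finset.sum_nonneg fun j _ => mul_nonneg (abs_nonneg _) (infl_nonneg _)
  diff i _ k := by
    have e : (fun x : (ℤ → N.E) × N.E => N.W m d h i x.1 - N.W m d h i (Function.update x.1 k x.2))
        = ∑ j ∈ range (m + 1), d j • fun x : (ℤ → N.E) × N.E =>
          N.Z (i - (j : ℤ) * h) x.1 - N.Z (i - (j : ℤ) * h) (Function.update x.1 k x.2) := by
      funext x
      simp only [W, Finset.sum_apply, Pi.smul_apply, smul_eq_mul, mul_sub, Finset.sum_sub_distrib]
    rw [e, ENNReal.ofReal_sum_of_nonneg fun j _ => mul_nonneg (abs_nonneg _) (infl_nonneg _)]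
    refine (eLpNorm_sum_le (fun j hj => ?_) (by norm_num)).trans (Finset.sum_le_sum fun j hj => ?_)
    · exact (((memLp_comp_fst (hN.memLp _)).sub (memLp_comp_update (hN.memLp _) k)).const_smul
        (d j)).1
    · rw [eLpNorm_const_smul, ENNReal.ofReal_mul (abs_nonneg _), ← Real.enorm_eq_ofReal_abs]
      exact mul_le_mul_right (hN.eLpNorm_diff_le _ k) _
  summable i _ := summable_sum fun j _ =>
    (((Equiv.subLeft (i - (j : ℤ) * h)).summable_iff).2 hN.summable_infl).mul_left _
  row i _ := by
    have hs : ∀ j ∈ range (m + 1), Summable fun k => |d j| * N.infl (i - (j : ℤ) * h - k) :=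
      fun j _ => (((Equiv.subLeft (i - (j : ℤ) * h)).summable_iff).2 hN.summable_infl).mul_left _
    rw [Summable.tsum_finsetSum hs, totalInfl, Finset.sum_mul]
    refine le_of_eq (Finset.sum_congr rfl fun j _ => ?_)
    rw [tsum_mul_left]
    congr 1
    exact (Equiv.subLeft (i - (j : ℤ) * h)).tsum_eq N.infl
  col k := by
    rw [Finset.sum_comm, totalInfl, Finset.sum_mul]
    refine Finset.sum_le_sum fun j _ => ?_
    rw [← Finset.mul_sum]
    refine mul_le_mul_of_nonneg_left ?_ (abs_nonneg _)
    have hs := ((Equiv.subRight ((j : ℤ) * h + k)).summable_iff).2 hN.summable_infl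
    have h1 := hs.sum_le_tsum I fun i _ => infl_nonneg _
    rw [← (Equiv.subRight ((j : ℤ) * h + k)).tsum_eq N.infl]
    refine le_trans (le_of_eq (Finset.sum_congr rfl fun i _ => ?_)) h1
    simp only [Equiv.subRight_apply]
    congr 1; ring

end NoiseModel

/-! ### The estimator as a quadratic form -/

/-- The lags `k` and `-k` both produce pairs below the diagonal. For `k < 0` the symmetry of `F`
reflects them to the pairs above it. -/
lemma sum_Ioo_band {c : ℤ → ℝ} {ℓ : ℤ} (hc : ∀ k, ℓ ≤ |k| → c k = 0)
    {F : ℤ → ℤ → ℝ} (hF : ∀ i j, F i j = F j i) (a b : ℤ) :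
    ∑ k ∈ Ioo (-ℓ) ℓ, c k * ∑ i ∈ Icc (a + |k|) b, F i (i - |k|)
      = ∑ i ∈ Icc a b, ∑ j ∈ Icc a b, c (i - j) * F i j := by
  have h1 : ∀ i ∈ Icc a b, ∑ j ∈ Icc a b, c (i - j) * F i j
      = ∑ k ∈ Ioo (-ℓ) ℓ, if i - k ∈ Icc a b then c k * F i (i - k) else 0 := by
    intro i _
    have e1 : ∑ j ∈ Icc a b, c (i - j) * F i j
        = ∑ j ∈ (Icc a b).filter (fun j => i - j ∈ Ioo (-ℓ) ℓ), c (i - j) * F i j := by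
      rw [Finset.sum_filter_of_ne]
      intro j _ hne
      rw [Finset.mem_Ioo, ← abs_lt]
      by_contra hcon
      exact hne (by rw [hc _ (not_lt.1 hcon), zero_mul])
    rw [e1, ← Finset.sum_filter]
    refine Finset.sum_nbij' (fun j => i - j) (fun k => i - k) ?_ ?_ (by simp) (by simp) (by simp)
    · intro j; simp only [Finset.mem_filter, Finset.mem_Icc, Finset.mem_Ioo]; omega
    · intro j; simp only [Finset.mem_filter, Finset.mem_Icc, Finset.mem_Ioo]; omega
  rw [Finset.sum_congr rfl h1, Finset.sum_comm]
  refine Finset.sum_congr rfl fun k _ => ?_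
  rw [Finset.mul_sum, ← Finset.sum_filter]
  rcases le_or_gt 0 k with hk | hk
  · rw [abs_of_nonneg hk]
    refine Finset.sum_congr ?_ fun i _ => rfl
    ext i; simp only [Finset.mem_filter, Finset.mem_Icc]; omega
  · rw [abs_of_neg hk]
    refine Finset.sum_nbij' (fun i => i + k) (fun i => i - k) ?_ ?_ ?_ ?_ ?_
    · intro i; simp only [Finset.mem_filter, Finset.mem_Icc]; omega
    · intro i; simp only [Finset.mem_filter, Finset.mem_Icc]; omega
    · intro i _; ring
    · intro i _; ring
    · intro i _
      rw [hF (i + k)]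
      congr 2 <;> ring

/-- The band quadratic form with weights `K((i-j)/ℓ)/n` on the times `mh < i ≤ n`. -/
def qform (K : ℝ → ℝ) (m n ℓ h : ℕ) (x y : ℤ → ℝ) : ℝ :=
  ∑ i ∈ Icc ((m : ℤ) * h + 1) n, ∑ j ∈ Icc ((m : ℤ) * h + 1) n,
    (1 / (n : ℝ) * K (((i - j : ℤ) : ℝ) / ℓ)) * (x i * y j)

lemma IsKernel.support_int {K : ℝ → ℝ} (hK : IsKernel K) {ℓ : ℕ} (hℓ : 1 ≤ ℓ) {k : ℤ}
    (hk : (ℓ : ℤ) ≤ |k|) : K ((k : ℝ) / ℓ) = 0 := by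
  refine hK.support _ ?_
  have hℓ0 : (0 : ℝ) < ℓ := by exact_mod_cast hℓ
  rw [abs_div, Nat.abs_cast, le_div_iff₀ hℓ0, one_mul]
  exact_mod_cast hk

lemma IsKernel.even_int {K : ℝ → ℝ} (hK : IsKernel K) (ℓ : ℕ) (k : ℤ) :
    K (((-k : ℤ) : ℝ) / ℓ) = K ((k : ℝ) / ℓ) := by
  rw [← hK.even]; congr 1; push_cast; ring

lemma sum_band_eq_qform {K : ℝ → ℝ} (hK : IsKernel K) {m n ℓ h : ℕ} (hℓ : 1 ≤ ℓ) (x : ℤ → ℝ) :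
    ∑ k ∈ Ioo (-(ℓ : ℤ)) ℓ, K ((k : ℝ) / ℓ) * (1 / (n : ℝ) *
      ∑ i ∈ Icc ((m : ℤ) * h + |k| + 1) n, x i * x (i - |k|)) = qform K m n ℓ h x x := by
  have := sum_Ioo_band (c := fun k => 1 / (n : ℝ) * K ((k : ℝ) / ℓ)) (ℓ := ℓ)
    (fun k hk => by simp only [hK.support_int hℓ hk, mul_zero])
    (F := fun i j => x i * x j) (fun i j => mul_comm _ _)
    ((m : ℤ) * h + 1) n
  rw [qform, ← this]
  refine Finset.sum_congr rfl fun k _ => ?_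
  rw [show (m : ℤ) * h + |k| + 1 = (m : ℤ) * h + 1 + |k| by ring]
  ring

lemma qform_add {K : ℝ → ℝ} (m n ℓ h : ℕ) (x y z : ℤ → ℝ) :
    qform K m n ℓ h (fun i => x i + y i) z = qform K m n ℓ h x z + qform K m n ℓ h y z := by
  simp only [qform, ← Finset.sum_add_distrib]
  refine Finset.sum_congr rfl fun i _ => Finset.sum_congr rfl fun j _ => ?_
  ring

lemma qform_smul {K : ℝ → ℝ} (m n ℓ h : ℕ) (c : ℝ) (x y : ℤ → ℝ) :
    qform K m n ℓ h (fun i => c * x i) y = c * qform K m n ℓ h x y := by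
  simp only [qform, Finset.mul_sum]
  refine Finset.sum_congr rfl fun i _ => Finset.sum_congr rfl fun j _ => ?_
  ring

lemma qform_comm {K : ℝ → ℝ} (hK : IsKernel K) (m n ℓ h : ℕ) (x y : ℤ → ℝ) :
    qform K m n ℓ h x y = qform K m n ℓ h y x := by
  rw [qform, Finset.sum_comm]
  refine Finset.sum_congr rfl fun i _ => Finset.sum_congr rfl fun j _ => ?_
  rw [← hK.even_int]
  rw [show (-(j - i) : ℤ) = i - j by ring]
  ring

lemma qform_add_add {K : ℝ → ℝ} (hK : IsKernel K) (m n ℓ h : ℕ) (x y : ℤ → ℝ) :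
    qform K m n ℓ h (fun i => x i + y i) (fun i => x i + y i)
      = qform K m n ℓ h x x + 2 * qform K m n ℓ h x y + qform K m n ℓ h y y := by
  rw [qform_add, qform_comm hK m n ℓ h x (fun i => x i + y i),
    qform_comm hK m n ℓ h y (fun i => x i + y i), qform_add, qform_add, qform_comm hK m n ℓ h y x]
  ring

/-- The differenced mean `∑_j d_j μ((i-jh)/n)`. -/
def MeanModel.M (M : MeanModel) (m : ℕ) (d : ℕ → ℝ) (n h : ℕ) (i : ℤ) : ℝ :=
  ∑ j ∈ range (m + 1), d j * M.mu n (((i - (j : ℤ) * h : ℤ) : ℝ) / n)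

namespace DGM

variable (G : DGM.{u})

lemma D_eq (m : ℕ) (d : ℕ → ℝ) (n h : ℕ) (i : ℤ) (ω : ℤ → G.noise.E) :
    G.D m d n h i ω = G.mean.M m d n h i + G.noise.W m d h i ω := by
  simp only [D, X, MeanModel.M, NoiseModel.W, mul_add, Finset.sum_add_distrib]

lemma vHat_eq {K : ℝ → ℝ} (hK : IsKernel K) (m : ℕ) (d : ℕ → ℝ) {n ℓ : ℕ} (h : ℕ) (hℓ : 1 ≤ ℓ)
    (ω : ℤ → G.noise.E) :
    G.vHat K m d n ℓ h ω
      = qform K m n ℓ h (G.mean.M m d n h) (G.mean.M m d n h)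
        + 2 * qform K m n ℓ h (G.mean.M m d n h) (fun i => G.noise.W m d h i ω)
        + qform K m n ℓ h (fun i => G.noise.W m d h i ω) (fun i => G.noise.W m d h i ω) := by
  rw [← qform_add_add hK]
  simp only [← D_eq]
  rw [← sum_band_eq_qform hK hℓ]
  rfl

end DGM

/-! ### The bias -/

/-- The weight `K(x/ℓ)(1 - (mh + |x|)/n)`. -/
def wKernel (K : ℝ → ℝ) (m n ℓ h : ℕ) (x : ℤ) : ℝ :=
  K ((x : ℝ) / ℓ) * (((n : ℝ) - m * h - |(x : ℝ)|) / n)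

/-- The weight that the expectation of the estimator attaches to `γ_x`. -/
def acvfWeight (K : ℝ → ℝ) (m : ℕ) (d : ℕ → ℝ) (n ℓ h : ℕ) (x : ℤ) : ℝ :=
  ∑ j ∈ range (m + 1), ∑ j' ∈ range (m + 1),
    d j * d j' * wKernel K m n ℓ h (x - ((j : ℤ) - j') * h)

/-- The part of the bias that is due to the noise. -/
def NoiseModel.bias (N : NoiseModel.{u}) (K : ℝ → ℝ) (m : ℕ) (d : ℕ → ℝ) (n ℓ h : ℕ) : ℝ :=
  ∑' x : ℤ, N.acvf x * (acvfWeight K m d n ℓ h x - 1)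

lemma wKernel_zero {K : ℝ → ℝ} (hK : IsKernel K) {m n ℓ h : ℕ} (hℓ : 1 ≤ ℓ) {x : ℤ}
    (hx : (ℓ : ℤ) ≤ |x|) : wKernel K m n ℓ h x = 0 := by
  rw [wKernel, hK.support_int hℓ hx, zero_mul]

lemma NoiseModel.WeaklyDependent.integral_W_mul {N : NoiseModel.{u}} (hN : N.WeaklyDependent)
    (m : ℕ) (d : ℕ → ℝ) (h : ℕ) (i i' : ℤ) :
    ∫ ω, N.W m d h i ω * N.W m d h i' ω ∂N.P
      = ∑ j ∈ range (m + 1), ∑ j' ∈ range (m + 1),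
        d j * d j' * N.acvf (i - i' - ((j : ℤ) - j') * h) := by
  have e : ∀ ω, N.W m d h i ω * N.W m d h i' ω
      = ∑ j ∈ range (m + 1), ∑ j' ∈ range (m + 1),
        d j * d j' * (N.Z (i - (j : ℤ) * h) ω * N.Z (i' - (j' : ℤ) * h) ω) := by
    intro ω
    simp only [NoiseModel.W, Finset.sum_mul_sum]
    refine Finset.sum_congr rfl fun j _ => Finset.sum_congr rfl fun j' _ => ?_
    ring
  have hInt : ∀ j j' : ℕ, Integrable (fun ω => d j * d j' *
      (N.Z (i - (j : ℤ) * h) ω * N.Z (i' - (j' : ℤ) * h) ω)) N.P := fun j j' =>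
    (integrable_mul_of_memLp_two (memLp_two_of_four (hN.memLp _))
      (memLp_two_of_four (hN.memLp _))).const_mul _
  simp only [e]
  rw [integral_finsetSum _ fun j _ => integrable_finsetSum _ fun j' _ => hInt j j']
  refine Finset.sum_congr rfl fun j _ => ?_
  rw [integral_finsetSum _ fun j' _ => hInt j j']
  refine Finset.sum_congr rfl fun j' _ => ?_
  rw [integral_const_mul, hN.integral_mul, ← hN.acvf_neg]
  congr 2; ring

/-- By stationarity lag `k` contributes `n - mh - |k|` equal expectations. Expanding them in the
autocovariances and translating each sum by `(j - j')h` collects the coefficient of `γ_x`. -/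
lemma NoiseModel.WeaklyDependent.integral_qform_W {N : NoiseModel.{u}} (hN : N.WeaklyDependent)
    (hγ : Summable N.acvf) {K : ℝ → ℝ} (hK : IsKernel K) (m : ℕ) (d : ℕ → ℝ) {n ℓ h : ℕ}
    (hℓ : 1 ≤ ℓ) (hn : m * h + ℓ ≤ n) :
    ∫ ω, qform K m n ℓ h (fun i => N.W m d h i ω) (fun i => N.W m d h i ω) ∂N.P
      = N.bias K m d n ℓ h + N.lrv := by
  have hnpos : (0 : ℝ) < n := by exact_mod_cast (by omega : 0 < n)
  set Γ : ℤ → ℝ := fun k => ∑ j ∈ range (m + 1), ∑ j' ∈ range (m + 1),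
    d j * d j' * N.acvf (k - ((j : ℤ) - j') * h) with hΓ
  have hΓe : ∀ k, Γ (-k) = Γ k := by
    intro k
    simp only [hΓ]
    rw [Finset.sum_comm]
    refine Finset.sum_congr rfl fun j _ => Finset.sum_congr rfl fun j' _ => ?_
    rw [← hN.acvf_neg, mul_comm (d j')]
    congr 2; ring
  have hWint : ∀ i i' : ℤ, Integrable (fun ω => N.W m d h i ω * N.W m d h i' ω) N.P := fun i i' =>
    integrable_mul_of_memLp_two
      (memLp_two_of_four ((hN.influenceBound m d h {i}).memLp i (by simp)))
      (memLp_two_of_four ((hN.influenceBound m d h {i'}).memLp i' (by simp)))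
  have e1 : ∫ ω, qform K m n ℓ h (fun i => N.W m d h i ω) (fun i => N.W m d h i ω) ∂N.P
      = ∑ k ∈ Ioo (-(ℓ : ℤ)) ℓ, wKernel K m n ℓ h k * Γ k := by
    simp only [← sum_band_eq_qform hK hℓ]
    rw [integral_finsetSum _ fun k _ => ((integrable_finsetSum _ fun i _ =>
      hWint i (i - |k|)).const_mul _).const_mul _]
    refine Finset.sum_congr rfl fun k hk => ?_
    rw [integral_const_mul, integral_const_mul, integral_finsetSum _ fun i _ => hWint i (i - |k|)]
    have e2 : ∀ i ∈ Icc ((m : ℤ) * h + |k| + 1) (n : ℤ),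
        ∫ ω, N.W m d h i ω * N.W m d h (i - |k|) ω ∂N.P = Γ k := by
      intro i _
      rw [hN.integral_W_mul]
      have : Γ |k| = Γ k := by
        rcases abs_choice k with h' | h' <;> rw [h']
        exact hΓe k
      rw [← this]
      simp only [hΓ]
      refine Finset.sum_congr rfl fun j _ => Finset.sum_congr rfl fun j' _ => ?_
      congr 2; ring
    rw [Finset.sum_congr rfl e2, Finset.sum_const, Int.card_Icc, wKernel, nsmul_eq_mul]
    have hk' : |k| < ℓ := abs_lt.2 (Finset.mem_Ioo.1 hk)
    -- `mh + ℓ ≤ n` keeps the number of summands from being truncated at zero by `toNat`.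
    have hnn : (0 : ℤ) ≤ (n : ℤ) + 1 - ((m : ℤ) * h + |k| + 1) := by
      have : ((m * h + ℓ : ℕ) : ℤ) ≤ n := by exact_mod_cast hn
      push_cast at this
      linarith
    have hcast : ((((n : ℤ) + 1 - ((m : ℤ) * h + |k| + 1)).toNat : ℕ) : ℝ)
        = (n : ℝ) - m * h - |(k : ℝ)| := by
      have : ((((n : ℤ) + 1 - ((m : ℤ) * h + |k| + 1)).toNat : ℤ) : ℝ)
        = (((n : ℤ) + 1 - ((m : ℤ) * h + |k| + 1) : ℤ) : ℝ) := by rw [Int.toNat_of_nonneg hnn]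
      rw [Int.cast_natCast] at this
      rw [this]; push_cast; ring
    rw [hcast]
    field_simp
  have hsum0 : ∀ f : ℤ → ℝ, ∑ k ∈ Ioo (-(ℓ : ℤ)) ℓ, wKernel K m n ℓ h k * f k
      = ∑' k, wKernel K m n ℓ h k * f k := by
    intro f
    rw [tsum_eq_sum]
    intro k hk
    rw [wKernel_zero hK hℓ, zero_mul]
    by_contra hcon
    exact hk (Finset.mem_Ioo.2 (abs_lt.1 (not_le.1 hcon)))
  have hfin : ∀ s : ℤ, Summable fun x => wKernel K m n ℓ h (x - s) * N.acvf x := by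
    intro s
    refine summable_of_ne_finset_zero (s := Ioo (s - ℓ) (s + ℓ)) fun x hx => ?_
    rw [wKernel_zero hK hℓ, zero_mul]
    by_contra hcon
    have := abs_lt.1 (not_le.1 hcon)
    exact hx (Finset.mem_Ioo.2 ⟨by linarith, by linarith⟩)
  have e3 : ∑ k ∈ Ioo (-(ℓ : ℤ)) ℓ, wKernel K m n ℓ h k * Γ k
      = ∑' x : ℤ, acvfWeight K m d n ℓ h x * N.acvf x := by
    have l1 : ∑ k ∈ Ioo (-(ℓ : ℤ)) ℓ, wKernel K m n ℓ h k * Γ k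
        = ∑ j ∈ range (m + 1), ∑ j' ∈ range (m + 1), d j * d j' *
          ∑ k ∈ Ioo (-(ℓ : ℤ)) ℓ, wKernel K m n ℓ h k * N.acvf (k - ((j : ℤ) - j') * h) := by
      simp only [hΓ, Finset.mul_sum]
      rw [Finset.sum_comm]
      refine Finset.sum_congr rfl fun j _ => ?_
      rw [Finset.sum_comm]
      refine Finset.sum_congr rfl fun j' _ => Finset.sum_congr rfl fun k _ => ?_
      ring
    rw [l1]
    have l2 : ∀ j j' : ℕ, ∑ k ∈ Ioo (-(ℓ : ℤ)) ℓ, wKernel K m n ℓ h k *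
          N.acvf (k - ((j : ℤ) - j') * h)
        = ∑' x, wKernel K m n ℓ h (x - ((j' : ℤ) - j) * h) * N.acvf x := by
      intro j j'
      rw [hsum0, ← (Equiv.subRight (((j' : ℤ) - j) * h)).tsum_eq]
      refine tsum_congr fun x => ?_
      simp only [Equiv.subRight_apply]
      congr 2; ring
    simp only [l2]
    rw [Finset.sum_comm]
    simp only [acvfWeight, Finset.sum_mul]
    rw [Summable.tsum_finsetSum fun j _ => summable_sum fun j' _ => by
      simpa only [mul_assoc] using ((hfin (((j : ℤ) - j') * h)).mul_left (d j * d j'))]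
    refine Finset.sum_congr rfl fun j _ => ?_
    rw [Summable.tsum_finsetSum fun j' _ => by
      simpa only [mul_assoc] using ((hfin (((j : ℤ) - j') * h)).mul_left (d j * d j'))]
    refine Finset.sum_congr rfl fun j' _ => ?_
    rw [← tsum_mul_left]
    refine tsum_congr fun x => by ring
  have hs1 : Summable fun x => acvfWeight K m d n ℓ h x * N.acvf x := by
    simp only [acvfWeight, Finset.sum_mul]
    exact summable_sum fun j _ => summable_sum fun j' _ => by
      simpa only [mul_assoc] using ((hfin (((j : ℤ) - j') * h)).mul_left (d j * d j'))
  have hs2 : Summable fun x => N.acvf x * (acvfWeight K m d n ℓ h x - 1) := by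
    refine (hs1.sub hγ).congr fun x => ?_
    ring
  rw [e1, e3, NoiseModel.bias, NoiseModel.lrv, ← hs2.tsum_add hγ]
  exact tsum_congr fun x => by ring

/-! ### Size of the differenced mean -/

/-- The response of the differences to a unit jump, at distance `y` from the jump. -/
def jumpResponse (m : ℕ) (d : ℕ → ℝ) (h : ℕ) (y : ℤ) : ℝ :=
  ∑ k ∈ range (m + 1), d k * if 0 ≤ y - (k : ℤ) * h then 1 else 0

/-- Outside the window of length `mh` either none or all of the differenced points lie past the
jump, and the coefficients sum to zero. -/
lemma jumpResponse_eq_zero {m : ℕ} {d : ℕ → ℝ} (hd : IsDiffSeq m d) {h : ℕ} {y : ℤ}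
    (hy : y < 0 ∨ (m : ℤ) * h ≤ y) : jumpResponse m d h y = 0 := by
  rw [jumpResponse]
  rcases hy with hy | hy
  · refine Finset.sum_eq_zero fun k _ => ?_
    rw [if_neg, mul_zero]
    have : (0 : ℤ) ≤ (k : ℤ) * h := by positivity
    omega
  · rw [← hd.sum_zero]
    refine Finset.sum_congr rfl fun k hk => ?_
    rw [if_pos, mul_one]
    have : (k : ℤ) * h ≤ m * h := by
      have : k ≤ m := Nat.lt_succ_iff.1 (Finset.mem_range.1 hk)
      gcongr
    omega

lemma abs_jumpResponse_le (m : ℕ) (d : ℕ → ℝ) (h : ℕ) (y : ℤ) :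
    |jumpResponse m d h y| ≤ ∑ k ∈ range (m + 1), |d k| := by
  refine (Finset.abs_sum_le_sum_abs _ _).trans (Finset.sum_le_sum fun k _ => ?_)
  split_ifs <;> simp

namespace MeanModel

variable (M : MeanModel)

lemma sum_abel (ξ u : ℕ → ℝ) (J : ℕ) :
    ∑ j ∈ range (J + 1), ξ j * (u j - u (j + 1))
      = ξ 0 * u 0 + (∑ j ∈ range J, (ξ (j + 1) - ξ j) * u (j + 1)) - ξ J * u (J + 1) := by
  induction J with
  | zero => simp; ring
  | succ J ih => rw [Finset.sum_range_succ, ih, Finset.sum_range_succ _ J]; ring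

/-- Summation by parts expresses the step function through its jumps; `T_0 = 1` and `T_{J+1} = n +
1` settle the boundary terms. -/
lemma s_eq {n : ℕ} (hn : 1 ≤ n) {i : ℤ} (h1 : 1 ≤ i) (h2 : i ≤ n) :
    M.s n ((i : ℝ) / n) = M.ξ n 0 +
      ∑ j ∈ range (M.J n), (M.ξ n (j + 1) - M.ξ n j) *
        if 0 ≤ i - (M.T n (j + 1) : ℤ) then 1 else 0 := by
  have hnpos : (0 : ℝ) < n := by exact_mod_cast hn
  set u : ℕ → ℝ := fun j => if 0 ≤ i - (M.T n j : ℤ) then 1 else 0 with hu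
  have e : ∀ j ∈ range (M.J n + 1),
      Set.indicator (Set.Ico ((M.T n j : ℝ) / n) ((M.T n (j + 1) : ℝ) / n)) (fun _ => M.ξ n j)
        ((i : ℝ) / n) = M.ξ n j * (u j - u (j + 1)) := by
    intro j hj
    have hlt := M.T_lt n hn j (Nat.lt_succ_iff.1 (Finset.mem_range.1 hj))
    have hmem : (i : ℝ) / n ∈ Set.Ico ((M.T n j : ℝ) / n) ((M.T n (j + 1) : ℝ) / n) ↔
        (M.T n j : ℤ) ≤ i ∧ i < M.T n (j + 1) := by
      rw [Set.mem_Ico, div_le_div_iff_of_pos_right hnpos, div_lt_div_iff_of_pos_right hnpos]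
      exact_mod_cast Iff.rfl
    rw [Set.indicator_apply]
    simp only [hmem, hu]
    split_ifs <;> first | omega | simp
  rw [s, Finset.sum_congr rfl e, sum_abel]
  have u0 : u 0 = 1 := by
    simp only [hu]; rw [if_pos]; rw [M.T_zero n hn]; push_cast; omega
  have u1 : u (M.J n + 1) = 0 := by
    simp only [hu]; rw [if_neg]; rw [M.T_last n hn]; push_cast; omega
  rw [u0, u1]; simp [hu]

lemma M_eq {m : ℕ} {d : ℕ → ℝ} (hd : IsDiffSeq m d) {n h : ℕ} (hn : 1 ≤ n) {i : ℤ}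
    (hi : i ∈ Icc ((m : ℤ) * h + 1) n) :
    M.M m d n h i = (∑ k ∈ range (m + 1), d k * M.c n (((i - (k : ℤ) * h : ℤ) : ℝ) / n)) +
      ∑ j ∈ range (M.J n), (M.ξ n (j + 1) - M.ξ n j) *
        jumpResponse m d h (i - (M.T n (j + 1) : ℤ)) := by
  rw [Finset.mem_Icc] at hi
  have hs : ∀ k ∈ range (m + 1), M.s n (((i - (k : ℤ) * h : ℤ) : ℝ) / n)
      = M.ξ n 0 + ∑ j ∈ range (M.J n), (M.ξ n (j + 1) - M.ξ n j) *
        if 0 ≤ i - (M.T n (j + 1) : ℤ) - (k : ℤ) * h then 1 else 0 := by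
    intro k hk
    have h0 : (0 : ℤ) ≤ (k : ℤ) * h := by positivity
    have hkm : (k : ℤ) * h ≤ m * h := by
      have : k ≤ m := Nat.lt_succ_iff.1 (Finset.mem_range.1 hk)
      gcongr
    rw [M.s_eq hn (by linarith [hi.1]) (by linarith [hi.2])]
    congr 1
    refine Finset.sum_congr rfl fun j _ => ?_
    rw [sub_right_comm]
  have e1 : M.M m d n h i = (∑ k ∈ range (m + 1), d k * M.c n (((i - (k : ℤ) * h : ℤ) : ℝ) / n))
      + ∑ k ∈ range (m + 1), d k * M.s n (((i - (k : ℤ) * h : ℤ) : ℝ) / n) := by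
    simp only [MeanModel.M, mu, mul_add, Finset.sum_add_distrib]
  rw [e1]
  congr 1
  rw [Finset.sum_congr rfl fun k hk => by rw [hs k hk]]
  simp only [mul_add, Finset.sum_add_distrib]
  rw [← Finset.sum_mul, hd.sum_zero, zero_mul, zero_add]
  simp only [jumpResponse, Finset.mul_sum]
  rw [Finset.sum_comm]
  refine Finset.sum_congr rfl fun j _ => Finset.sum_congr rfl fun k _ => ?_
  ring

lemma abs_sub_le_of_smoothness {n : ℕ} {A : ℝ} (hA : 0 ≤ A)
    (hs : M.smoothness n ≤ ENNReal.ofReal A) {t t' : ℝ} (ht' : t' ∈ Set.Icc (0 : ℝ) 1)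
    (ht : t ∈ Set.Icc (0 : ℝ) 1) (htt : t' ≤ t) : |M.c n t - M.c n t'| ≤ A * (t - t') := by
  rcases htt.eq_or_lt with rfl | hlt
  · simp
  have h1 : ENNReal.ofReal |(M.c n t - M.c n t') / (t - t')| ≤ ENNReal.ofReal A := by
    refine le_trans ?_ hs
    unfold smoothness
    exact le_iSup₂_of_le t' ht' (le_iSup₂_of_le t ht (le_iSup_of_le hlt le_rfl))
  rw [ENNReal.ofReal_le_ofReal_iff hA, abs_div, abs_of_pos (sub_pos.2 hlt),
    div_le_iff₀ (sub_pos.2 hlt)] at h1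
  exact h1

lemma abs_jump_le {n : ℕ} {A : ℝ} (hA : 0 ≤ A) (hs : M.jumpSize n ≤ ENNReal.ofReal A) {j : ℕ}
    (hj : j ∈ range (M.J n)) : |M.ξ n (j + 1) - M.ξ n j| ≤ A := by
  rw [← ENNReal.ofReal_le_ofReal_iff hA]
  refine le_trans ?_ hs
  unfold jumpSize
  exact le_iSup₂_of_le j hj le_rfl

/-- As `∑ d_k = 0`, the value `c(i/n)` may be subtracted from every term, leaving increments over
distances of at most `mh/n`. -/
lemma abs_smooth_part_le {m : ℕ} {d : ℕ → ℝ} (hd : IsDiffSeq m d) {n h : ℕ} (hn : 1 ≤ n) {A : ℝ}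
    (hA : 0 ≤ A) (hs : M.smoothness n ≤ ENNReal.ofReal A) {i : ℤ}
    (hi : i ∈ Icc ((m : ℤ) * h + 1) n) :
    |∑ k ∈ range (m + 1), d k * M.c n (((i - (k : ℤ) * h : ℤ) : ℝ) / n)|
      ≤ (∑ k ∈ range (m + 1), |d k|) * (A * (m * h / n)) := by
  rw [Finset.mem_Icc] at hi
  have hnpos : (0 : ℝ) < n := by exact_mod_cast hn
  have e : ∑ k ∈ range (m + 1), d k * M.c n (((i - (k : ℤ) * h : ℤ) : ℝ) / n)
      = ∑ k ∈ range (m + 1), d k * (M.c n (((i - (k : ℤ) * h : ℤ) : ℝ) / n) -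
        M.c n ((i : ℝ) / n)) := by
    simp only [mul_sub, Finset.sum_sub_distrib]
    rw [← Finset.sum_mul, hd.sum_zero, zero_mul, sub_zero]
  rw [e, Finset.sum_mul]
  refine (Finset.abs_sum_le_sum_abs _ _).trans (Finset.sum_le_sum fun k hk => ?_)
  rw [abs_mul]
  refine mul_le_mul_of_nonneg_left ?_ (abs_nonneg _)
  have h0 : (0 : ℤ) ≤ (k : ℤ) * h := by positivity
  have hkm : (k : ℤ) * h ≤ m * h := by
    have : k ≤ m := Nat.lt_succ_iff.1 (Finset.mem_range.1 hk)
    gcongr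
  have mem : ∀ z : ℤ, 1 ≤ z → z ≤ n → (z : ℝ) / n ∈ Set.Icc (0 : ℝ) 1 := by
    intro z hz1 hz2
    have : (0 : ℝ) ≤ z := by exact_mod_cast (by omega : (0 : ℤ) ≤ z)
    refine ⟨by positivity, ?_⟩
    rw [div_le_one hnpos]
    exact_mod_cast hz2
  rw [abs_sub_comm]
  have hle : (((i - (k : ℤ) * h : ℤ) : ℝ) / n) ≤ (i : ℝ) / n := by
    rw [div_le_div_iff_of_pos_right hnpos]
    exact_mod_cast (by linarith : i - (k : ℤ) * h ≤ i)
  refine (M.abs_sub_le_of_smoothness hA hs (mem _ (by linarith [hi.1]) (by linarith [hi.2]))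
    (mem _ (by nlinarith [hi.1]) hi.2) hle).trans ?_
  refine mul_le_mul_of_nonneg_left ?_ hA
  rw [← sub_div, div_le_div_iff_of_pos_right hnpos]
  have : ((k : ℤ) * h : ℝ) ≤ m * h := by exact_mod_cast hkm
  push_cast at this ⊢
  linarith

lemma abs_M_le {m : ℕ} {d : ℕ → ℝ} (hd : IsDiffSeq m d) {n h : ℕ} (hn : 1 ≤ n) {A : ℝ}
    (hA : 0 ≤ A) (hs : M.smoothness n ≤ ENNReal.ofReal A) (hj : M.jumpSize n ≤ ENNReal.ofReal A)
    {i : ℤ} (hi : i ∈ Icc ((m : ℤ) * h + 1) n) :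
    |M.M m d n h i| ≤ (∑ k ∈ range (m + 1), |d k|) * (A * (m * h / n) +
      A * ∑ j ∈ range (M.J n), if i ∈ Ico (M.T n (j + 1) : ℤ) (M.T n (j + 1) + m * h) then
        1 else 0) := by
  rw [M.M_eq hd hn hi, mul_add]
  refine (abs_add_le _ _).trans (add_le_add (M.abs_smooth_part_le hd hn hA hs hi) ?_)
  rw [Finset.mul_sum, Finset.mul_sum]
  refine (Finset.abs_sum_le_sum_abs _ _).trans (Finset.sum_le_sum fun j hjm => ?_)
  rw [abs_mul]
  split_ifs with hin
  · rw [mul_one, mul_comm]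
    exact mul_le_mul (abs_jumpResponse_le _ _ _ _) (M.abs_jump_le hA hj hjm) (abs_nonneg _)
      (Finset.sum_nonneg fun _ _ => abs_nonneg _)
  · rw [jumpResponse_eq_zero hd, abs_zero, mul_zero, mul_zero, mul_zero]
    rw [Finset.mem_Ico, not_and_or, not_le, not_lt] at hin
    rcases hin with h' | h'
    · left; linarith
    · right; linarith

/-- A constant bounding both the differenced means and their sum divided by `h`. -/
def meanBound (m : ℕ) (d : ℕ → ℝ) (A : ℝ) : ℝ := (∑ k ∈ range (m + 1), |d k|) * ((m + 1) * (A + A ^ 2))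

lemma meanBound_nonneg (m : ℕ) (d : ℕ → ℝ) {A : ℝ} (hA : 0 ≤ A) : 0 ≤ meanBound m d A :=
  mul_nonneg (Finset.sum_nonneg fun _ _ => abs_nonneg _) (by positivity)

lemma abs_M_le_meanBound {m : ℕ} {d : ℕ → ℝ} (hd : IsDiffSeq m d) {n h : ℕ} (hn : 1 ≤ n)
    (hhn : h ≤ n) {A : ℝ} (hA : 0 ≤ A) (hs : M.smoothness n ≤ ENNReal.ofReal A)
    (hj : M.jumpSize n ≤ ENNReal.ofReal A) (hJ : (M.J n : ℝ) ≤ A) {i : ℤ}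
    (hi : i ∈ Icc ((m : ℤ) * h + 1) n) : |M.M m d n h i| ≤ meanBound m d A := by
  have hnpos : (0 : ℝ) < n := by exact_mod_cast hn
  refine (M.abs_M_le hd hn hA hs hj hi).trans ?_
  refine mul_le_mul_of_nonneg_left ?_ (Finset.sum_nonneg fun _ _ => abs_nonneg _)
  have h1 : (m : ℝ) * h / n ≤ m := by
    rw [div_le_iff₀ hnpos]
    have : (h : ℝ) ≤ n := by exact_mod_cast hhn
    gcongr
  have h2 : (∑ j ∈ range (M.J n), if i ∈ Ico (M.T n (j + 1) : ℤ) (M.T n (j + 1) + m * h) then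
      (1 : ℝ) else 0) ≤ A := by
    refine le_trans (Finset.sum_le_sum (g := fun _ => 1) fun j _ => ?_)
      (le_trans (le_of_eq ?_) hJ)
    · split_ifs <;> norm_num
    · simp
  have h3 : (0 : ℝ) ≤ m := by positivity
  calc A * (m * h / n) + A * _ ≤ A * m + A * A := by gcongr
    _ ≤ (m + 1) * (A + A ^ 2) := by nlinarith [mul_nonneg h3 (sq_nonneg A)]

/-- The trend gives at most `n` terms of order `h/n`, and each of the boundedly many jumps gives a
window of `mh` bounded terms; both add up to `O(h)`. -/
lemma sum_abs_M_le {m : ℕ} {d : ℕ → ℝ} (hd : IsDiffSeq m d) {n h : ℕ} (hn : 1 ≤ n) {A : ℝ}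
    (hA : 0 ≤ A) (hs : M.smoothness n ≤ ENNReal.ofReal A) (hj : M.jumpSize n ≤ ENNReal.ofReal A)
    (hJ : (M.J n : ℝ) ≤ A) :
    ∑ i ∈ Icc ((m : ℤ) * h + 1) n, |M.M m d n h i| ≤ meanBound m d A * h := by
  have hnpos : (0 : ℝ) < n := by exact_mod_cast hn
  refine (Finset.sum_le_sum fun i hi => M.abs_M_le hd hn hA hs hj hi).trans ?_
  rw [← Finset.mul_sum, meanBound, mul_assoc]
  refine mul_le_mul_of_nonneg_left ?_ (Finset.sum_nonneg fun _ _ => abs_nonneg _)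
  rw [Finset.sum_add_distrib, ← Finset.mul_sum, ← Finset.mul_sum, Finset.sum_comm]
  have hcard : ((Icc ((m : ℤ) * h + 1) (n : ℤ)).card : ℝ) ≤ n := by
    rw [Int.card_Icc]
    have h0 : (0 : ℤ) ≤ (m : ℤ) * h := by positivity
    have : (((n : ℤ) + 1 - ((m : ℤ) * h + 1)).toNat) ≤ n := by omega
    exact_mod_cast this
  have h1 : A * ∑ _i ∈ Icc ((m : ℤ) * h + 1) (n : ℤ), (m : ℝ) * h / n ≤ A * (m * h) := by
    rw [Finset.sum_const, nsmul_eq_mul]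
    calc A * (((Icc ((m : ℤ) * h + 1) (n : ℤ)).card : ℝ) * ((m : ℝ) * h / n))
        ≤ A * (n * ((m : ℝ) * h / n)) := by gcongr
      _ = A * (m * h) := by field_simp
  have h2 : ∀ j ∈ range (M.J n), (∑ i ∈ Icc ((m : ℤ) * h + 1) (n : ℤ),
      if i ∈ Ico (M.T n (j + 1) : ℤ) (M.T n (j + 1) + m * h) then (1 : ℝ) else 0) ≤ m * h := by
    intro j _
    rw [← Finset.sum_filter, Finset.sum_const, nsmul_eq_mul, mul_one]
    have : ((Icc ((m : ℤ) * h + 1) (n : ℤ)).filter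
        (fun i => i ∈ Ico (M.T n (j + 1) : ℤ) (M.T n (j + 1) + m * h))).card ≤ m * h := by
      calc _ ≤ (Ico (M.T n (j + 1) : ℤ) (M.T n (j + 1) + m * h)).card :=
            Finset.card_le_card fun i hi => (Finset.mem_filter.1 hi).2
        _ = m * h := by
            rw [Int.card_Ico, add_sub_cancel_left]
            exact_mod_cast Int.toNat_natCast (m * h)
    exact_mod_cast this
  have h3 := Finset.sum_le_sum h2
  rw [Finset.sum_const, Finset.card_range, nsmul_eq_mul] at h3
  have h4 : (M.J n : ℝ) * (m * h) ≤ A * (m * h) := by gcongr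
  have h5 : A * ∑ j ∈ range (M.J n), (∑ i ∈ Icc ((m : ℤ) * h + 1) (n : ℤ),
      if i ∈ Ico (M.T n (j + 1) : ℤ) (M.T n (j + 1) + m * h) then (1 : ℝ) else 0)
      ≤ A * (A * (m * h)) := mul_le_mul_of_nonneg_left (h3.trans h4) hA
  have h6 : (0 : ℝ) ≤ m := by positivity
  have h7 : (0 : ℝ) ≤ h := by positivity
  nlinarith [mul_nonneg hA h7, mul_nonneg (sq_nonneg A) h7]

end MeanModel

/-! ### Mean squared error: decomposition and bounds at a fixed sample size -/

lemma sum_abs_band_le {g : ℤ → ℝ} {ℓ : ℕ} {c : ℝ} (hc : 0 ≤ c)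
    (h0 : ∀ k : ℤ, (ℓ : ℤ) ≤ |k| → g k = 0) (hb : ∀ k, |g k| ≤ c) (I : Finset ℤ) (i : ℤ) :
    ∑ j ∈ I, |g (i - j)| ≤ 2 * ℓ * c := by
  have h1 : ∑ j ∈ I, |g (i - j)| ≤ ∑ j ∈ Ioo (i - ℓ) (i + ℓ), |g (i - j)| := by
    refine (Finset.sum_filter_of_ne (p := fun j => j ∈ Ioo (i - (ℓ : ℤ)) (i + ℓ)) ?_).symm.le.trans ?_
    · intro j _ hne
      by_contra hcon
      refine hne ?_
      rw [h0, abs_zero]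
      by_contra hlt
      have := abs_lt.1 (not_le.1 hlt)
      exact hcon (Finset.mem_Ioo.2 ⟨by linarith, by linarith⟩)
    · exact Finset.sum_le_sum_of_subset_of_nonneg (fun j hj => (Finset.mem_filter.1 hj).2)
        fun _ _ _ => abs_nonneg _
  refine h1.trans ((Finset.sum_le_sum fun j _ => hb _).trans ?_)
  rw [Finset.sum_const, Int.card_Ioo, nsmul_eq_mul]
  refine mul_le_mul_of_nonneg_right ?_ hc
  have : (i + (ℓ : ℤ) - (i - ℓ) - 1).toNat ≤ 2 * ℓ := by omega
  exact_mod_cast this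

lemma sum_qform_eq_linear (K : ℝ → ℝ) (m n ℓ h : ℕ) (x y : ℤ → ℝ) :
    qform K m n ℓ h x y = ∑ j ∈ Icc ((m : ℤ) * h + 1) (n : ℤ),
      (∑ i ∈ Icc ((m : ℤ) * h + 1) (n : ℤ), (1 / (n : ℝ) * K (((i - j : ℤ) : ℝ) / ℓ)) * x i) * y j := by
  rw [qform, Finset.sum_comm]
  refine Finset.sum_congr rfl fun j _ => ?_
  rw [Finset.sum_mul]
  exact Finset.sum_congr rfl fun i _ => by ring

lemma card_window_le (m n h : ℕ) : ((Icc ((m : ℤ) * h + 1) (n : ℤ)).card : ℝ) ≤ n := by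
  rw [Int.card_Icc]
  have h0 : (0 : ℤ) ≤ (m : ℤ) * h := by positivity
  have : (((n : ℤ) + 1 - ((m : ℤ) * h + 1)).toNat) ≤ n := by omega
  exact_mod_cast this

section Smoothing

variable {K : ℝ → ℝ} {m n ℓ h : ℕ} {A C : ℝ} {x : ℤ → ℝ}

lemma band_weight_abs_le (hA : ∀ t, |K t| ≤ A) (k : ℤ) :
    |1 / (n : ℝ) * K ((k : ℝ) / ℓ)| ≤ A / n := by
  rw [abs_mul, abs_of_nonneg (by positivity), one_div, inv_mul_eq_div]
  have := hA ((k : ℝ) / ℓ)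
  gcongr

lemma abs_smoothed_le (hK : IsKernel K) (hA : ∀ t, |K t| ≤ A) (hℓ : 1 ≤ ℓ) (hC0 : 0 ≤ C)
    (hx : ∀ i ∈ Icc ((m : ℤ) * h + 1) (n : ℤ), |x i| ≤ C) (j : ℤ) :
    |∑ i ∈ Icc ((m : ℤ) * h + 1) (n : ℤ), (1 / (n : ℝ) * K (((i - j : ℤ) : ℝ) / ℓ)) * x i|
      ≤ 2 * ℓ * (A / n) * C := by
  have hA0 : 0 ≤ A := (abs_nonneg _).trans (hA 0)
  have h1 := sum_abs_band_le (g := fun k : ℤ => 1 / (n : ℝ) * K ((k : ℝ) / ℓ)) (c := A / n) (ℓ := ℓ)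
    (by positivity) (fun k hk => by simp only [hK.support_int hℓ hk, mul_zero])
    (fun k => band_weight_abs_le hA k) (Icc ((m : ℤ) * h + 1) (n : ℤ)) j
  calc _ ≤ ∑ i ∈ Icc ((m : ℤ) * h + 1) (n : ℤ), |1 / (n : ℝ) * K (((j - i : ℤ) : ℝ) / ℓ)| * C := by
        refine (Finset.abs_sum_le_sum_abs _ _).trans (Finset.sum_le_sum fun i hi => ?_)
        rw [abs_mul, ← hK.even_int, neg_sub]
        exact mul_le_mul_of_nonneg_left (hx i hi) (abs_nonneg _)
    _ ≤ _ := by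
        rw [← Finset.sum_mul]
        exact mul_le_mul_of_nonneg_right h1 hC0

lemma sum_abs_smoothed_le (hK : IsKernel K) (hA : ∀ t, |K t| ≤ A) (hℓ : 1 ≤ ℓ) :
    ∑ j ∈ Icc ((m : ℤ) * h + 1) (n : ℤ),
      |∑ i ∈ Icc ((m : ℤ) * h + 1) (n : ℤ), (1 / (n : ℝ) * K (((i - j : ℤ) : ℝ) / ℓ)) * x i|
      ≤ 2 * ℓ * (A / n) * ∑ i ∈ Icc ((m : ℤ) * h + 1) (n : ℤ), |x i| := by
  have hA0 : 0 ≤ A := (abs_nonneg _).trans (hA 0)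
  calc _ ≤ ∑ j ∈ Icc ((m : ℤ) * h + 1) (n : ℤ), ∑ i ∈ Icc ((m : ℤ) * h + 1) (n : ℤ),
        |1 / (n : ℝ) * K (((i - j : ℤ) : ℝ) / ℓ)| * |x i| := by
        refine Finset.sum_le_sum fun j _ => (Finset.abs_sum_le_sum_abs _ _).trans
          (Finset.sum_le_sum fun i _ => (abs_mul _ _).le)
    _ = ∑ i ∈ Icc ((m : ℤ) * h + 1) (n : ℤ), (∑ j ∈ Icc ((m : ℤ) * h + 1) (n : ℤ),
        |1 / (n : ℝ) * K (((i - j : ℤ) : ℝ) / ℓ)|) * |x i| := by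
        rw [Finset.sum_comm]
        exact Finset.sum_congr rfl fun i _ => (Finset.sum_mul _ _ _).symm
    _ ≤ ∑ i ∈ Icc ((m : ℤ) * h + 1) (n : ℤ), 2 * ℓ * (A / n) * |x i| := by
        refine Finset.sum_le_sum fun i _ => mul_le_mul_of_nonneg_right ?_ (abs_nonneg _)
        exact sum_abs_band_le (g := fun k : ℤ => 1 / (n : ℝ) * K ((k : ℝ) / ℓ)) (c := A / n)
          (by positivity) (fun k hk => by simp only [hK.support_int hℓ hk, mul_zero])
          (fun k => band_weight_abs_le hA k) _ i
    _ = _ := by rw [Finset.mul_sum]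

/-- The kernel average of `x` is bounded by a multiple of `Cℓ/n`, and it is summed against `x`,
whose absolute sum is at most `Ch`. -/
lemma abs_qform_self_le (hK : IsKernel K) (hA : ∀ t, |K t| ≤ A) (hℓ : 1 ≤ ℓ) (hC0 : 0 ≤ C)
    (hx : ∀ i ∈ Icc ((m : ℤ) * h + 1) (n : ℤ), |x i| ≤ C)
    (hxs : ∑ i ∈ Icc ((m : ℤ) * h + 1) (n : ℤ), |x i| ≤ C * h) :
    |qform K m n ℓ h x x| ≤ 2 * A * C ^ 2 * ((ℓ : ℝ) * h / n) := by
  have hA0 : 0 ≤ A := (abs_nonneg _).trans (hA 0)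
  rw [sum_qform_eq_linear]
  calc _ ≤ ∑ j ∈ Icc ((m : ℤ) * h + 1) (n : ℤ), 2 * ℓ * (A / n) * C * |x j| := by
        refine (Finset.abs_sum_le_sum_abs _ _).trans (Finset.sum_le_sum fun j _ => ?_)
        rw [abs_mul]
        exact mul_le_mul_of_nonneg_right (abs_smoothed_le hK hA hℓ hC0 hx j) (abs_nonneg _)
    _ ≤ 2 * ℓ * (A / n) * C * (C * h) := by
        rw [← Finset.mul_sum]
        gcongr
    _ = _ := by ring

/-- Supremum times absolute sum, both for the kernel average. These squares control the variance of
the cross term between mean and noise. -/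
lemma sum_sq_smoothed_le (hK : IsKernel K) (hA : ∀ t, |K t| ≤ A) (hℓ : 1 ≤ ℓ) (hC0 : 0 ≤ C)
    (hx : ∀ i ∈ Icc ((m : ℤ) * h + 1) (n : ℤ), |x i| ≤ C)
    (hxs : ∑ i ∈ Icc ((m : ℤ) * h + 1) (n : ℤ), |x i| ≤ C * h) :
    ∑ j ∈ Icc ((m : ℤ) * h + 1) (n : ℤ),
      (∑ i ∈ Icc ((m : ℤ) * h + 1) (n : ℤ), (1 / (n : ℝ) * K (((i - j : ℤ) : ℝ) / ℓ)) * x i) ^ 2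
      ≤ 4 * A ^ 2 * C ^ 2 * ((ℓ : ℝ) / n * (ℓ * h / n)) := by
  have hA0 : 0 ≤ A := (abs_nonneg _).trans (hA 0)
  calc _ ≤ ∑ j ∈ Icc ((m : ℤ) * h + 1) (n : ℤ), 2 * ℓ * (A / n) * C *
        |∑ i ∈ Icc ((m : ℤ) * h + 1) (n : ℤ), (1 / (n : ℝ) * K (((i - j : ℤ) : ℝ) / ℓ)) * x i| := by
        refine Finset.sum_le_sum fun j _ => ?_
        rw [← sq_abs, sq]
        exact mul_le_mul_of_nonneg_right (abs_smoothed_le hK hA hℓ hC0 hx j) (abs_nonneg _)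
    _ ≤ 2 * ℓ * (A / n) * C * (2 * ℓ * (A / n) * (C * h)) := by
        rw [← Finset.mul_sum]
        have := (sum_abs_smoothed_le (m := m) (n := n) (h := h) (x := x) hK hA hℓ).trans
          (mul_le_mul_of_nonneg_left hxs (by positivity))
        gcongr
    _ = _ := by ring

end Smoothing

namespace DGM

variable {G : DGM.{u}} {K : ℝ → ℝ} {m : ℕ} {d : ℕ → ℝ} {ℓ h : ℕ → ℕ} {n : ℕ}

/-- The bias of the estimator. -/
def bias (G : DGM.{u}) (K : ℝ → ℝ) (m : ℕ) (d : ℕ → ℝ) (ℓ h : ℕ → ℕ) (n : ℕ) : ℝ :=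
  G.noise.bias K m d n (ℓ n) (h n) +
    qform K m n (ℓ n) (h n) (G.mean.M m d n (h n)) (G.mean.M m d n (h n))

lemma memLp_qform_W (hN : G.noise.WeaklyDependent) (K : ℝ → ℝ) (m : ℕ) (d : ℕ → ℝ) (n ℓ h : ℕ) :
    MemLp (fun ω => qform K m n ℓ h (fun i => G.noise.W m d h i ω) (fun i => G.noise.W m d h i ω))
      2 G.noise.P :=
  (hN.influenceBound m d h (Icc ((m : ℤ) * h + 1) (n : ℤ))).quadratic_memLp _

lemma memLp_qform_M_W (hN : G.noise.WeaklyDependent) (K : ℝ → ℝ) (m : ℕ) (d : ℕ → ℝ) (n ℓ h : ℕ)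
    (x : ℤ → ℝ) :
    MemLp (fun ω => qform K m n ℓ h x (fun i => G.noise.W m d h i ω)) 4 G.noise.P := by
  simp only [sum_qform_eq_linear]
  exact (hN.influenceBound m d h (Icc ((m : ℤ) * h + 1) (n : ℤ))).linear_memLp _

lemma integral_qform_M_W (hN : G.noise.WeaklyDependent) (K : ℝ → ℝ) (m : ℕ) (d : ℕ → ℝ)
    (n ℓ h : ℕ) (x : ℤ → ℝ) :
    ∫ ω, qform K m n ℓ h x (fun i => G.noise.W m d h i ω) ∂G.noise.P = 0 := by
  simp only [sum_qform_eq_linear]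
  exact (hN.influenceBound m d h (Icc ((m : ℤ) * h + 1) (n : ℤ))).linear_mean _

lemma memLp_vHat (hN : G.noise.WeaklyDependent) (hK : IsKernel K) (hℓ : 1 ≤ ℓ n) :
    MemLp (G.vHat K m d n (ℓ n) (h n)) 2 G.noise.P := by
  set c := qform K m n (ℓ n) (h n) (G.mean.M m d n (h n)) (G.mean.M m d n (h n)) with hc
  set L := fun ω => qform K m n (ℓ n) (h n) (G.mean.M m d n (h n))
    (fun i => G.noise.W m d (h n) i ω) with hL
  set Q := fun ω => qform K m n (ℓ n) (h n) (fun i => G.noise.W m d (h n) i ω)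
    (fun i => G.noise.W m d (h n) i ω) with hQ
  have hLm : MemLp L 2 G.noise.P := memLp_two_of_four (memLp_qform_M_W hN K m d n _ _ _)
  have hQm : MemLp Q 2 G.noise.P := memLp_qform_W hN K m d n _ _
  have hcm : MemLp (fun _ : ℤ → G.noise.E => c) 2 G.noise.P := memLp_const c
  have e : G.vHat K m d n (ℓ n) (h n) = fun ω => c + 2 * L ω + Q ω :=
    funext fun ω => G.vHat_eq hK m d (h n) hℓ ω
  rw [e]
  exact (hcm.add (hLm.const_mul 2)).add hQm

lemma integral_vHat_sub (hN : G.noise.WeaklyDependent) (hγ : Summable G.noise.acvf)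
    (hK : IsKernel K) (hℓ : 1 ≤ ℓ n) (hn : m * h n + ℓ n ≤ n) :
    ∫ ω, (G.vHat K m d n (ℓ n) (h n) ω - G.noise.lrv) ∂G.noise.P = G.bias K m d ℓ h n := by
  rw [integral_sub ((memLp_vHat hN hK hℓ).integrable (by norm_num)) (integrable_const _)]
  simp only [G.vHat_eq hK m d (n := n) (h n) hℓ]
  have i1 := (memLp_qform_M_W hN K m d n (ℓ n) (h n) (G.mean.M m d n (h n))).integrable (by norm_num)
  have i2 := (memLp_qform_W hN K m d n (ℓ n) (h n)).integrable (by norm_num)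
  rw [integral_add (by exact (integrable_const _).add (i1.const_mul 2)) i2,
    integral_add (integrable_const _) (i1.const_mul 2), integral_const_mul, integral_qform_M_W hN,
    hN.integral_qform_W hγ hK m d hℓ hn, bias]
  simp
  ring

lemma sq_bias_le_mse (hN : G.noise.WeaklyDependent) (hγ : Summable G.noise.acvf)
    (hK : IsKernel K) (hℓ : 1 ≤ ℓ n) (hn : m * h n + ℓ n ≤ n) :
    G.bias K m d ℓ h n ^ 2 ≤ G.mse K m d ℓ h n := by
  rw [← integral_vHat_sub hN hγ hK hℓ hn, mse]
  exact sq_integral_le ((memLp_vHat hN hK hℓ).sub (memLp_const _))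

/-- The error is a centred quadratic form plus twice a centred linear form plus the bias, and `(x +
2y + z)² ≤ 3x² + 12y² + 3z²`. -/
theorem mse_le (hN : G.noise.WeaklyDependent) (hγ : Summable G.noise.acvf) (hK : IsKernel K)
    {A : ℝ} (hA : ∀ t, |K t| ≤ A) {C : ℝ} (hC0 : 0 ≤ C) (hℓ : 1 ≤ ℓ n) (hn : m * h n + ℓ n ≤ n)
    (hx : ∀ i ∈ Icc ((m : ℤ) * h n + 1) (n : ℤ), |G.mean.M m d n (h n) i| ≤ C)
    (hxs : ∑ i ∈ Icc ((m : ℤ) * h n + 1) (n : ℤ), |G.mean.M m d n (h n) i| ≤ C * h n) :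
    G.mse K m d ℓ h n ≤ 36 * G.noise.totalInfl m d ^ 4 * A ^ 2 * ((ℓ n : ℝ) / n)
      + 48 * G.noise.totalInfl m d ^ 2 * A ^ 2 * C ^ 2 * ((ℓ n : ℝ) / n * (ℓ n * h n / n))
      + 3 * G.bias K m d ℓ h n ^ 2 := by
  have hA0 : 0 ≤ A := (abs_nonneg _).trans (hA 0)
  have hnpos : (0 : ℝ) < n := by exact_mod_cast (by omega : 0 < n)
  set Θ := G.noise.totalInfl m d with hΘ
  have hΘ0 : 0 ≤ Θ := NoiseModel.totalInfl_nonneg m d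
  have H := hN.influenceBound m d (h n) (Icc ((m : ℤ) * h n + 1) (n : ℤ))
  set QW := fun ω => qform K m n (ℓ n) (h n) (fun i => G.noise.W m d (h n) i ω)
    (fun i => G.noise.W m d (h n) i ω) with hQW
  set L := fun ω => qform K m n (ℓ n) (h n) (G.mean.M m d n (h n))
    (fun i => G.noise.W m d (h n) i ω) with hL
  have hEQ : ∫ ω, QW ω ∂G.noise.P = G.noise.bias K m d n (ℓ n) (h n) + G.noise.lrv :=
    hN.integral_qform_W hγ hK m d hℓ hn
  have hQm : MemLp QW 2 G.noise.P := memLp_qform_W hN K m d n _ _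
  have hLm : MemLp L 2 G.noise.P := memLp_two_of_four (memLp_qform_M_W hN K m d n _ _ _)
  have hdec : ∀ ω, G.vHat K m d n (ℓ n) (h n) ω - G.noise.lrv
      = (QW ω - ∫ ω', QW ω' ∂G.noise.P) + 2 * L ω + G.bias K m d ℓ h n := by
    intro ω
    rw [G.vHat_eq hK m d (n := n) (h n) hℓ, hEQ, bias]
    ring
  have hvar : ∫ ω, (QW ω - ∫ ω', QW ω' ∂G.noise.P) ^ 2 ∂G.noise.P
      ≤ 12 * Θ ^ 4 * A ^ 2 * ((ℓ n : ℝ) / n) := by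
    -- A row of the weight matrix has at most `2ℓ` nonzero entries, each at most `A/n` in absolute
    -- value.
    have h1 := H.quadratic_variance_le (NoiseModel.totalInfl_nonneg m d)
      (a := fun i j => 1 / (n : ℝ) * K (((i - j : ℤ) : ℝ) / ℓ n))
      (fun i j => by rw [← hK.even_int, neg_sub]) (c := 2 * ℓ n * (A / n) ^ 2) (by
        intro i _
        have := sum_abs_band_le (g := fun k : ℤ => (1 / (n : ℝ) * K ((k : ℝ) / ℓ n)) ^ 2)
          (c := (A / n) ^ 2) (ℓ := ℓ n) (by positivity)
          (fun k hk => by simp only [hK.support_int hℓ hk]; simp)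
          (fun k => by
            rw [abs_pow]
            exact pow_le_pow_left₀ (abs_nonneg _) (band_weight_abs_le hA k) 2)
          (Icc ((m : ℤ) * h n + 1) (n : ℤ)) i
        simpa only [abs_pow, sq_abs] using this) (by positivity)
    refine h1.trans ?_
    calc 6 * Θ ^ 4 * (2 * ℓ n * (A / n) ^ 2) * ((Icc ((m : ℤ) * h n + 1) (n : ℤ)).card : ℝ)
        ≤ 6 * Θ ^ 4 * (2 * ℓ n * (A / n) ^ 2) * n := by
          have := card_window_le m n (h n)
          gcongr
      _ = 12 * Θ ^ 4 * A ^ 2 * ((ℓ n : ℝ) / n) := by field_simp; ring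
  have hlin : ∫ ω, L ω ^ 2 ∂G.noise.P
      ≤ 4 * Θ ^ 2 * A ^ 2 * C ^ 2 * ((ℓ n : ℝ) / n * (ℓ n * h n / n)) := by
    simp only [hL, sum_qform_eq_linear]
    refine (H.linear_sq_le (NoiseModel.totalInfl_nonneg m d) _).trans ?_
    have := sum_sq_smoothed_le (m := m) (n := n) (h := h n) hK hA hℓ hC0 hx hxs
    calc _ ≤ Θ ^ 2 * (4 * A ^ 2 * C ^ 2 * ((ℓ n : ℝ) / n * (ℓ n * h n / n))) := by gcongr
      _ = _ := by ring
  have i1 : Integrable (fun ω => (QW ω - ∫ ω', QW ω' ∂G.noise.P) ^ 2) G.noise.P :=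
    (hQm.sub (memLp_const _)).integrable_sq
  have i2 : Integrable (fun ω => L ω ^ 2) G.noise.P := hLm.integrable_sq
  have hle : G.mse K m d ℓ h n ≤ ∫ ω, (3 * (QW ω - ∫ ω', QW ω' ∂G.noise.P) ^ 2 + 12 * L ω ^ 2
      + 3 * G.bias K m d ℓ h n ^ 2) ∂G.noise.P := by
    refine integral_mono ((memLp_vHat hN hK hℓ).sub (memLp_const _)).integrable_sq
      (((i1.const_mul 3).add (i2.const_mul 12)).add (integrable_const _)) fun ω => ?_
    simp only [hdec]
    nlinarith [sq_nonneg ((QW ω - ∫ ω', QW ω' ∂G.noise.P) - 2 * L ω),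
      sq_nonneg ((QW ω - ∫ ω', QW ω' ∂G.noise.P) - G.bias K m d ℓ h n),
      sq_nonneg (2 * L ω - G.bias K m d ℓ h n)]
  rw [integral_add (by exact (i1.const_mul 3).add (i2.const_mul 12)) (integrable_const _),
    integral_add (i1.const_mul 3) (i2.const_mul 12), integral_const_mul, integral_const_mul] at hle
  simp only [integral_const, probReal_univ, one_smul] at hle
  linarith

end DGM

/-! ### Asymptotic upper bound for the mean squared error -/

namespace Admissible

variable {m : ℕ} {ℓ h : ℕ → ℕ}

lemma tendsto_aux (H : Admissible m ℓ h) :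
    Tendsto (fun n : ℕ => 1 / (ℓ n : ℝ)) atTop (𝓝 0) ∧
      Tendsto (fun n : ℕ => ((ℓ n : ℝ) + m * h n) / n) atTop (𝓝 0) := by
  have h1 : ∀ n : ℕ, (0 : ℝ) ≤ 1 / (ℓ n : ℝ) := fun n => by positivity
  have h2 : ∀ n : ℕ, (0 : ℝ) ≤ ((ℓ n : ℝ) + m * h n) / n := fun n => by positivity
  exact ⟨squeeze_zero h1 (fun n => le_add_of_nonneg_right (h2 n)) H.lim,
    squeeze_zero h2 (fun n => le_add_of_nonneg_left (h1 n)) H.lim⟩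

lemma tendsto_bandwidth (H : Admissible m ℓ h) : Tendsto (fun n => (ℓ n : ℝ)) atTop atTop := by
  have h1 := H.tendsto_aux.1
  have h2 : ∀ᶠ n in atTop, (0 : ℝ) < 1 / (ℓ n : ℝ) := by
    filter_upwards [eventually_ge_atTop 1] with n hn
    have : (0 : ℝ) < ℓ n := by exact_mod_cast (H.range_ℓ n hn).1
    positivity
  refine (tendsto_nhdsWithin_iff.2 ⟨h1, h2⟩).inv_tendsto_nhdsGT_zero.congr fun n => ?_
  simp

lemma eventually_le (H : Admissible m ℓ h) : ∀ᶠ n in atTop, m * h n + ℓ n ≤ n := by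
  filter_upwards [H.tendsto_aux.2.eventually (gt_mem_nhds zero_lt_one), eventually_ge_atTop 1] with n hn h1
  have hnpos : (0 : ℝ) < n := by exact_mod_cast h1
  rw [div_lt_one hnpos] at hn
  have : ((m * h n + ℓ n : ℕ) : ℝ) ≤ n := by push_cast; linarith
  exact_mod_cast this

end Admissible

/-- Near the origin this is the expansion of `K`; elsewhere boundedness is absorbed in the constant.
-/
lemma NearOrigin.abs_sub_one_le {K : ℝ → ℝ} (hK : IsKernel K) {q : ℕ} {B : ℝ}
    (hq : NearOrigin K q B) {p : ℕ} (hp : p ≤ q) : ∃ C : ℝ, 0 ≤ C ∧ ∀ t, |K t - 1| ≤ C * |t| ^ p := by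
  obtain ⟨A, hA⟩ := hK.bounded
  have hev : ∀ᶠ t in 𝓝[>] (0 : ℝ), |(K t - K 0) / |t| ^ q| < |B| + 1 :=
    hq.lim.abs.eventually (gt_mem_nhds (lt_add_one _))
  obtain ⟨δ, hδ, hδ'⟩ := mem_nhdsGT_iff_exists_Ioo_subset.1 hev
  rw [Set.mem_Ioi] at hδ
  have hA0 : 0 ≤ A := (abs_nonneg _).trans (hA 0)
  set δ' := min δ 1 with hδ1
  have hδ0 : 0 < δ' := lt_min hδ one_pos
  refine ⟨max (|B| + 1) ((A + 1) / δ' ^ p), le_max_of_le_left (by positivity), ?_⟩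
  have pos : ∀ t, 0 < t → |K t - 1| ≤ max (|B| + 1) ((A + 1) / δ' ^ p) * |t| ^ p := by
    intro t ht
    rcases lt_or_ge t δ' with hlt | hge
    · have h1 : |(K t - K 0) / |t| ^ q| < |B| + 1 := hδ' ⟨ht, hlt.trans_le (min_le_left _ _)⟩
      have ht1 : |t| ≤ 1 := by rw [abs_of_pos ht]; exact hlt.le.trans (min_le_right _ _)
      have htq : 0 < |t| ^ q := by positivity
      rw [abs_div, abs_of_pos htq, div_lt_iff₀ htq, hK.zero] at h1
      calc |K t - 1| ≤ (|B| + 1) * |t| ^ q := h1.le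
        _ ≤ (|B| + 1) * |t| ^ p := by
          gcongr ?_ * ?_
          exact pow_le_pow_of_le_one (abs_nonneg _) ht1 hp
        _ ≤ _ := by gcongr; exact le_max_left _ _
    · calc |K t - 1| ≤ A + 1 := (abs_sub _ _).trans (by simpa using hA t)
        _ = (A + 1) / δ' ^ p * δ' ^ p := by field_simp
        _ ≤ (A + 1) / δ' ^ p * |t| ^ p := by rw [abs_of_pos ht]; gcongr
        _ ≤ _ := by gcongr; exact le_max_right _ _
  intro t
  rcases lt_trichotomy t 0 with h | rfl | h
  · have := pos (-t) (by linarith)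
    rwa [hK.even, abs_neg] at this
  · rw [hK.zero, sub_self, abs_zero]
    exact mul_nonneg (le_max_of_le_left (by positivity)) (by positivity)
  · exact pos t h

/-- The kernel at lags displaced by nonzero multiples of `h` is of the order `((1 + |x|)/ℓ)^p`. -/
def OffDiag (K : ℝ → ℝ) (ℓ h : ℕ → ℕ) (p : ℕ) : Prop :=
  ∃ C : ℝ, 0 ≤ C ∧ ∀ᶠ n in atTop, ∀ x s : ℤ, s ≠ 0 →
    |K (((x - s * h n : ℤ) : ℝ) / ℓ n)| ≤ C * ((1 + |(x : ℝ)|) / ℓ n) ^ p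

/-- The weights of the autocovariances, without the correction for the sample size. -/
def rawWeight (K : ℝ → ℝ) (m : ℕ) (d : ℕ → ℝ) (ℓ h : ℕ) (x : ℤ) : ℝ :=
  ∑ j ∈ range (m + 1), ∑ j' ∈ range (m + 1),
    d j * d j' * K (((x - ((j : ℤ) - j') * h : ℤ) : ℝ) / ℓ)

/-- The diagonal terms carry total weight `∑ d_j² = 1` and involve `K(x/ℓ) - 1`; the others are
controlled by `OffDiag`. -/
lemma abs_rawWeight_sub_one_le {K : ℝ → ℝ} (hK : IsKernel K) {q : ℕ} {B : ℝ}
    (hq : NearOrigin K q B) {p : ℕ} (hp : p ≤ q) {m : ℕ} {d : ℕ → ℝ} (hd : IsDiffSeq m d)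
    {ℓ h : ℕ → ℕ} (hoff : OffDiag K ℓ h p) :
    ∃ C : ℝ, 0 ≤ C ∧ ∀ᶠ n in atTop, ∀ x : ℤ,
      |rawWeight K m d (ℓ n) (h n) x - 1| ≤ C * ((1 + |(x : ℝ)|) / ℓ n) ^ p := by
  obtain ⟨C₁, hC₁, h1⟩ := hq.abs_sub_one_le hK hp
  obtain ⟨C₂, hC₂, h2⟩ := hoff
  refine ⟨(∑ j ∈ range (m + 1), ∑ j' ∈ range (m + 1), |d j * d j'|) * (C₁ + C₂),
    mul_nonneg (Finset.sum_nonneg fun _ _ => Finset.sum_nonneg fun _ _ => abs_nonneg _)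
      (by positivity), ?_⟩
  filter_upwards [h2] with n hn x
  have e : rawWeight K m d (ℓ n) (h n) x - 1 = ∑ j ∈ range (m + 1), ∑ j' ∈ range (m + 1),
      d j * d j' * (K (((x - ((j : ℤ) - j') * h n : ℤ) : ℝ) / ℓ n) - if j = j' then 1 else 0) := by
    have : ∑ j ∈ range (m + 1), ∑ j' ∈ range (m + 1),
        d j * d j' * (if j = j' then (1 : ℝ) else 0) = 1 := by
      refine Eq.trans ?_ hd.sum_sq
      refine Finset.sum_congr rfl fun j hj => ?_
      simp only [mul_ite, mul_one, mul_zero, Finset.sum_ite_eq, if_pos hj]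
      ring
    simp only [rawWeight, mul_sub, Finset.sum_sub_distrib, this]
  rw [e, Finset.sum_mul]
  refine (Finset.abs_sum_le_sum_abs _ _).trans ?_
  rw [Finset.sum_mul]
  refine Finset.sum_le_sum fun j _ => ?_
  rw [Finset.sum_mul, Finset.sum_mul]
  refine (Finset.abs_sum_le_sum_abs _ _).trans (Finset.sum_le_sum fun j' _ => ?_)
  rw [abs_mul, mul_assoc]
  refine mul_le_mul_of_nonneg_left ?_ (abs_nonneg _)
  have hX : (0 : ℝ) ≤ ((1 + |(x : ℝ)|) / ℓ n) ^ p := by positivity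
  by_cases hjj : j = j'
  · subst hjj
    simp only [sub_self, zero_mul, sub_zero, if_true]
    calc _ ≤ C₁ * |(x : ℝ) / ℓ n| ^ p := h1 _
      _ ≤ C₁ * ((1 + |(x : ℝ)|) / ℓ n) ^ p := by
        rw [abs_div, Nat.abs_cast]
        gcongr
        linarith
      _ ≤ _ := by nlinarith
  · rw [if_neg hjj, sub_zero]
    calc _ ≤ C₂ * ((1 + |(x : ℝ)|) / ℓ n) ^ p := hn x _ (by
          intro h0; exact hjj (by exact_mod_cast sub_eq_zero.1 h0))
      _ ≤ _ := by nlinarith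

/-- A lag `y` in the support loses the fraction `(mh + |y|)/n ≤ (mh + ℓ)/n` of the sample. -/
lemma abs_acvfWeight_sub_rawWeight_le {K : ℝ → ℝ} (hK : IsKernel K) {A : ℝ} (hA : ∀ t, |K t| ≤ A)
    (m : ℕ) (d : ℕ → ℝ) {n ℓ : ℕ} (h : ℕ) (hℓ : 1 ≤ ℓ) (hn : 1 ≤ n) (x : ℤ) :
    |acvfWeight K m d n ℓ h x - rawWeight K m d ℓ h x|
      ≤ (∑ j ∈ range (m + 1), ∑ j' ∈ range (m + 1), |d j * d j'|) * A * ((m * h + ℓ) / n) := by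
  have hA0 : 0 ≤ A := (abs_nonneg _).trans (hA 0)
  have hnpos : (0 : ℝ) < n := by exact_mod_cast hn
  have key : ∀ y : ℤ, |wKernel K m n ℓ h y - K ((y : ℝ) / ℓ)| ≤ A * ((m * h + ℓ) / n) := by
    intro y
    rcases le_or_gt (ℓ : ℤ) |y| with hy | hy
    · rw [wKernel_zero hK hℓ hy, hK.support_int hℓ hy, sub_zero, abs_zero]
      positivity
    · have e : wKernel K m n ℓ h y - K ((y : ℝ) / ℓ) = -(K ((y : ℝ) / ℓ) * ((m * h + |(y : ℝ)|) / n)) := by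
        rw [wKernel]; field_simp; ring
      rw [e, abs_neg, abs_mul]
      have hy' : |(y : ℝ)| ≤ ℓ := by exact_mod_cast hy.le
      rw [abs_of_nonneg (by positivity : (0 : ℝ) ≤ (m * h + |(y : ℝ)|) / n)]
      gcongr
      exact hA _
  simp only [acvfWeight, rawWeight, ← Finset.sum_sub_distrib, ← mul_sub]
  rw [Finset.sum_mul, Finset.sum_mul]
  refine (Finset.abs_sum_le_sum_abs _ _).trans (Finset.sum_le_sum fun j _ => ?_)
  rw [Finset.sum_mul, Finset.sum_mul]
  refine (Finset.abs_sum_le_sum_abs _ _).trans (Finset.sum_le_sum fun j' _ => ?_)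
  rw [abs_mul, mul_assoc]
  exact mul_le_mul_of_nonneg_left (key _) (abs_nonneg _)

lemma summable_one_add_pow_mul {γ : ℤ → ℝ} {q : ℕ} (hγ : Summable fun k : ℤ => |(k : ℝ)| ^ q * |γ k|)
    {p : ℕ} (hp : p ≤ q) : Summable fun k : ℤ => (1 + |(k : ℝ)|) ^ p * |γ k| := by
  have h0 : Summable fun k : ℤ => if k = 0 then |γ 0| else 0 :=
    summable_of_ne_finset_zero (s := {0}) fun k hk => if_neg (by simpa using hk)
  refine Summable.of_nonneg_of_le (fun k => by positivity) (fun k => ?_)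
    ((hγ.mul_left (2 ^ q)).add h0)
  by_cases hk : k = 0
  · subst hk
    simp only [if_true, Int.cast_zero, abs_zero, add_zero, one_pow, one_mul]
    exact le_add_of_nonneg_left (by positivity)
  · rw [if_neg hk, add_zero, ← mul_assoc, ← mul_pow]
    refine mul_le_mul_of_nonneg_right ?_ (abs_nonneg _)
    have h1 : (1 : ℝ) ≤ |(k : ℝ)| := by exact_mod_cast Int.one_le_abs hk
    calc (1 + |(k : ℝ)|) ^ p ≤ (1 + |(k : ℝ)|) ^ q := pow_le_pow_right₀ (by linarith) hp
      _ ≤ (2 * |(k : ℝ)|) ^ q := by gcongr; linarith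

lemma summable_of_finiteU {γ : ℤ → ℝ} {q : ℕ} (hγ : Summable fun k : ℤ => |(k : ℝ)| ^ q * |γ k|) :
    Summable γ := by
  have := summable_one_add_pow_mul hγ (Nat.zero_le q)
  simp only [pow_zero, one_mul] at this
  exact this.of_abs

/-- The pointwise bound on the weights grows like `(1 + |x|)^p`, which is summable against the
autocovariances because `p ≤ q`. -/
lemma NoiseModel.abs_bias_le {N : NoiseModel.{u}} {K : ℝ → ℝ} (hK : IsKernel K) {q : ℕ} {B : ℝ}
    (hq : NearOrigin K q B) {p : ℕ} (hp : p ≤ q) {m : ℕ} {d : ℕ → ℝ} (hd : IsDiffSeq m d)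
    {ℓ h : ℕ → ℕ} (H : Admissible m ℓ h) (hoff : OffDiag K ℓ h p) (hN : N.FiniteU q) :
    ∃ C : ℝ, 0 ≤ C ∧ ∀ᶠ n in atTop,
      |N.bias K m d n (ℓ n) (h n)| ≤ C * ((1 / (ℓ n : ℝ)) ^ p + (m * h n + ℓ n) / n) := by
  obtain ⟨A, hA⟩ := hK.bounded
  have hA0 : 0 ≤ A := (abs_nonneg _).trans (hA 0)
  obtain ⟨C, hC, h1⟩ := abs_rawWeight_sub_one_le hK hq hp hd hoff
  set S := ∑ j ∈ range (m + 1), ∑ j' ∈ range (m + 1), |d j * d j'| with hS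
  have hS0 : 0 ≤ S := Finset.sum_nonneg fun _ _ => Finset.sum_nonneg fun _ _ => abs_nonneg _
  have hs := summable_one_add_pow_mul hN hp
  set U := ∑' k : ℤ, (1 + |(k : ℝ)|) ^ p * |N.acvf k| with hU
  have hU0 : 0 ≤ U := tsum_nonneg fun k => by positivity
  refine ⟨(C + S * A) * U, by positivity, ?_⟩
  filter_upwards [h1, eventually_ge_atTop 1] with n hn hn1
  have hℓ := (H.range_ℓ n hn1).1
  set r := (1 / (ℓ n : ℝ)) ^ p with hr
  set e := ((m : ℝ) * h n + ℓ n) / n with he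
  have hr0 : 0 ≤ r := by positivity
  have he0 : 0 ≤ e := by positivity
  have hpt : ∀ x : ℤ, |N.acvf x * (acvfWeight K m d n (ℓ n) (h n) x - 1)|
      ≤ (C + S * A) * (r + e) * ((1 + |(x : ℝ)|) ^ p * |N.acvf x|) := by
    intro x
    have h2 := abs_acvfWeight_sub_rawWeight_le hK hA m d (h n) hℓ hn1 x
    have h3 := hn x
    have h4 : (1 : ℝ) ≤ (1 + |(x : ℝ)|) ^ p := one_le_pow₀ (by linarith [abs_nonneg (x : ℝ)])
    have h5 : |acvfWeight K m d n (ℓ n) (h n) x - 1| ≤ (C + S * A) * (r + e) * (1 + |(x : ℝ)|) ^ p := by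
      calc |acvfWeight K m d n (ℓ n) (h n) x - 1|
          = |(acvfWeight K m d n (ℓ n) (h n) x - rawWeight K m d (ℓ n) (h n) x) +
            (rawWeight K m d (ℓ n) (h n) x - 1)| := by ring_nf
        _ ≤ S * A * e + C * ((1 + |(x : ℝ)|) / ℓ n) ^ p := (abs_add_le _ _).trans (add_le_add h2 h3)
        _ = S * A * e + C * (r * (1 + |(x : ℝ)|) ^ p) := by
            rw [hr, ← mul_pow]; congr 3; ring
        _ ≤ S * A * e * (1 + |(x : ℝ)|) ^ p + C * (r * (1 + |(x : ℝ)|) ^ p) := by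
            exact add_le_add (le_mul_of_one_le_right (by positivity) h4) le_rfl
        _ ≤ (C + S * A) * (r + e) * (1 + |(x : ℝ)|) ^ p := by
            have : 0 ≤ (C * e + S * A * r) * (1 + |(x : ℝ)|) ^ p := by positivity
            linarith
    rw [abs_mul, mul_comm, ← mul_assoc]
    exact mul_le_mul_of_nonneg_right h5 (abs_nonneg _)
  have hsum : Summable fun x : ℤ => N.acvf x * (acvfWeight K m d n (ℓ n) (h n) x - 1) :=
    (Summable.of_nonneg_of_le (fun _ => abs_nonneg _) hpt (hs.mul_left _)).of_abs
  calc |N.bias K m d n (ℓ n) (h n)|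
      ≤ ∑' x : ℤ, |N.acvf x * (acvfWeight K m d n (ℓ n) (h n) x - 1)| := by
        have := norm_tsum_le_tsum_norm (f := fun x : ℤ =>
          N.acvf x * (acvfWeight K m d n (ℓ n) (h n) x - 1)) hsum.abs
        simpa only [Real.norm_eq_abs, NoiseModel.bias] using this
    _ ≤ (C + S * A) * (r + e) * U := by
        rw [hU, ← tsum_mul_left]
        exact hsum.abs.tsum_le_tsum hpt (hs.mul_left _)
    _ = (C + S * A) * U * (r + e) := by ring

lemma DGM.InClass.exists_bound {G : DGM.{u}} {q : ℕ} (hG : G.InClass q) :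
    ∃ A : ℝ, 0 ≤ A ∧ ∀ᶠ n in atTop, (G.mean.J n : ℝ) ≤ A ∧
      G.mean.jumpSize n ≤ ENNReal.ofReal A ∧ G.mean.smoothness n ≤ ENNReal.ofReal A := by
  obtain ⟨A₁, hA₁, h1⟩ := hG.jumps
  obtain ⟨A₂, hA₂, h2⟩ := hG.jumpSize
  obtain ⟨A₃, hA₃, h3⟩ := hG.smoothness
  refine ⟨A₁ + A₂ + A₃, by positivity, ?_⟩
  filter_upwards [h1, h2, h3] with n hn1 hn2 hn3
  refine ⟨?_, hn2.2.trans (ENNReal.ofReal_le_ofReal (by linarith)),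
    hn3.2.trans (ENNReal.ofReal_le_ofReal (by linarith))⟩
  have h4 := hn1.2
  rw [← ENNReal.ofReal_natCast, ENNReal.ofReal_le_ofReal_iff hA₁.le] at h4
  linarith

/-- The upper bound for the mean squared error. -/
theorem mse_isBigO {K : ℝ → ℝ} (hK : IsKernel K) {q : ℕ} {B : ℝ}
    (hq : NearOrigin K q B) {p : ℕ} (hp : p ≤ q) {m : ℕ} {d : ℕ → ℝ} (hd : IsDiffSeq m d)
    {ℓ h : ℕ → ℕ} (H : Admissible m ℓ h) (hoff : OffDiag K ℓ h p) {G : DGM.{u}}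
    (hG : G.InClass q) :
    ∃ C : ℝ, 0 ≤ C ∧ ∀ᶠ n in atTop, G.mse K m d ℓ h n ≤ C * ((ℓ n : ℝ) / n +
      (ℓ n : ℝ) / n * (ℓ n * h n / n) + ((1 / (ℓ n : ℝ)) ^ p) ^ 2 + ((ℓ n : ℝ) * h n / n) ^ 2) := by
  obtain ⟨A, hA⟩ := hK.bounded
  have hA0 : 0 ≤ A := (abs_nonneg _).trans (hA 0)
  obtain ⟨A', hA', hb⟩ := hG.exists_bound
  obtain ⟨C₁, hC₁, h1⟩ := NoiseModel.abs_bias_le hK hq hp hd H hoff hG.finite_u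
  set Θ := G.noise.totalInfl m d with hΘ
  have hΘ0 : 0 ≤ Θ := NoiseModel.totalInfl_nonneg m d
  set C := MeanModel.meanBound m d A' with hC
  have hC0 : 0 ≤ C := MeanModel.meanBound_nonneg m d hA'
  set C₂ := C₁ * (m + 1) + 2 * A * C ^ 2 with hC₂
  have hC₂0 : 0 ≤ C₂ := by positivity
  refine ⟨36 * Θ ^ 4 * A ^ 2 + 48 * Θ ^ 2 * A ^ 2 * C ^ 2 + 6 * C₁ ^ 2 + 6 * C₂ ^ 2, by positivity, ?_⟩
  filter_upwards [hb, h1, H.eventually_le, eventually_ge_atTop 1] with n ⟨hJ, hj, hs⟩ hbias hle hn1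
  have hℓ := (H.range_ℓ n hn1).1
  have hh := (H.range_h n hn1).1
  have hx := fun i hi => G.mean.abs_M_le_meanBound hd hn1 (H.range_h n hn1).2 hA' hs hj hJ (i := i) hi
  have hxs := G.mean.sum_abs_M_le hd (h := h n) hn1 hA' hs hj hJ
  refine (DGM.mse_le hG.weak (summable_of_finiteU hG.finite_u) hK hA hC0 hℓ hle hx hxs).trans ?_
  have hnpos : (0 : ℝ) < n := by exact_mod_cast hn1
  have hℓ' : (1 : ℝ) ≤ ℓ n := by exact_mod_cast hℓ
  have hh' : (1 : ℝ) ≤ h n := by exact_mod_cast hh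
  set a := (ℓ n : ℝ) / n with ha
  set b := (ℓ n : ℝ) * h n / n with hb'
  set r := (1 / (ℓ n : ℝ)) ^ p with hr
  have hq1 := abs_qform_self_le hK hA hℓ hC0 hx hxs
  -- As `ℓ, h ≥ 1`, the sample-size correction is absorbed by the mean part `ℓh/n`.
  have e1 : ((m : ℝ) * h n + ℓ n) / n ≤ (m + 1) * b := by
    rw [hb', ← mul_div_assoc]
    gcongr
    nlinarith [mul_nonneg (sub_nonneg.2 hℓ') (sub_nonneg.2 hh'),
      mul_nonneg (Nat.cast_nonneg m : (0 : ℝ) ≤ m) (mul_nonneg (sub_nonneg.2 hℓ')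
        (Nat.cast_nonneg (h n) : (0 : ℝ) ≤ h n))]
  have hb0 : 0 ≤ b := by positivity
  have hr0 : 0 ≤ r := by positivity
  have ha0 : 0 ≤ a := by positivity
  have hbb : |G.bias K m d ℓ h n| ≤ C₁ * r + C₂ * b := by
    rw [DGM.bias]
    refine (abs_add_le _ _).trans ((add_le_add hbias hq1).trans ?_)
    have := mul_le_mul_of_nonneg_left e1 hC₁
    rw [hC₂]
    linarith
  have hb2 : G.bias K m d ℓ h n ^ 2 ≤ 2 * C₁ ^ 2 * r ^ 2 + 2 * C₂ ^ 2 * b ^ 2 := by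
    have := pow_le_pow_left₀ (abs_nonneg _) hbb 2
    rw [sq_abs] at this
    nlinarith [sq_nonneg (C₁ * r - C₂ * b)]
  set k₁ := 36 * Θ ^ 4 * A ^ 2
  set k₂ := 48 * Θ ^ 2 * A ^ 2 * C ^ 2
  have hk₁ : 0 ≤ k₁ := by positivity
  have hk₂ : 0 ≤ k₂ := by positivity
  calc k₁ * a + k₂ * (a * b) + 3 * G.bias K m d ℓ h n ^ 2
      ≤ k₁ * a + k₂ * (a * b) + 6 * C₁ ^ 2 * r ^ 2 + 6 * C₂ ^ 2 * b ^ 2 := by linarith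
    _ ≤ _ := by
        have t1 : 0 ≤ (k₂ + 6 * C₁ ^ 2 + 6 * C₂ ^ 2) * a := by positivity
        have t2 : 0 ≤ (k₁ + 6 * C₁ ^ 2 + 6 * C₂ ^ 2) * (a * b) := by positivity
        have t3 : 0 ≤ (k₁ + k₂ + 6 * C₂ ^ 2) * r ^ 2 := by positivity
        have t4 : 0 ≤ (k₁ + k₂ + 6 * C₁ ^ 2) * b ^ 2 := by positivity
        linarith

/-! ### Linear processes with Rademacher innovations -/

/-- The fair coin. -/
def coin : Measure Bool := (2⁻¹ : ℝ≥0∞) • Measure.dirac true + (2⁻¹ : ℝ≥0∞) • Measure.dirac false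

instance : IsProbabilityMeasure coin := ⟨by simp [coin, ENNReal.inv_two_add_inv_two]⟩

lemma coin_map_not : coin.map not = coin := by
  have hm : Measurable not := measurable_from_top
  rw [coin, Measure.map_add _ _ hm, Measure.map_smul, Measure.map_smul, Measure.map_dirac' hm,
    Measure.map_dirac' hm, add_comm]
  rfl

/-- The sign `±1` of a coin toss. -/
def sgn (b : Bool) : ℝ := if b then 1 else -1

lemma sgn_not (b : Bool) : sgn (!b) = -sgn b := by cases b <;> simp [sgn]

lemma abs_sgn (b : Bool) : |sgn b| = 1 := by cases b <;> simp [sgn]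

lemma sgn_mul_self (b : Bool) : sgn b * sgn b = 1 := by cases b <;> simp [sgn]

lemma continuous_linear_filter {a : ℕ → ℝ} (ha : Summable fun j => |a j|) :
    Continuous fun x : ℕ → Bool => ∑' j, a j * sgn (x j) := by
  refine continuous_tsum (u := fun j => |a j|) (fun j => ?_) ha fun j x => ?_
  · exact continuous_const.mul ((continuous_of_discreteTopology (f := sgn)).comp (continuous_apply j))
  · rw [Real.norm_eq_abs, abs_mul, abs_sgn, mul_one]

/-- The linear process `Z_i = ∑_j a_j ε_{i-j}` with Rademacher innovations. -/
def linNoise (a : ℕ → ℝ) (ha : Summable fun j => |a j|) : NoiseModel.{0} where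
  E := Bool
  ν := coin
  g x := ∑' j, a j * sgn (x j)
  measurable_g := (continuous_linear_filter ha).measurable

/-- The coefficients extended by zero to negative indices. -/
def zext (a : ℕ → ℝ) (z : ℤ) : ℝ := if 0 ≤ z then a z.toNat else 0

@[simp] lemma zext_natCast (a : ℕ → ℝ) (n : ℕ) : zext a n = a n := by simp [zext]

/-- The law of the coin tosses. -/
abbrev tosses : Measure (ℤ → Bool) := Measure.infinitePi fun _ : ℤ => coin

/-- The Rademacher innovation at time `p`. -/
def eps (p : ℤ) (ω : ℤ → Bool) : ℝ := sgn (ω p)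

lemma measurable_eps (p : ℤ) : Measurable (eps p) :=
  (measurable_from_top (f := sgn)).comp (measurable_pi_apply p)

lemma abs_eps (p : ℤ) (ω : ℤ → Bool) : |eps p ω| = 1 := abs_sgn _

lemma eps_mul_self (p : ℤ) (ω : ℤ → Bool) : eps p ω * eps p ω = 1 := sgn_mul_self _

/-- Flip the coins at the times in `S`. -/
def flip (S : Set ℤ) (ω : ℤ → Bool) : ℤ → Bool := open Classical in fun i => if i ∈ S then !ω i else ω i

lemma measurePreserving_flip (S : Set ℤ) : MeasurePreserving (flip S) tosses tosses := by
  classical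
  have hf : ∀ i : ℤ, Measurable fun b : Bool => if i ∈ S then !b else b := fun i => measurable_from_top
  have heq : flip S = fun ω i => (fun b : Bool => if i ∈ S then !b else b) (ω i) := by
    funext ω i; simp only [flip]
  refine ⟨by rw [heq]; exact measurable_pi_lambda _ fun i => (hf i).comp (measurable_pi_apply i), ?_⟩
  rw [heq, tosses, Measure.infinitePi_map_pi _ hf]
  congr 1
  funext i
  split_ifs
  exacts [coin_map_not, Measure.map_id]

lemma eps_flip_of_mem {S : Set ℤ} {p : ℤ} (hp : p ∈ S) (ω : ℤ → Bool) :
    eps p (flip S ω) = -eps p ω := by simp [eps, flip, hp, sgn_not]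

lemma eps_flip_of_notMem {S : Set ℤ} {p : ℤ} (hp : p ∉ S) (ω : ℤ → Bool) :
    eps p (flip S ω) = eps p ω := by simp [eps, flip, hp]

/-- Sign flips preserve the law of the tosses, so odd functions integrate to zero. This takes the
place of independence arguments for the moments below. -/
lemma integral_eq_zero_of_flip (S : Set ℤ) {Y : (ℤ → Bool) → ℝ} (hY : Measurable Y)
    (h : ∀ ω, Y (flip S ω) = -Y ω) : ∫ ω, Y ω ∂tosses = 0 := by
  have h1 := integral_comp_measurePreserving (measurePreserving_flip S) hY.aestronglyMeasurable
  simp only [h, integral_neg] at h1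
  linarith

lemma integral_eps_mul_eps (p q : ℤ) :
    ∫ ω, eps p ω * eps q ω ∂tosses = if p = q then 1 else 0 := by
  split_ifs with h
  · subst h; simp [eps_mul_self]
  · refine integral_eq_zero_of_flip {p} ((measurable_eps p).mul (measurable_eps q)) fun ω => ?_
    rw [eps_flip_of_mem (by simp), eps_flip_of_notMem (by simpa using Ne.symm h)]; ring

lemma integral_eps_four (r s : ℤ) {p q : ℤ} (hpq : p ≠ q) :
    ∫ ω, eps s ω * (eps r ω * (eps p ω * eps q ω)) ∂tosses
      = (if r = p then 1 else 0) * (if s = q then 1 else 0) +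
        (if r = q then 1 else 0) * (if s = p then 1 else 0) := by
  by_cases h1 : r = p
  · subst h1
    have : ∀ ω, eps s ω * (eps r ω * (eps r ω * eps q ω)) = eps s ω * eps q ω := fun ω => by
      rw [← mul_assoc (eps r ω), eps_mul_self, one_mul]
    simp [this, integral_eps_mul_eps, hpq]
  by_cases h2 : r = q
  · subst h2
    have : ∀ ω, eps s ω * (eps r ω * (eps p ω * eps r ω)) = eps s ω * eps p ω := fun ω => by
      rw [mul_comm (eps p ω), ← mul_assoc (eps r ω), eps_mul_self, one_mul]
    simp [this, integral_eps_mul_eps, h1]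
  simp only [h1, h2, if_false, zero_mul, add_zero]
  have hm : Measurable fun ω => eps s ω * (eps r ω * (eps p ω * eps q ω)) :=
    (measurable_eps s).mul ((measurable_eps r).mul ((measurable_eps p).mul (measurable_eps q)))
  -- The flipped index is one that occurs exactly once among `r, s, p, q`.
  refine integral_eq_zero_of_flip (if s = p then {q} else if s = q then {p} else {p}) hm fun ω => ?_
  split_ifs with h3 h4
  · subst h3
    rw [eps_flip_of_notMem (by simpa using hpq), eps_flip_of_notMem (by simpa using h2),
      eps_flip_of_mem (by simp)]
    ring
  · subst h4
    rw [eps_flip_of_notMem (by simpa using Ne.symm hpq), eps_flip_of_notMem (by simpa using h1),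
      eps_flip_of_mem (by simp)]
    ring
  · rw [eps_flip_of_notMem (by simpa using h3), eps_flip_of_notMem (by simpa using h1),
      eps_flip_of_mem (by simp), eps_flip_of_notMem (by simpa using Ne.symm hpq)]
    ring

/-- The linear process `∑_j a_j ε_{i-j}` as a function on the space of coin tosses. -/
def linZ (a : ℕ → ℝ) (i : ℤ) (ω : ℤ → Bool) : ℝ := ∑' j : ℕ, a j * eps (i - j) ω

section LinNoise

variable {a : ℕ → ℝ} (ha : Summable fun j => |a j|)

lemma linNoise_Z (i : ℤ) : (linNoise a ha).Z i = linZ a i := rfl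

lemma measurable_linZ (ha : Summable fun j => |a j|) (i : ℤ) : Measurable (linZ a i) :=
  (linNoise a ha).measurable_Z i

lemma summable_filter (ha : Summable fun j => |a j|) (i : ℤ) (ω : ℤ → Bool) : Summable fun j : ℕ => a j * eps (i - j) ω := by
  refine Summable.of_norm (ha.congr fun j => ?_)
  rw [Real.norm_eq_abs, abs_mul, abs_eps, mul_one]

lemma abs_linZ_le (ha : Summable fun j => |a j|) (i : ℤ) (ω : ℤ → Bool) : |linZ a i ω| ≤ ∑' j, |a j| := by
  rw [linZ]
  have h := norm_tsum_le_tsum_norm (f := fun j : ℕ => a j * eps (i - j) ω) (by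
    refine ha.congr fun j => ?_
    rw [Real.norm_eq_abs, abs_mul, abs_eps, mul_one])
  refine h.trans (le_of_eq (tsum_congr fun j => ?_))
  rw [Real.norm_eq_abs, abs_mul, abs_eps, mul_one]

lemma memLp_linNoise_Z (i : ℤ) (p : ℝ≥0∞) : MemLp ((linNoise a ha).Z i) p (linNoise a ha).P :=
  MemLp.of_bound ((linNoise a ha).measurable_Z i).aestronglyMeasurable (∑' j, |a j|)
    (Eventually.of_forall fun ω => abs_linZ_le ha i ω)

/-- Interchanges series and expectation; used once per factor, it reduces mixed moments of the
process to moments of the innovations. -/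
lemma integral_linZ_mul (ha : Summable fun j => |a j|) (i : ℤ) {Y : (ℤ → Bool) → ℝ} (hY : Measurable Y) {c : ℝ}
    (hc : ∀ ω, |Y ω| ≤ c) :
    ∫ ω, linZ a i ω * Y ω ∂tosses
      = ∑' j : ℕ, a j * ∫ ω, eps (i - j) ω * Y ω ∂tosses := by
  have hm : ∀ j : ℕ, Measurable fun ω => a j * (eps (i - j) ω * Y ω) := fun j =>
    ((measurable_eps _).mul hY).const_mul _
  have hb : ∀ (j : ℕ) ω, ‖a j * (eps (i - j) ω * Y ω)‖ ≤ |a j| * c := fun j ω => by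
    rw [Real.norm_eq_abs, abs_mul, abs_mul, abs_eps, one_mul]
    exact mul_le_mul_of_nonneg_left (hc ω) (abs_nonneg _)
  have hInt : ∀ j : ℕ, Integrable (fun ω => a j * (eps (i - j) ω * Y ω)) tosses := fun j =>
    Integrable.of_bound (hm j).aestronglyMeasurable _ (Eventually.of_forall (hb j))
  have hsum : Summable fun j : ℕ => ∫ ω, ‖a j * (eps (i - j) ω * Y ω)‖ ∂tosses := by
    refine Summable.of_nonneg_of_le (fun j => integral_nonneg fun _ => norm_nonneg _) (fun j => ?_)
      (ha.mul_right c)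
    calc ∫ ω, ‖a j * (eps (i - j) ω * Y ω)‖ ∂tosses ≤ ∫ _, |a j| * c ∂tosses :=
          integral_mono (hInt j).norm (integrable_const _) fun ω => hb j ω
      _ = |a j| * c := by simp
  have h1 := integral_tsum_of_summable_integral_norm hInt hsum
  simp only [integral_const_mul] at h1
  rw [h1]
  congr 1; funext ω
  rw [linZ, ← tsum_mul_right]
  exact tsum_congr fun j => by ring

lemma tsum_mul_ite_eq (a : ℕ → ℝ) (j p : ℤ) :
    ∑' l : ℕ, a l * (if j - (l : ℤ) = p then (1 : ℝ) else 0) = zext a (j - p) := by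
  rw [zext]
  split_ifs with h
  · rw [tsum_eq_single (j - p).toNat]
    · rw [if_pos, mul_one]; omega
    · intro l hl; rw [if_neg, mul_zero]; omega
  · refine (tsum_congr fun l => ?_).trans tsum_zero
    rw [if_neg, mul_zero]; omega

lemma integral_linZ_mul_linZ (ha : Summable fun j => |a j|) (i j : ℤ) :
    ∫ ω, linZ a i ω * linZ a j ω ∂tosses
      = ∑' k : ℕ, a k * zext a (j - i + k) := by
  rw [integral_linZ_mul ha i (measurable_linZ ha j) (abs_linZ_le ha j)]
  refine tsum_congr fun k => ?_
  congr 1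
  have h1 : ∀ ω, eps (i - k) ω * linZ a j ω = linZ a j ω * eps (i - k) ω :=
    fun ω => mul_comm _ _
  simp only [h1]
  rw [integral_linZ_mul ha j (measurable_eps _) (c := 1) (fun ω => (abs_eps _ ω).le)]
  simp only [integral_eps_mul_eps]
  rw [tsum_mul_ite_eq]
  congr 1; ring

/-- For `p ≠ q` only the two matchings of `ε_p, ε_q` with one innovation from each factor survive.
-/
lemma integral_linZ_mul_linZ_mul_eps (ha : Summable fun j => |a j|) (i j : ℤ) {p q : ℤ} (hpq : p ≠ q) :
    ∫ ω, linZ a i ω * (linZ a j ω * (eps p ω * eps q ω)) ∂tosses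
      = zext a (i - p) * zext a (j - q) + zext a (i - q) * zext a (j - p) := by
  have hpqm : Measurable fun ω => eps p ω * eps q ω := (measurable_eps p).mul (measurable_eps q)
  rw [integral_linZ_mul ha i (Y := fun ω => linZ a j ω * (eps p ω * eps q ω))
    ((measurable_linZ ha j).mul hpqm) (c := ∑' j, |a j|) (fun ω => by
      rw [abs_mul, abs_mul, abs_eps, abs_eps, mul_one, mul_one]
      exact abs_linZ_le ha j ω)]
  have h1 : ∀ r : ℤ, ∫ ω, eps r ω * (linZ a j ω * (eps p ω * eps q ω)) ∂tosses
      = (if r = p then 1 else 0) * zext a (j - q) + (if r = q then 1 else 0) * zext a (j - p) := by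
    intro r
    have h2 : ∀ ω, eps r ω * (linZ a j ω * (eps p ω * eps q ω))
        = linZ a j ω * (eps r ω * (eps p ω * eps q ω)) := fun ω => by ring
    simp only [h2]
    rw [integral_linZ_mul ha j (Y := fun ω => eps r ω * (eps p ω * eps q ω))
      ((measurable_eps r).mul hpqm) (c := 1) (fun ω => by
      rw [abs_mul, abs_mul, abs_eps, abs_eps, abs_eps]; norm_num)]
    simp only [integral_eps_four _ _ hpq]
    rw [← tsum_mul_ite_eq a j q, ← tsum_mul_ite_eq a j p, ← tsum_mul_left, ← tsum_mul_left,
      ← Summable.tsum_add]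
    · exact tsum_congr fun l => by ring
    · refine Summable.mul_left _ (Summable.of_norm_bounded ha fun l => ?_)
      split_ifs <;> simp
    · refine Summable.mul_left _ (Summable.of_norm_bounded ha fun l => ?_)
      split_ifs <;> simp
  simp only [h1]
  rw [← tsum_mul_ite_eq a i p, ← tsum_mul_ite_eq a i q, ← tsum_mul_right, ← tsum_mul_right,
    ← Summable.tsum_add]
  · exact tsum_congr fun l => by ring
  · refine Summable.mul_right _ (Summable.of_norm_bounded ha fun l => ?_)
    split_ifs <;> simp
  · refine Summable.mul_right _ (Summable.of_norm_bounded ha fun l => ?_)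
    split_ifs <;> simp

lemma linZ_flip_univ (a : ℕ → ℝ) (i : ℤ) (ω : ℤ → Bool) :
    linZ a i (flip Set.univ ω) = -linZ a i ω := by
  rw [linZ, linZ, ← tsum_neg]
  refine tsum_congr fun j => ?_
  rw [eps_flip_of_mem (Set.mem_univ _)]; ring

lemma linNoise_theta_le (i : ℕ) : (linNoise a ha).theta 4 i ≤ ENNReal.ofReal (2 * |a i|) := by
  have h1 : ∀ x : (ℤ → Bool) × Bool, ‖linZ a i x.1 -
      linZ a i (Function.update x.1 0 x.2)‖ ≤ 2 * |a i| := by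
    intro x
    rw [linZ, linZ, ← (summable_filter ha _ _).tsum_sub (summable_filter ha _ _),
      tsum_eq_single i]
    · rw [Real.norm_eq_abs, ← mul_sub, abs_mul, mul_comm]
      refine mul_le_mul_of_nonneg_right ((abs_sub _ _).trans ?_) (abs_nonneg _)
      rw [abs_eps, abs_eps]; norm_num
    · intro j hj
      have : (i : ℤ) - j ≠ 0 := by
        intro h0; exact hj (by exact_mod_cast (sub_eq_zero.1 h0).symm)
      simp [eps, Function.update_of_ne this]
  have h2 : (linNoise a ha).theta 4 i ≤ _ :=
    eLpNorm_le_of_ae_bound (p := 4) (μ := (linNoise a ha).P.prod (linNoise a ha).ν)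
      (Eventually.of_forall h1)
  rwa [measure_univ, ENNReal.one_rpow, one_mul] at h2

lemma linNoise_weaklyDependent : (linNoise a ha).WeaklyDependent where
  moment := ⟨5, by norm_num, memLp_linNoise_Z ha 1 _⟩
  mean_zero := integral_eq_zero_of_flip Set.univ ((linNoise a ha).measurable_Z 1)
    (linZ_flip_univ a 1)
  stable := by
    refine (ENNReal.tsum_le_tsum (linNoise_theta_le ha)).trans_lt ?_
    rw [← ENNReal.ofReal_tsum_of_nonneg (fun i => by positivity) (ha.mul_left 2)]
    exact ENNReal.ofReal_lt_top

lemma linNoise_acvf (k : ℤ) : (linNoise a ha).acvf k = ∑' j : ℕ, a j * zext a (k + j) := by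
  have h1 := (linNoise_weaklyDependent ha).integral_mul 0 k
  rw [sub_zero] at h1
  rw [← h1]
  exact (integral_linZ_mul_linZ ha 0 k).trans (by simp)

lemma summable_zext {b : ℕ → ℝ} (hb : Summable b) : Summable (zext b) := by
  have h2 := (Nat.cast_injective (R := ℤ)).summable_iff (f := zext b) (fun z hz => by
    rw [zext, if_neg]
    intro h0
    exact hz ⟨z.toNat, Int.toNat_of_nonneg h0⟩)
  rw [← h2]
  exact hb.congr fun n => (zext_natCast b n).symm

/-- For `x, j ≥ 0`, `|x - j|^q ≤ j^q + x^q`, so the double series is dominated by two products of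
convergent series. -/
lemma linNoise_finiteU {q : ℕ} (hq : Summable fun j : ℕ => (j : ℝ) ^ q * |a j|) :
    (linNoise a ha).FiniteU q := by
  have hz1 : Summable fun z => |zext a z| := by
    refine (summable_zext ha).congr fun z => ?_
    unfold zext; split_ifs <;> simp
  have hz2 : Summable fun z : ℤ => |(z : ℝ)| ^ q * |zext a z| := by
    refine (summable_zext hq).congr fun z => ?_
    unfold zext
    split_ifs with h
    · have : ((z.toNat : ℕ) : ℝ) = |(z : ℝ)| := by
        rw [abs_of_nonneg (by exact_mod_cast h)]
        exact_mod_cast Int.toNat_of_nonneg h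
      simp only [this]
    · simp
  have hprod : Summable fun x : ℕ × ℤ => |((x.2 - x.1 : ℤ) : ℝ)| ^ q * (|a x.1| * |zext a x.2|) := by
    have s1 := hq.mul_of_nonneg hz1 (fun j => by positivity) (fun z => abs_nonneg _)
    have s2 := ha.mul_of_nonneg hz2 (fun j => abs_nonneg _) (fun z => by positivity)
    refine Summable.of_nonneg_of_le (fun x => by positivity) (fun x => ?_) (s1.add s2)
    by_cases hx : 0 ≤ x.2
    · have hx' : (0 : ℝ) ≤ x.2 := by exact_mod_cast hx
      have hj : (0 : ℝ) ≤ x.1 := Nat.cast_nonneg _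
      have h3 : |((x.2 - x.1 : ℤ) : ℝ)| ^ q ≤ (x.1 : ℝ) ^ q + |(x.2 : ℝ)| ^ q := by
        push_cast
        rcases le_total (x.1 : ℝ) x.2 with h | h
        · rw [abs_of_nonneg (by linarith), abs_of_nonneg hx']
          have : ((x.2 : ℝ) - x.1) ^ q ≤ (x.2 : ℝ) ^ q := pow_le_pow_left₀ (by linarith) (by linarith) q
          have := pow_nonneg hj q
          linarith
        · rw [abs_of_nonpos (by linarith), abs_of_nonneg hx']
          have : (-((x.2 : ℝ) - x.1)) ^ q ≤ (x.1 : ℝ) ^ q := pow_le_pow_left₀ (by linarith) (by linarith) q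
          have := pow_nonneg hx' q
          linarith
      have h4 : 0 ≤ |a x.1| * |zext a x.2| := by positivity
      nlinarith [mul_le_mul_of_nonneg_right h3 h4]
    · have : zext a x.2 = 0 := by rw [zext, if_neg hx]
      simp [this]
  -- A shear: the second coordinate becomes the lag `k = x - j`, so that the fibres over `k` sum to
  -- the bound for `γ_k`.
  let e : ℕ × ℤ ≃ ℕ × ℤ :=
    { toFun := fun x => (x.1, x.2 + x.1), invFun := fun x => (x.1, x.2 - x.1)
      left_inv := fun x => by simp, right_inv := fun x => by simp }
  have hshear : Summable fun x : ℕ × ℤ => |(x.2 : ℝ)| ^ q * (|a x.1| * |zext a (x.2 + x.1)|) := by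
    refine (e.summable_iff.2 hprod).congr fun x => ?_
    simp [e]
  have hsw : Summable fun x : ℤ × ℕ => |(x.1 : ℝ)| ^ q * (|a x.2| * |zext a (x.1 + x.2)|) :=
    hshear.prod_symm
  refine Summable.of_nonneg_of_le (fun k => by positivity) (fun k => ?_) hsw.prod
  have hfib := hsw.prod_factor k
  rw [linNoise_acvf]
  calc |(k : ℝ)| ^ q * |∑' j : ℕ, a j * zext a (k + j)|
      ≤ |(k : ℝ)| ^ q * ∑' j : ℕ, |a j| * |zext a (k + j)| := by
        refine mul_le_mul_of_nonneg_left ?_ (by positivity)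
        have hs : Summable fun j : ℕ => ‖a j * zext a (k + j)‖ := by
          have hb : Summable fun j : ℕ => |a j| * ∑' z, |zext a z| := ha.mul_right _
          refine Summable.of_nonneg_of_le (fun _ => norm_nonneg _) (fun j => ?_) hb
          rw [Real.norm_eq_abs, abs_mul]
          exact mul_le_mul_of_nonneg_left (hz1.le_tsum _ fun _ _ => abs_nonneg _) (abs_nonneg _)
        have := norm_tsum_le_tsum_norm hs
        simpa only [Real.norm_eq_abs, abs_mul] using this
    _ = _ := tsum_mul_left.symm

end LinNoise

/-! ### Mean functions with a linear trend and one jump in the middle -/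

/-- The trend `ρ_n t` plus a jump of size `κ_n` in the middle of the sample. -/
def trendJump (ρ κ : ℕ → ℝ) (hκ : ∀ n, κ n ≠ 0) : MeanModel where
  c n t := ρ n * t
  -- For `n = 1` no integer lies strictly between `1` and `n + 1`, so there is no room for a jump.
  J n := if 2 ≤ n then 1 else 0
  ξ n j := κ n * j
  T n j := if j = 0 then 1 else if j = 1 ∧ 2 ≤ n then n / 2 + 1 else n + 1
  continuous_c n := by fun_prop
  T_zero n _ := by simp
  T_last n _ := by split_ifs <;> simp_all
  T_lt n hn j hj := by
    by_cases h2 : 2 ≤ n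
    · rw [if_pos h2] at hj
      interval_cases j
      · simp [h2]
      · simp [h2]; omega
    · rw [if_neg h2] at hj
      interval_cases j; simp [h2]; omega
  ξ_ne n _ j _ := by
    push_cast
    intro h
    have := hκ n
    apply this
    linarith

section TrendJump

variable {ρ κ : ℕ → ℝ} {hκ : ∀ n, κ n ≠ 0}

lemma trendJump_J {n : ℕ} (hn : 2 ≤ n) : (trendJump ρ κ hκ).J n = 1 := if_pos hn

lemma trendJump_jumpSize {n : ℕ} (hn : 2 ≤ n) :
    (trendJump ρ κ hκ).jumpSize n = ENNReal.ofReal |κ n| := by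
  rw [MeanModel.jumpSize, trendJump_J hn]
  simp [trendJump]

lemma trendJump_smoothness (n : ℕ) :
    (trendJump ρ κ hκ).smoothness n = ENNReal.ofReal |ρ n| := by
  have hq : ∀ t' t : ℝ, t' < t → (ρ n * t - ρ n * t') / (t - t') = ρ n := fun t' t h => by
    rw [← mul_sub, mul_div_assoc, div_self (sub_ne_zero.2 h.ne'), mul_one]
  apply le_antisymm
  · refine iSup₂_le fun t' _ => iSup₂_le fun t _ => iSup_le fun h => ?_
    exact le_of_eq (by rw [← hq t' t h]; rfl)
  · refine le_trans (le_of_eq ?_) (le_iSup₂_of_le (0 : ℝ) (by simp) (le_iSup₂_of_le (1 : ℝ) (by simp)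
      (le_iSup_of_le zero_lt_one le_rfl)))
    simp [trendJump]

lemma orderOne_of_mem_Icc {f : ℕ → ℝ} (hf : ∀ n, f n ∈ Set.Icc (1 : ℝ) 3) {a : ℕ → ℝ≥0∞}
    (ha : ∀ᶠ n in atTop, a n = ENNReal.ofReal |f n|) : OrderOne a := by
  refine ⟨3, by norm_num, ha.mono fun n hn => ?_⟩
  rw [hn, abs_of_nonneg (by linarith [(hf n).1])]
  exact ⟨ENNReal.ofReal_le_ofReal (by linarith [(hf n).1]), ENNReal.ofReal_le_ofReal (hf n).2⟩

lemma ne_zero_of_mem_Icc (hf : ∀ n, κ n ∈ Set.Icc (1 : ℝ) 3) (n : ℕ) : κ n ≠ 0 := by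
  have := (hf n).1
  positivity

lemma inClass_trendJump (hρ : ∀ n, ρ n ∈ Set.Icc (1 : ℝ) 3) (hκ' : ∀ n, κ n ∈ Set.Icc (1 : ℝ) 3)
    {N : NoiseModel.{u}} {q : ℕ} (hN : N.WeaklyDependent) (hU : N.FiniteU q) :
    DGM.InClass ⟨N, trendJump ρ κ hκ⟩ q where
  weak := hN
  finite_u := hU
  jumps := orderOne_of_mem_Icc (f := fun _ => 1) (fun _ => by norm_num) <| by
    filter_upwards [eventually_ge_atTop 2] with n hn
    simp [trendJump_J hn]
  jumpSize := orderOne_of_mem_Icc hκ' <| by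
    filter_upwards [eventually_ge_atTop 2] with n hn
    exact trendJump_jumpSize hn
  smoothness := orderOne_of_mem_Icc hρ (Eventually.of_forall fun n => trendJump_smoothness (hκ := hκ) n)

/-- The differenced identity function. -/
def trendResponse (m : ℕ) (d : ℕ → ℝ) (n h : ℕ) (i : ℤ) : ℝ :=
  ∑ k ∈ range (m + 1), d k * (((i - (k : ℤ) * h : ℤ) : ℝ) / n)

/-- The differenced unit jump in the middle of the sample. -/
def midJump (m : ℕ) (d : ℕ → ℝ) (n h : ℕ) (i : ℤ) : ℝ :=
  jumpResponse m d h (i - ((n / 2 + 1 : ℕ) : ℤ))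

lemma trendJump_M {m : ℕ} {d : ℕ → ℝ} (hd : IsDiffSeq m d) {n h : ℕ} (hn : 2 ≤ n) {i : ℤ}
    (hi : i ∈ Icc ((m : ℤ) * h + 1) n) :
    (trendJump ρ κ hκ).M m d n h i = ρ n * trendResponse m d n h i + κ n * midJump m d n h i := by
  rw [MeanModel.M_eq _ hd (by omega) hi, trendJump_J hn, trendResponse, midJump, mul_sum]
  congr 1
  · exact sum_congr rfl fun k _ => by simp only [trendJump]; ring
  · simp [trendJump, hn]

lemma qform_congr {K : ℝ → ℝ} {m n ℓ h : ℕ} {x y x' y' : ℤ → ℝ}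
    (hx : ∀ i ∈ Icc ((m : ℤ) * h + 1) n, x i = x' i) (hy : ∀ i ∈ Icc ((m : ℤ) * h + 1) n, y i = y' i) :
    qform K m n ℓ h x y = qform K m n ℓ h x' y' :=
  sum_congr rfl fun i hi => sum_congr rfl fun j hj => by rw [hx i hi, hy j hj]

/-- The mean part of the bias is a quadratic polynomial in slope and jump size. Both may vary in
`[1, 3]`, which serves to avoid cancellation with the noise bias and to isolate the jump term. -/
lemma qform_trendJump {K : ℝ → ℝ} (hK : IsKernel K) {m : ℕ} {d : ℕ → ℝ} (hd : IsDiffSeq m d)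
    {n : ℕ} (ℓ h : ℕ) (hn : 2 ≤ n) :
    qform K m n ℓ h ((trendJump ρ κ hκ).M m d n h) ((trendJump ρ κ hκ).M m d n h)
      = ρ n ^ 2 * qform K m n ℓ h (trendResponse m d n h) (trendResponse m d n h)
        + 2 * (ρ n * κ n) * qform K m n ℓ h (trendResponse m d n h) (midJump m d n h)
        + κ n ^ 2 * qform K m n ℓ h (midJump m d n h) (midJump m d n h) := by
  rw [qform_congr (fun i hi => trendJump_M hd hn hi) (fun i hi => trendJump_M hd hn hi),
    qform_add_add hK, qform_smul, qform_smul, qform_smul,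
    qform_comm hK m n ℓ h (trendResponse m d n h) (fun i => ρ n * trendResponse m d n h i),
    qform_comm hK m n ℓ h (trendResponse m d n h) (fun i => κ n * midJump m d n h i),
    qform_comm hK m n ℓ h (midJump m d n h) (fun i => κ n * midJump m d n h i),
    qform_smul, qform_smul, qform_smul,
    qform_comm hK m n ℓ h (midJump m d n h) (trendResponse m d n h)]
  ring

end TrendJump

/-! ### The bias for moving averages -/

lemma summable_abs_of_finite {a : ℕ → ℝ} {L : ℕ} (hL : ∀ j, L < j → a j = 0) :
    Summable fun j => |a j| :=
  summable_of_ne_finset_zero (s := range (L + 1)) fun j hj => by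
    rw [hL j (by simpa using hj), abs_zero]

lemma linNoise_finiteU_of_finite {a : ℕ → ℝ} {L : ℕ} (hL : ∀ j, L < j → a j = 0) (q : ℕ) :
    (linNoise a (summable_abs_of_finite hL)).FiniteU q :=
  linNoise_finiteU _ <| summable_of_ne_finset_zero (s := range (L + 1)) fun j hj => by
    rw [hL j (by simpa using hj), abs_zero, mul_zero]

lemma hasSum_zext_mul {a : ℕ → ℝ} {L : ℕ} (hL : ∀ j, L < j → a j = 0) (f : ℤ → ℝ) :
    HasSum (fun y : ℤ => zext a y * f y) (∑ u ∈ range (L + 1), a u * f u) := by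
  have h1 : HasSum (fun y : ℤ => zext a y * f y)
      (∑ y ∈ (range (L + 1)).map Nat.castEmbedding, zext a y * f y) := by
    refine hasSum_sum_of_ne_finset_zero fun y hy => ?_
    rw [zext]
    split_ifs with h0
    · rw [hL, zero_mul]
      by_contra hlt
      exact hy (mem_map.2 ⟨y.toNat, by simp; omega, by simp [h0]⟩)
    · rw [zero_mul]
  simpa only [sum_map, Nat.castEmbedding_apply, zext_natCast] using h1

lemma hasSum_zext_sub_mul {a : ℕ → ℝ} {L : ℕ} (hL : ∀ j, L < j → a j = 0) (f : ℤ → ℝ) (c : ℤ) :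
    HasSum (fun i : ℤ => zext a (i - c) * f i) (∑ u ∈ range (L + 1), a u * f (c + u)) := by
  have h := (Equiv.subRight c).hasSum_iff.2 (hasSum_zext_mul hL fun y => f (c + y))
  simpa [Function.comp_def] using h

lemma sum_Icc_zext_mul {a : ℕ → ℝ} {L : ℕ} (hL : ∀ j, L < j → a j = 0) (f : ℤ → ℝ) {c A b : ℤ}
    (hA : A ≤ c) (hb : c + L ≤ b) :
    ∑ i ∈ Icc A b, zext a (i - c) * f i = ∑ u ∈ range (L + 1), a u * f (c + u) := by
  rw [← (hasSum_zext_sub_mul hL f c).tsum_eq]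
  refine (tsum_eq_sum fun i hi => ?_).symm
  rw [zext]
  split_ifs with h0
  · rw [hL, zero_mul]
    rw [mem_Icc] at hi
    omega
  · rw [zero_mul]

lemma linNoise_bias_of_finite {a : ℕ → ℝ} {L : ℕ} (hL : ∀ j, L < j → a j = 0) (K : ℝ → ℝ) (m : ℕ)
    (d : ℕ → ℝ) (n ℓ h : ℕ) :
    (linNoise a (summable_abs_of_finite hL)).bias K m d n ℓ h
      = ∑ j ∈ range (L + 1), a j * ∑ u ∈ range (L + 1),
          a u * (acvfWeight K m d n ℓ h ((u : ℤ) - j) - 1) := by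
  have h1 : ∀ x : ℤ, (linNoise a (summable_abs_of_finite hL)).acvf x
      = ∑ j ∈ range (L + 1), a j * zext a (x + j) := fun x => by
    rw [linNoise_acvf]
    exact tsum_eq_sum fun j hj => by rw [hL j (by simpa using hj), zero_mul]
  simp only [NoiseModel.bias, h1]
  refine HasSum.tsum_eq ?_
  have h2 := hasSum_sum (s := range (L + 1)) fun (j : ℕ) (_ : j ∈ range (L + 1)) =>
    (hasSum_zext_sub_mul hL (fun x => acvfWeight K m d n ℓ h x - 1) (-(j : ℤ))).mul_left (a j)
  simp only [neg_add_eq_sub, sub_neg_eq_add] at h2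
  refine h2.congr_fun fun x => ?_
  rw [sum_mul]
  exact sum_congr rfl fun j _ => by ring

lemma wKernel_neg {K : ℝ → ℝ} (hK : IsKernel K) (m n ℓ h : ℕ) (x : ℤ) :
    wKernel K m n ℓ h (-x) = wKernel K m n ℓ h x := by
  rw [wKernel, wKernel, hK.even_int]
  simp

lemma acvfWeight_neg {K : ℝ → ℝ} (hK : IsKernel K) (m : ℕ) (d : ℕ → ℝ) (n ℓ h : ℕ) (x : ℤ) :
    acvfWeight K m d n ℓ h (-x) = acvfWeight K m d n ℓ h x := by
  rw [acvfWeight, acvfWeight, sum_comm]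
  refine sum_congr rfl fun j _ => sum_congr rfl fun j' _ => ?_
  rw [← wKernel_neg hK, mul_comm (d j)]
  congr 2
  ring

/-- The filter with coefficients `σ` at lag zero and `β` at lag `L`. -/
def twoTap (σ β : ℝ) (L : ℕ) (j : ℕ) : ℝ := (if j = 0 then σ else 0) + if j = L then β else 0

lemma twoTap_eq_zero (σ β : ℝ) (L : ℕ) : ∀ j, L < j → twoTap σ β L j = 0 := fun j hj => by
  rw [twoTap, if_neg (by omega), if_neg (by omega), add_zero]

lemma sum_twoTap_mul (σ β : ℝ) (L : ℕ) (f : ℕ → ℝ) :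
    ∑ u ∈ range (L + 1), twoTap σ β L u * f u = σ * f 0 + β * f L := by
  simp only [twoTap, add_mul, sum_add_distrib, ite_mul, zero_mul]
  rw [sum_ite_eq', sum_ite_eq', if_pos (by simp), if_pos (by simp)]

lemma sum_twoTap (σ β : ℝ) (L : ℕ) : ∑ u ∈ range (L + 1), twoTap σ β L u = σ + β := by
  simpa using sum_twoTap_mul σ β L fun _ => 1

/-- The noise `Z_i = σ ε_i + β ε_{i-L}`. -/
def twoTapNoise (σ β : ℝ) (L : ℕ) : NoiseModel.{0} :=
  linNoise (twoTap σ β L) (summable_abs_of_finite (twoTap_eq_zero σ β L))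

/-- The autocovariances are `σ² + β²` at lag zero and `σβ` at `±L`; for `L = 0` these contributions
simply add up. -/
lemma twoTapNoise_bias {K : ℝ → ℝ} (hK : IsKernel K) (σ β : ℝ) (L : ℕ) (m : ℕ) (d : ℕ → ℝ)
    (n ℓ h : ℕ) :
    (twoTapNoise σ β L).bias K m d n ℓ h
      = (σ ^ 2 + β ^ 2) * (acvfWeight K m d n ℓ h 0 - 1)
        + 2 * σ * β * (acvfWeight K m d n ℓ h L - 1) := by
  rw [twoTapNoise, linNoise_bias_of_finite (twoTap_eq_zero σ β L)]
  simp only [sum_twoTap_mul σ β L fun u => acvfWeight K m d n ℓ h ((u : ℤ) - _) - 1]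
  rw [sum_twoTap_mul σ β L fun j => σ * (acvfWeight K m d n ℓ h (((0 : ℕ) : ℤ) - j) - 1)
    + β * (acvfWeight K m d n ℓ h ((L : ℤ) - j) - 1)]
  simp only [Nat.cast_zero, sub_zero, zero_sub, sub_self, acvfWeight_neg hK]
  ring

/-! ### A lower bound for the variance -/

section Bessel

variable {K : ℝ → ℝ} {m : ℕ} {d : ℕ → ℝ} {a : ℕ → ℝ} {L : ℕ}

/-- The bounds on `p` keep every time reached by the innovation at `p`, through filter and
differences, inside the window, so no boundary terms appear. -/
lemma sum_filtered_mul (hL : ∀ j, L < j → a j = 0) (f : ℤ → ℝ) {n h : ℕ} {p : ℤ}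
    (h1 : (m : ℤ) * h + 1 ≤ p) (h2 : p + m * h + L ≤ n) :
    ∑ i ∈ Icc ((m : ℤ) * h + 1) (n : ℤ), (∑ j ∈ range (m + 1), d j * zext a (i - (p + (j : ℤ) * h))) * f i
      = ∑ j ∈ range (m + 1), d j * ∑ u ∈ range (L + 1), a u * f (p + (j : ℤ) * h + u) := by
  simp only [sum_mul]
  rw [sum_comm]
  refine sum_congr rfl fun j hj => ?_
  have hj' : (j : ℤ) * h ≤ (m : ℤ) * h :=
    mul_le_mul_of_nonneg_right (by exact_mod_cast Nat.lt_succ_iff.1 (mem_range.1 hj)) (by positivity)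
  have hj0 : 0 ≤ (j : ℤ) * h := by positivity
  rw [← sum_Icc_zext_mul hL f (A := (m : ℤ) * h + 1) (b := n) (by linarith) (by linarith), mul_sum]
  exact sum_congr rfl fun i _ => by ring

lemma sum_filtered_mul_filtered (hL : ∀ j, L < j → a j = 0) {n ℓ h : ℕ} {p q : ℤ}
    (hp1 : (m : ℤ) * h + 1 ≤ p) (hp2 : p + m * h + L ≤ n) (hq1 : (m : ℤ) * h + 1 ≤ q)
    (hq2 : q + m * h + L ≤ n) :
    ∑ i ∈ Icc ((m : ℤ) * h + 1) (n : ℤ), ∑ i' ∈ Icc ((m : ℤ) * h + 1) (n : ℤ),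
      (1 / (n : ℝ) * K (((i - i' : ℤ) : ℝ) / ℓ)) *
        ((∑ j ∈ range (m + 1), d j * zext a (i - (p + (j : ℤ) * h))) *
          ∑ j ∈ range (m + 1), d j * zext a (i' - (q + (j : ℤ) * h)))
      = 1 / n * ∑ u ∈ range (L + 1), ∑ u' ∈ range (L + 1),
          a u * a u' * rawWeight K m d ℓ h (p - q + ((u : ℤ) - u')) := by
  have e1 : ∀ i : ℤ, ∑ i' ∈ Icc ((m : ℤ) * h + 1) (n : ℤ),
      (1 / (n : ℝ) * K (((i - i' : ℤ) : ℝ) / ℓ)) *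
        ((∑ j ∈ range (m + 1), d j * zext a (i - (p + (j : ℤ) * h))) *
          ∑ j ∈ range (m + 1), d j * zext a (i' - (q + (j : ℤ) * h)))
      = (∑ j ∈ range (m + 1), d j * zext a (i - (p + (j : ℤ) * h))) *
        (1 / n * ∑ j' ∈ range (m + 1), d j' * ∑ u' ∈ range (L + 1),
          a u' * K (((i - (q + (j' : ℤ) * h + u') : ℤ) : ℝ) / ℓ)) := fun i => by
    rw [← sum_filtered_mul hL (fun i' => K (((i - i' : ℤ) : ℝ) / ℓ)) hq1 hq2, mul_sum, mul_sum]
    exact sum_congr rfl fun i' _ => by ring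
  simp only [e1]
  rw [sum_filtered_mul hL (fun i => 1 / n * ∑ j' ∈ range (m + 1), d j' * ∑ u' ∈ range (L + 1),
          a u' * K (((i - (q + (j' : ℤ) * h + u') : ℤ) : ℝ) / ℓ)) hp1 hp2]
  simp only [rawWeight, mul_sum]
  rw [sum_comm]
  refine sum_congr rfl fun u _ => ?_
  have e2 : ∀ j ∈ range (m + 1), ∀ F : ℕ → ℕ → ℝ, ∑ j' ∈ range (m + 1), ∑ u' ∈ range (L + 1), F j' u'
      = ∑ u' ∈ range (L + 1), ∑ j' ∈ range (m + 1), F j' u' := fun _ _ F => sum_comm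
  rw [sum_congr rfl fun j hj => e2 j hj _, sum_comm]
  refine sum_congr rfl fun u' _ => ?_
  rw [sum_comm]
  refine sum_congr rfl fun j' _ => sum_congr rfl fun j _ => ?_
  have e3 : p + (j : ℤ) * h + u - (q + (j' : ℤ) * h + u') = p - q + ((u : ℤ) - u') - ((j' : ℤ) - j) * h := by
    ring
  rw [e3]
  ring

lemma abs_eps_mul_eps (p q : ℤ) (ω : ℤ → Bool) : |eps p ω * eps q ω| = 1 := by
  rw [abs_mul, abs_eps, abs_eps, mul_one]

lemma measurable_eps_mul_eps (p q : ℤ) : Measurable fun ω => eps p ω * eps q ω :=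
  (measurable_eps p).mul (measurable_eps q)

lemma integral_qform_W_mul_eps (hL : ∀ j, L < j → a j = 0) (ha : Summable fun j => |a j|)
    {n ℓ h : ℕ} {p q : ℤ} (hpq : p ≠ q)
    (hp1 : (m : ℤ) * h + 1 ≤ p) (hp2 : p + m * h + L ≤ n) (hq1 : (m : ℤ) * h + 1 ≤ q)
    (hq2 : q + m * h + L ≤ n) :
    ∫ ω, qform K m n ℓ h (fun i => (linNoise a ha).W m d h i ω) (fun i => (linNoise a ha).W m d h i ω)
        * (eps p ω * eps q ω) ∂tosses
      = 1 / n * ∑ u ∈ range (L + 1), ∑ u' ∈ range (L + 1), a u * a u' *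
          (rawWeight K m d ℓ h (p - q + ((u : ℤ) - u')) + rawWeight K m d ℓ h (q - p + ((u : ℤ) - u'))) := by
  have hInt : ∀ i j : ℤ, Integrable (fun ω => linZ a i ω * (linZ a j ω * (eps p ω * eps q ω))) tosses := by
    intro i j
    refine Integrable.of_bound (((measurable_linZ ha i).mul ((measurable_linZ ha j).mul
      (measurable_eps_mul_eps p q))).aestronglyMeasurable) ((∑' j, |a j|) * ∑' j, |a j|)
      (Eventually.of_forall fun ω => ?_)
    rw [Real.norm_eq_abs, abs_mul, abs_mul, abs_eps_mul_eps, mul_one]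
    exact mul_le_mul (abs_linZ_le ha i ω) (abs_linZ_le ha j ω) (abs_nonneg _)
      (tsum_nonneg fun _ => abs_nonneg _)
  have hexp : ∀ ω : ℤ → Bool, qform K m n ℓ h (fun i => (linNoise a ha).W m d h i ω)
      (fun i => (linNoise a ha).W m d h i ω) * (eps p ω * eps q ω)
      = ∑ i ∈ Icc ((m : ℤ) * h + 1) (n : ℤ), ∑ i' ∈ Icc ((m : ℤ) * h + 1) (n : ℤ),
        ∑ j ∈ range (m + 1), ∑ j' ∈ range (m + 1),
        ((1 / (n : ℝ) * K (((i - i' : ℤ) : ℝ) / ℓ)) * (d j * d j')) *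
          (linZ a (i - (j : ℤ) * h) ω * (linZ a (i' - (j' : ℤ) * h) ω * (eps p ω * eps q ω))) := by
    intro ω
    simp only [qform, sum_mul]
    refine sum_congr rfl fun i _ => sum_congr rfl fun i' _ => ?_
    simp only [NoiseModel.W]
    rw [sum_mul_sum]
    simp only [mul_sum, sum_mul]
    refine sum_congr rfl fun j _ => sum_congr rfl fun j' _ => ?_
    rw [linNoise_Z, linNoise_Z]; ring
  have hval : ∀ i i' : ℤ, ∑ j ∈ range (m + 1), ∑ j' ∈ range (m + 1),
      ((1 / (n : ℝ) * K (((i - i' : ℤ) : ℝ) / ℓ)) * (d j * d j')) *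
        (zext a (i - (j : ℤ) * h - p) * zext a (i' - (j' : ℤ) * h - q) +
          zext a (i - (j : ℤ) * h - q) * zext a (i' - (j' : ℤ) * h - p))
      = (1 / (n : ℝ) * K (((i - i' : ℤ) : ℝ) / ℓ)) *
        ((∑ j ∈ range (m + 1), d j * zext a (i - (p + (j : ℤ) * h))) *
          ∑ j ∈ range (m + 1), d j * zext a (i' - (q + (j : ℤ) * h))) +
        (1 / (n : ℝ) * K (((i - i' : ℤ) : ℝ) / ℓ)) *
        ((∑ j ∈ range (m + 1), d j * zext a (i - (q + (j : ℤ) * h))) *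
          ∑ j ∈ range (m + 1), d j * zext a (i' - (p + (j : ℤ) * h))) := by
    intro i i'
    rw [sum_mul_sum, sum_mul_sum]
    simp only [mul_sum, ← sum_add_distrib]
    refine sum_congr rfl fun j _ => sum_congr rfl fun j' _ => ?_
    rw [show i - (j : ℤ) * h - p = i - (p + (j : ℤ) * h) by ring,
      show i' - (j' : ℤ) * h - q = i' - (q + (j' : ℤ) * h) by ring,
      show i - (j : ℤ) * h - q = i - (q + (j : ℤ) * h) by ring,
      show i' - (j' : ℤ) * h - p = i' - (p + (j' : ℤ) * h) by ring]
    ring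
  simp only [hexp]
  rw [integral_finsetSum _ fun i _ => integrable_finsetSum _ fun i' _ => integrable_finsetSum _
    fun j _ => integrable_finsetSum _ fun j' _ => (hInt _ _).const_mul _]
  have hin : ∀ i i' : ℤ, ∫ ω, ∑ j ∈ range (m + 1), ∑ j' ∈ range (m + 1),
        ((1 / (n : ℝ) * K (((i - i' : ℤ) : ℝ) / ℓ)) * (d j * d j')) *
          (linZ a (i - (j : ℤ) * h) ω * (linZ a (i' - (j' : ℤ) * h) ω * (eps p ω * eps q ω))) ∂tosses
      = ∑ j ∈ range (m + 1), ∑ j' ∈ range (m + 1),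
      ((1 / (n : ℝ) * K (((i - i' : ℤ) : ℝ) / ℓ)) * (d j * d j')) *
        (zext a (i - (j : ℤ) * h - p) * zext a (i' - (j' : ℤ) * h - q) +
          zext a (i - (j : ℤ) * h - q) * zext a (i' - (j' : ℤ) * h - p)) := by
    intro i i'
    rw [integral_finsetSum _ fun j _ => integrable_finsetSum _ fun j' _ => (hInt _ _).const_mul _]
    refine sum_congr rfl fun j _ => ?_
    rw [integral_finsetSum _ fun j' _ => (hInt _ _).const_mul _]
    refine sum_congr rfl fun j' _ => ?_
    rw [integral_const_mul, integral_linZ_mul_linZ_mul_eps ha _ _ hpq]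
  rw [sum_congr rfl fun i _ => (integral_finsetSum _ fun i' _ => integrable_finsetSum _ fun j _ =>
    integrable_finsetSum _ fun j' _ => (hInt _ _).const_mul _).trans
      (sum_congr rfl fun i' _ => (hin i i').trans (hval i i'))]
  simp only [sum_add_distrib, mul_add]
  rw [sum_filtered_mul_filtered hL hp1 hp2 hq1 hq2, sum_filtered_mul_filtered hL hq1 hq2 hp1 hp2]

/-- Only the quadratic part of the estimator correlates with `ε_p ε_q`: constants do not as `p ≠ q`,
and the linear part is odd under flipping all signs. -/
lemma integral_vHat_mul_eps (hK : IsKernel K) (hL : ∀ j, L < j → a j = 0)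
    (ha : Summable fun j => |a j|) (M : MeanModel)
    {n ℓ h : ℕ} (hℓ : 1 ≤ ℓ) {p q : ℤ} (hpq : p ≠ q)
    (hp1 : (m : ℤ) * h + 1 ≤ p) (hp2 : p + m * h + L ≤ n) (hq1 : (m : ℤ) * h + 1 ≤ q)
    (hq2 : q + m * h + L ≤ n) (v : ℝ) :
    ∫ ω, (DGM.vHat ⟨linNoise a ha, M⟩ K m d n ℓ h ω - v) * (eps p ω * eps q ω) ∂tosses
      = 1 / n * ∑ u ∈ range (L + 1), ∑ u' ∈ range (L + 1), a u * a u' *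
          (rawWeight K m d ℓ h (p - q + ((u : ℤ) - u')) + rawWeight K m d ℓ h (q - p + ((u : ℤ) - u'))) := by
  rw [← integral_qform_W_mul_eps hL ha hpq hp1 hp2 hq1 hq2]
  have hN := linNoise_weaklyDependent ha
  have hφ : ∀ᵐ ω ∂tosses, ‖eps p ω * eps q ω‖ ≤ 1 := Eventually.of_forall fun ω =>
    (abs_eps_mul_eps p q ω).le
  have hφm := (measurable_eps_mul_eps p q).aestronglyMeasurable (μ := tosses)
  let MM := M.M m d n h
  have hQ1 : Integrable (fun ω : ℤ → Bool => qform K m n ℓ h MM (fun i => (linNoise a ha).W m d h i ω))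
      tosses := (DGM.memLp_qform_M_W (G := ⟨linNoise a ha, M⟩) hN K m d n ℓ h MM).integrable (by norm_num)
  have hQ2 : Integrable (fun ω : ℤ → Bool => qform K m n ℓ h (fun i => (linNoise a ha).W m d h i ω)
      (fun i => (linNoise a ha).W m d h i ω)) tosses :=
    (DGM.memLp_qform_W (G := ⟨linNoise a ha, M⟩) hN K m d n ℓ h).integrable (by norm_num)
  have hz1 : ∫ ω, eps p ω * eps q ω ∂tosses = 0 := by rw [integral_eps_mul_eps, if_neg hpq]
  have hz2 : ∫ ω, qform K m n ℓ h MM (fun i => (linNoise a ha).W m d h i ω) * (eps p ω * eps q ω) ∂tosses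
      = 0 := by
    refine integral_eq_zero_of_flip Set.univ ?_ fun ω => ?_
    · refine Measurable.mul ?_ (measurable_eps_mul_eps p q)
      unfold qform NoiseModel.W
      refine Finset.measurable_sum _ fun i _ => Finset.measurable_sum _ fun j _ => ?_
      refine Measurable.const_mul (Measurable.const_mul (Finset.measurable_sum _ fun k _ => ?_) _) _
      exact Measurable.const_mul (measurable_linZ ha _) _
    · rw [eps_flip_of_mem (Set.mem_univ _), eps_flip_of_mem (Set.mem_univ _), neg_mul_neg, ← neg_mul]
      congr 1
      have hW : ∀ i, (linNoise a ha).W m d h i (flip Set.univ ω) = -(linNoise a ha).W m d h i ω := by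
        intro i
        simp only [NoiseModel.W, linNoise_Z]
        rw [← sum_neg_distrib]
        exact sum_congr rfl fun j _ => by rw [linZ_flip_univ]; ring
      simp only [qform, hW, mul_neg, sum_neg_distrib]
  have hexp : ∀ ω : ℤ → Bool, (DGM.vHat ⟨linNoise a ha, M⟩ K m d n ℓ h ω - v) * (eps p ω * eps q ω)
      = (qform K m n ℓ h MM MM - v) * (eps p ω * eps q ω) +
        2 * (qform K m n ℓ h MM (fun i => (linNoise a ha).W m d h i ω) * (eps p ω * eps q ω)) +
        qform K m n ℓ h (fun i => (linNoise a ha).W m d h i ω) (fun i => (linNoise a ha).W m d h i ω)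
        * (eps p ω * eps q ω) := fun ω => by
    rw [DGM.vHat_eq ⟨linNoise a ha, M⟩ hK m d h hℓ ω]
    ring
  have hi0 : Integrable (fun ω => (qform K m n ℓ h MM MM - v) * (eps p ω * eps q ω)) tosses :=
    (Integrable.of_bound hφm 1 hφ).const_mul _
  have hi1 : Integrable (fun ω : ℤ → Bool => 2 * (qform K m n ℓ h MM (fun i => (linNoise a ha).W m d h i ω)
      * (eps p ω * eps q ω))) tosses := (hQ1.mul_bdd hφm hφ).const_mul 2
  have hi2 := hQ2.mul_bdd hφm hφ
  simp only [hexp]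
  rw [integral_add (by exact hi0.add hi1) hi2, integral_add hi0 hi1, integral_const_mul,
    integral_const_mul, hz1, hz2]
  simp

end Bessel

/-! ### Bessel's inequality for products of two innovations -/

section Bessel

variable {K : ℝ → ℝ} {m : ℕ} {d : ℕ → ℝ} {a : ℕ → ℝ} {L : ℕ}

/-- The sum of the products `ε_p ε_{p+r}` over the pairs `(p, r)` in `S`. -/
def pairSum (S : Finset (ℤ × ℤ)) (ω : ℤ → Bool) : ℝ := ∑ x ∈ S, eps x.1 ω * eps (x.1 + x.2) ω

lemma memLp_pairSum (S : Finset (ℤ × ℤ)) : MemLp (pairSum S) 2 tosses := by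
  refine memLp_finsetSum _ fun x _ => ?_
  exact MemLp.of_bound (measurable_eps_mul_eps _ _).aestronglyMeasurable 1
    (Eventually.of_forall fun ω => (abs_eps_mul_eps _ _ ω).le)

/-- For `r ≥ 1` the unordered pair `{p, p + r}` determines `(p, r)`, so the products are
orthonormal. -/
lemma integral_pairSum_sq {S : Finset (ℤ × ℤ)} (hS : ∀ x ∈ S, 1 ≤ x.2) :
    ∫ ω, pairSum S ω ^ 2 ∂tosses = #S := by
  have hInt : ∀ x y : ℤ × ℤ, Integrable (fun ω => eps x.1 ω * (eps (x.1 + x.2) ω *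
      (eps y.1 ω * eps (y.1 + y.2) ω))) tosses := fun x y => by
    refine Integrable.of_bound ((measurable_eps _).mul ((measurable_eps _).mul
      (measurable_eps_mul_eps _ _))).aestronglyMeasurable 1 (Eventually.of_forall fun ω => ?_)
    rw [Real.norm_eq_abs, abs_mul, abs_mul, abs_eps_mul_eps, abs_eps, abs_eps]; norm_num
  have hexp : ∀ ω, pairSum S ω ^ 2 = ∑ x ∈ S, ∑ y ∈ S, eps x.1 ω * (eps (x.1 + x.2) ω *
      (eps y.1 ω * eps (y.1 + y.2) ω)) := fun ω => by
    rw [pairSum, sq, sum_mul_sum]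
    exact sum_congr rfl fun x _ => sum_congr rfl fun y _ => by ring
  simp only [hexp]
  rw [integral_finsetSum _ fun x _ => integrable_finsetSum _ fun y _ => hInt x y]
  have hx : ∀ x ∈ S, ∫ ω, ∑ y ∈ S, eps x.1 ω * (eps (x.1 + x.2) ω *
      (eps y.1 ω * eps (y.1 + y.2) ω)) ∂tosses = 1 := fun x hx => by
    rw [integral_finsetSum _ fun y _ => hInt x y, sum_eq_single_of_mem x hx]
    · rw [integral_eps_four _ _ (by have := hS x hx; omega)]
      have := hS x hx
      simp
      omega
    · intro y hy hne
      have h1 := hS x hx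
      have h2 := hS y hy
      rw [integral_eps_four _ _ (by omega)]
      by_cases hc : x.1 = y.1
      · have : x.2 ≠ y.2 := fun h => hne (Prod.ext hc.symm h.symm)
        rw [if_neg (show x.1 + x.2 ≠ y.1 by omega), if_neg (show x.1 + x.2 ≠ y.1 + y.2 by omega)]; simp
      · rw [if_neg hc]
        by_cases hc2 : x.1 + x.2 = y.1
        · rw [if_neg (show x.1 ≠ y.1 + y.2 by omega)]; simp
        · rw [if_neg hc2]; simp
  rw [sum_congr rfl hx]
  simp

/-- Bessel's inequality, in the form of Cauchy–Schwarz against the sum of the orthonormal products.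
-/
lemma card_mul_le_mse (hK : IsKernel K) (ha : Summable fun j => |a j|)
    (M : MeanModel) {ℓ h : ℕ → ℕ} {n : ℕ} (hℓ : 1 ≤ ℓ n) {S : Finset (ℤ × ℤ)}
    (hS : ∀ x ∈ S, 1 ≤ x.2) {c : ℝ} (hc : 0 ≤ c)
    (hlow : ∀ x ∈ S, c ≤ ∫ ω, (DGM.vHat ⟨linNoise a ha, M⟩ K m d n (ℓ n) (h n) ω
      - (linNoise a ha).lrv) * (eps x.1 ω * eps (x.1 + x.2) ω) ∂tosses) :
    #S * c ^ 2 ≤ DGM.mse ⟨linNoise a ha, M⟩ K m d ℓ h n := by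
  rcases S.eq_empty_or_nonempty with rfl | hne
  · rw [card_empty, Nat.cast_zero, zero_mul]
    exact integral_nonneg fun ω => sq_nonneg _
  have hpos : (0 : ℝ) < #S := by exact_mod_cast hne.card_pos
  let Y : (ℤ → Bool) → ℝ := fun ω =>
    DGM.vHat ⟨linNoise a ha, M⟩ K m d n (ℓ n) (h n) ω - (linNoise a ha).lrv
  have hY : MemLp Y 2 tosses := (DGM.memLp_vHat (G := ⟨linNoise a ha, M⟩) (linNoise_weaklyDependent ha)
    hK hℓ).sub (memLp_const _)
  have h1 : ∫ ω, Y ω * pairSum S ω ∂tosses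
      = ∑ x ∈ S, ∫ ω, Y ω * (eps x.1 ω * eps (x.1 + x.2) ω) ∂tosses := by
    simp only [pairSum, mul_sum]
    refine integral_finsetSum _ fun x _ => ?_
    exact (hY.integrable (by norm_num)).mul_bdd (c := 1) (measurable_eps_mul_eps _ _).aestronglyMeasurable
      (Eventually.of_forall fun ω => (abs_eps_mul_eps _ _ ω).le)
  have h2 : #S * c ≤ ∫ ω, Y ω * pairSum S ω ∂tosses := by
    rw [h1, ← nsmul_eq_mul]
    exact card_nsmul_le_sum _ _ _ hlow
  have h3 := sq_integral_mul_le hY (memLp_pairSum S)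
  rw [integral_pairSum_sq hS] at h3
  have h4 : (#S * c) ^ 2 ≤ (∫ ω, Y ω ^ 2 ∂tosses) * #S :=
    (pow_le_pow_left₀ (by positivity) h2 2).trans h3
  have h5 : (∫ ω, Y ω ^ 2 ∂tosses) = DGM.mse ⟨linNoise a ha, M⟩ K m d ℓ h n := rfl
  rw [h5] at h4
  nlinarith

/-- The variance of the estimator is at least of the order of `ℓ / n`, for moving averages with
nonzero long-run variance. -/
theorem exists_mul_le_mse (hK : IsKernel K) {q : ℕ} {B : ℝ} (hq : NearOrigin K q B)
    (hd : IsDiffSeq m d) {ℓ h : ℕ → ℕ} (H : Admissible m ℓ h) (hoff : OffDiag K ℓ h 1)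
    (hL : ∀ j, L < j → a j = 0) (ha : Summable fun j => |a j|)
    (hsum : ∑ u ∈ range (L + 1), a u ≠ 0) :
    ∃ c : ℝ, 0 < c ∧ ∀ᶠ n in atTop, ∀ M : MeanModel,
      c * ((ℓ n : ℝ) / n) ≤ DGM.mse ⟨linNoise a ha, M⟩ K m d ℓ h n := by
  obtain ⟨C, hC0, hC⟩ := abs_rawWeight_sub_one_le hK hq hq.pos hd hoff
  set s : ℝ := (∑ u ∈ range (L + 1), a u) ^ 2 with hs
  set A : ℝ := (∑ u ∈ range (L + 1), |a u|) ^ 2 with hA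
  have hs0 : 0 < s := by positivity
  have hsA : s ≤ A := by
    rw [hs, hA, ← sq_abs]
    exact pow_le_pow_left₀ (abs_nonneg _) (abs_sum_le_sum_abs _ _) 2
  have hA0 : 0 < A := hs0.trans_le hsA
  -- If all weights involved are within `ε` of one, the coefficient differs from `2s/n` by at most
  -- `2εA/n = s/n`.
  set ε : ℝ := s / (2 * A) with hε
  have hε0 : 0 < ε := by positivity
  have hε1 : ε ≤ 1 := by rw [hε, div_le_one (by positivity)]; linarith
  -- Lags up to `ηℓ`, even after adding the filter length `L`, keep the weights within `ε` of one.
  set η : ℝ := ε / (2 * (C + 1)) with hη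
  have hη0 : 0 < η := by positivity
  have hη1 : η ≤ 1 := by rw [hη, div_le_one (by positivity)]; linarith
  have hCη : C * (2 * η) ≤ ε := by
    have : (C + 1) * (2 * η) = ε := by rw [hη]; field_simp
    nlinarith
  refine ⟨η * s ^ 2 / 4, by positivity, ?_⟩
  have hsmall : ∀ᶠ n : ℕ in atTop, ((ℓ n : ℝ) + m * h n) / n < 1 / 16 :=
    H.tendsto_aux.2.eventually_lt_const (by norm_num)
  filter_upwards [hC, hsmall, eventually_ge_atTop 1, eventually_ge_atTop (16 * L + 16),
    H.tendsto_bandwidth.eventually_ge_atTop ((1 + L + 2) / η)] with n hCn hn1 hn0 hnL hℓL M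
  have hnpos : (0 : ℝ) < n := by exact_mod_cast hn0
  have hℓη : (1 + L + 2 : ℝ) ≤ η * ℓ n := by
    rw [div_le_iff₀ hη0] at hℓL; linarith
  have hℓ1 : 1 ≤ ℓ n := (H.range_ℓ n hn0).1
  have hℓpos : (0 : ℝ) < ℓ n := by exact_mod_cast hℓ1
  rw [div_lt_iff₀ hnpos] at hn1
  set R : ℕ := ⌊η * ℓ n⌋₊ with hR
  have hRle : (R : ℝ) ≤ η * ℓ n := Nat.floor_le (by positivity)
  have hRge : η * ℓ n / 2 ≤ R := by
    have := Nat.lt_floor_add_one (η * ℓ n)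
    have hLn : (0 : ℝ) ≤ L := Nat.cast_nonneg _
    rw [← hR] at this
    linarith
  have hRℓ : (R : ℝ) ≤ ℓ n := hRle.trans (by nlinarith)
  -- Starting points away from both ends, and lags up to `R`: of the order of `nℓ` pairs, each with
  -- coefficient at least `s/n`.
  let S : Finset (ℤ × ℤ) := Icc ((m : ℤ) * h n + 1) (n - m * h n - L - R) ×ˢ Icc (1 : ℤ) R
  have hS1 : ∀ x ∈ S, 1 ≤ x.2 := fun x hx => (mem_Icc.1 (mem_product.1 hx).2).1
  have hbound : ∀ r : ℤ, |(r : ℝ)| ≤ R → ∀ u ∈ range (L + 1), ∀ u' ∈ range (L + 1),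
      |rawWeight K m d (ℓ n) (h n) (r + ((u : ℤ) - u')) - 1| ≤ ε := by
    intro r hr u hu u' hu'
    refine (hCn _).trans (le_trans ?_ hCη)
    rw [pow_one]
    refine mul_le_mul_of_nonneg_left ?_ hC0
    rw [div_le_iff₀ hℓpos]
    have hu1 : (u : ℝ) ≤ L := by exact_mod_cast Nat.lt_succ_iff.1 (mem_range.1 hu)
    have hu1' : (u' : ℝ) ≤ L := by exact_mod_cast Nat.lt_succ_iff.1 (mem_range.1 hu')
    have hu0 : (0 : ℝ) ≤ u := Nat.cast_nonneg _
    have hu0' : (0 : ℝ) ≤ u' := Nat.cast_nonneg _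
    have : |((r + ((u : ℤ) - u') : ℤ) : ℝ)| ≤ R + L := by
      push_cast
      refine (abs_add_le _ _).trans (add_le_add hr ?_)
      rw [abs_le]; constructor <;> linarith
    linarith
  have hlow : ∀ x ∈ S, s / n ≤ ∫ ω, (DGM.vHat ⟨linNoise a ha, M⟩ K m d n (ℓ n) (h n) ω
      - (linNoise a ha).lrv) * (eps x.1 ω * eps (x.1 + x.2) ω) ∂tosses := by
    intro x hx
    have hx1 := mem_Icc.1 (mem_product.1 hx).1
    have hx2 := mem_Icc.1 (mem_product.1 hx).2
    rw [integral_vHat_mul_eps hK hL ha M hℓ1 (by omega) hx1.1 (by linarith) (by linarith)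
      (by linarith), div_eq_inv_mul, one_div]
    refine mul_le_mul_of_nonneg_left ?_ (by positivity)
    have hr : |((x.2 : ℤ) : ℝ)| ≤ R := by
      rw [abs_of_nonneg (by exact_mod_cast (zero_le_one.trans hx2.1))]; exact_mod_cast hx2.2
    have hr' : |((-x.2 : ℤ) : ℝ)| ≤ R := by
      push_cast; rwa [abs_neg]
    have e1 : ∑ u ∈ range (L + 1), ∑ u' ∈ range (L + 1), a u * a u' * 2 = 2 * s := by
      rw [hs, sq, sum_mul_sum]
      simp only [← sum_mul]; ring
    have e2 : ∑ u ∈ range (L + 1), ∑ u' ∈ range (L + 1), |a u| * |a u'| * (2 * ε) = s := by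
      simp only [← sum_mul]
      rw [← sum_mul_sum, ← sq, ← hA, hε]; field_simp
    have e3 : |∑ u ∈ range (L + 1), ∑ u' ∈ range (L + 1), a u * a u' *
        (rawWeight K m d (ℓ n) (h n) (x.1 - (x.1 + x.2) + ((u : ℤ) - u'))
          + rawWeight K m d (ℓ n) (h n) (x.1 + x.2 - x.1 + ((u : ℤ) - u')) - 2)| ≤ s := by
      rw [← e2]
      refine (abs_sum_le_sum_abs _ _).trans (sum_le_sum fun u hu => ?_)
      refine (abs_sum_le_sum_abs _ _).trans (sum_le_sum fun u' hu' => ?_)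
      rw [abs_mul, abs_mul]
      refine mul_le_mul_of_nonneg_left ?_ (by positivity)
      rw [show x.1 - (x.1 + x.2) = -x.2 by ring, show x.1 + x.2 - x.1 = x.2 by ring]
      have b1 := hbound _ hr u hu u' hu'
      have b2 := hbound _ hr' u hu u' hu'
      rw [abs_le] at b1 b2 ⊢
      constructor <;> linarith [b1.1, b1.2, b2.1, b2.2]
    have e4 : ∑ u ∈ range (L + 1), ∑ u' ∈ range (L + 1), a u * a u' *
        (rawWeight K m d (ℓ n) (h n) (x.1 - (x.1 + x.2) + ((u : ℤ) - u'))
          + rawWeight K m d (ℓ n) (h n) (x.1 + x.2 - x.1 + ((u : ℤ) - u')))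
        = 2 * s + ∑ u ∈ range (L + 1), ∑ u' ∈ range (L + 1), a u * a u' *
        (rawWeight K m d (ℓ n) (h n) (x.1 - (x.1 + x.2) + ((u : ℤ) - u'))
          + rawWeight K m d (ℓ n) (h n) (x.1 + x.2 - x.1 + ((u : ℤ) - u')) - 2) := by
      rw [← e1, ← sum_add_distrib]
      refine sum_congr rfl fun u _ => ?_
      rw [← sum_add_distrib]
      exact sum_congr rfl fun u' _ => by ring
    rw [e4]
    linarith [(abs_le.1 e3).1]
  refine le_trans ?_ (card_mul_le_mse hK ha M hℓ1 hS1 (by positivity) hlow)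
  have hcard : (n : ℝ) / 2 * (η * ℓ n / 2) ≤ #S := by
    have h1 : (#S : ℝ) = #(Icc ((m : ℤ) * h n + 1) (n - m * h n - L - R)) * R := by
      simp only [S, card_product, Int.card_Icc, Nat.cast_mul]
      simp
    rw [h1]
    refine mul_le_mul ?_ hRge (by positivity) (by positivity)
    rw [Int.card_Icc]
    have h2 : ((n : ℤ) - m * h n - L - R + 1 - (m * h n + 1) : ℝ)
        ≤ (((n : ℤ) - m * h n - L - R + 1 - (m * h n + 1)).toNat : ℝ) := by
      exact_mod_cast Int.self_le_toNat _
    refine le_trans ?_ h2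
    have hnL' : (16 * L + 16 : ℝ) ≤ n := by exact_mod_cast hnL
    have hm0 : (0 : ℝ) ≤ m * h n := by positivity
    push_cast
    linarith
  calc η * s ^ 2 / 4 * ((ℓ n : ℝ) / n) = (n : ℝ) / 2 * (η * ℓ n / 2) * (s / n) ^ 2 := by
        field_simp; ring
    _ ≤ #S * (s / n) ^ 2 := mul_le_mul_of_nonneg_right hcard (by positivity)

end Bessel

/-! ### Rates -/

lemma bw_pos (p : ℕ) {n : ℕ} (hn : 1 ≤ n) : 0 < bw p n :=
  Real.rpow_pos_of_pos (by exact_mod_cast hn) _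

/-- `bw p n` balances `ℓ/n` and `ℓ^{-2p}`; rates are compared below as powers of `bw`, with this
identity replacing `n`. -/
lemma bw_pow (p n : ℕ) : bw p n ^ (1 + 2 * p) = n := by
  rw [bw, ← Real.rpow_natCast, ← Real.rpow_mul (Nat.cast_nonneg _)]
  have : (1 / (1 + 2 * (p : ℝ))) * ((1 + 2 * p : ℕ) : ℝ) = 1 := by
    push_cast; field_simp
  rw [this, Real.rpow_one]

lemma one_le_bw (p : ℕ) {n : ℕ} (hn : 1 ≤ n) : 1 ≤ bw p n :=
  Real.one_le_rpow (by exact_mod_cast hn) (by positivity)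

lemma rate_eq_div (p : ℕ) {n : ℕ} (hn : 1 ≤ n) : rate p n = bw p n / n := by
  have hn' : (0 : ℝ) < n := by exact_mod_cast hn
  rw [rate, bw, ← Real.rpow_sub_one hn'.ne']
  congr 1
  field_simp
  ring

lemma rate_eq_sq (p : ℕ) {n : ℕ} (hn : 1 ≤ n) : rate p n = ((1 / bw p n) ^ p) ^ 2 := by
  have h0 := bw_pos p hn
  rw [rate_eq_div p hn]
  rw [← bw_pow p n]
  rw [one_div, inv_pow, inv_pow, ← pow_mul, pow_add, pow_one, mul_comm 2 p]
  field_simp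

lemma rate_pos (p : ℕ) {n : ℕ} (hn : 1 ≤ n) : 0 < rate p n :=
  Real.rpow_pos_of_pos (by exact_mod_cast hn) _

lemma bw_pow_self (p n : ℕ) : bw p n ^ p = (n : ℝ) ^ ((p : ℝ) / (1 + 2 * (p : ℝ))) := by
  rw [bw, ← Real.rpow_natCast, ← Real.rpow_mul (Nat.cast_nonneg _)]
  congr 1
  ring

lemma DGM.mse_nonneg (G : DGM.{u}) (K : ℝ → ℝ) (m : ℕ) (d : ℕ → ℝ) (ℓ h : ℕ → ℕ) (n : ℕ) :
    0 ≤ G.mse K m d ℓ h n := integral_nonneg fun _ => sq_nonneg _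

lemma OffDiag.mono {K : ℝ → ℝ} (hK : IsKernel K) {m : ℕ} {ℓ h : ℕ → ℕ} (H : Admissible m ℓ h) {p p' : ℕ}
    (hp : p' ≤ p) (hoff : OffDiag K ℓ h p) : OffDiag K ℓ h p' := by
  obtain ⟨C, hC0, hC⟩ := hoff
  obtain ⟨A, hA⟩ := hK.bounded
  have hA0 : 0 ≤ A := (abs_nonneg _).trans (hA 0)
  refine ⟨C + A, by positivity, ?_⟩
  filter_upwards [hC, eventually_ge_atTop 1] with n hn hn1 x s hs
  have hℓ : (0 : ℝ) < ℓ n := by exact_mod_cast (H.range_ℓ n hn1).1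
  have ht0 : 0 ≤ (1 + |(x : ℝ)|) / ℓ n := by positivity
  rcases le_total ((1 + |(x : ℝ)|) / ℓ n) 1 with h1 | h1
  · calc _ ≤ C * ((1 + |(x : ℝ)|) / ℓ n) ^ p := hn x s hs
      _ ≤ C * ((1 + |(x : ℝ)|) / ℓ n) ^ p' :=
          mul_le_mul_of_nonneg_left (pow_le_pow_of_le_one ht0 h1 hp) hC0
      _ ≤ _ := mul_le_mul_of_nonneg_right (by linarith) (by positivity)
  · calc _ ≤ A := hA _
      _ ≤ C + A := by linarith
      _ ≤ _ := le_mul_of_one_le_right (by positivity) (one_le_pow₀ h1)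

/-! ### Upper bounds at the balanced bandwidth, and lower bounds from variance and bias -/

section Attains

variable {K : ℝ → ℝ} {m : ℕ} {d : ℕ → ℝ} {ℓ h : ℕ → ℕ}

lemma isBigO_div_natCast {f g : ℕ → ℝ} (hfg : f =O[atTop] g) :
    (fun n => f n / n) =O[atTop] fun n => g n / n := by
  simpa only [div_eq_mul_inv] using hfg.mul (isBigO_refl (fun n : ℕ => ((n : ℝ))⁻¹) atTop)

/-- The upper bound on `h` enters here: it keeps the mean part of the bias at the order `bw^{-p}` of
the noise part. -/
lemma isBigO_lag_term {p : ℕ} (hℓ : (fun n => (ℓ n : ℝ)) =O[atTop] bw p)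
    (hh : (fun n => (h n : ℝ)) =O[atTop] fun n => bw p n ^ p) :
    (fun n : ℕ => (ℓ n : ℝ) * h n / n) =O[atTop] fun n => (1 / bw p n) ^ p := by
  refine (isBigO_div_natCast (hℓ.mul hh)).trans (EventuallyEq.isBigO ?_)
  filter_upwards [eventually_ge_atTop 1] with n hn
  have h0 := bw_pos p hn
  rw [← bw_pow p n]
  rw [one_div, inv_pow, pow_add, pow_one, mul_comm 2 p, pow_mul]
  field_simp

lemma mseBigO_rate (hK : IsKernel K) {q : ℕ} {B : ℝ} (hq : NearOrigin K q B)
    (hd : IsDiffSeq m d) (H : Admissible m ℓ h) {p : ℕ} (hp : p ≤ q)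
    (hoff : OffDiag K ℓ h p) (hℓ : (fun n => (ℓ n : ℝ)) =Θ[atTop] bw p)
    (hh : (fun n => (h n : ℝ)) =O[atTop] fun n => bw p n ^ p) :
    MSEBigO.{u} K m d ℓ h q (rate p) := by
  intro G hG
  obtain ⟨C, hC0, hC⟩ := mse_isBigO hK hq hp hd H hoff hG
  have hlag := isBigO_lag_term hℓ.1 hh
  have hrate : (fun n => bw p n / n) =O[atTop] rate p := EventuallyEq.isBigO <| by
    filter_upwards [eventually_ge_atTop 1] with n hn using (rate_eq_div p hn).symm
  have hsq : (fun n => ((1 / bw p n) ^ p) ^ 2) =O[atTop] rate p := EventuallyEq.isBigO <| by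
    filter_upwards [eventually_ge_atTop 1] with n hn using (rate_eq_sq p hn).symm
  have h1 := (isBigO_div_natCast hℓ.1).trans hrate
  have hone : (fun n => (1 / bw p n) ^ p) =O[atTop] fun _ => (1 : ℝ) := by
    refine IsBigO.of_bound 1 ?_
    filter_upwards [eventually_ge_atTop 1] with n hn
    have h0 := one_le_bw p hn
    rw [Real.norm_of_nonneg (by positivity), norm_one, mul_one]
    exact pow_le_one₀ (by positivity) (by rw [div_le_one (by linarith)]; exact h0)
  have h2 : (fun n : ℕ => (ℓ n : ℝ) / n * (ℓ n * h n / n)) =O[atTop] rate p := by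
    simpa using h1.mul (hlag.trans hone)
  have h3 : (fun n : ℕ => ((1 / (ℓ n : ℝ)) ^ p) ^ 2) =O[atTop] rate p := by
    refine IsBigO.trans (IsBigO.pow (IsBigO.pow ?_ p) 2) hsq
    simp only [one_div]
    exact hℓ.2.inv_rev (by
      filter_upwards [eventually_ge_atTop 1] with n hn h0
      exact absurd h0 (bw_pos p hn).ne')
  have h4 : (fun n : ℕ => ((ℓ n : ℝ) * h n / n) ^ 2) =O[atTop] rate p := (hlag.pow 2).trans hsq
  refine IsBigO.trans (IsBigO.of_bound C ?_) (((h1.add h2).add h3).add h4)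
  filter_upwards [hC] with n hn
  rw [Real.norm_of_nonneg (G.mse_nonneg ..)]
  refine hn.trans (mul_le_mul_of_nonneg_left (le_abs_self _) hC0)

/-- White noise with Rademacher distribution, scaled by `σ`. -/
abbrev whiteNoise (σ : ℝ) : NoiseModel.{0} := twoTapNoise σ 0 0

lemma twoTapNoise_weaklyDependent (σ β : ℝ) (L : ℕ) : (twoTapNoise σ β L).WeaklyDependent :=
  linNoise_weaklyDependent _

lemma twoTapNoise_finiteU (σ β : ℝ) (L q : ℕ) : (twoTapNoise σ β L).FiniteU q :=
  linNoise_finiteU_of_finite (twoTap_eq_zero σ β L) q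

lemma isBigO_mse_of_variance (hK : IsKernel K) {q : ℕ} {B : ℝ} (hq : NearOrigin K q B)
    (hd : IsDiffSeq m d) (H : Admissible m ℓ h) (hoff : OffDiag K ℓ h 1) {σ β : ℝ} (hσ : σ + β ≠ 0)
    (L : ℕ) (M : MeanModel) :
    (fun n : ℕ => (ℓ n : ℝ) / n) =O[atTop] DGM.mse ⟨twoTapNoise σ β L, M⟩ K m d ℓ h := by
  obtain ⟨c, hc0, hc⟩ := exists_mul_le_mse hK hq hd H hoff (twoTap_eq_zero σ β L)
    (summable_abs_of_finite (twoTap_eq_zero σ β L)) (by rwa [sum_twoTap])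
  refine IsBigO.of_bound (1 / c) (hc.mono fun n hn => ?_)
  rw [Real.norm_of_nonneg (by positivity), Real.norm_of_nonneg (DGM.mse_nonneg ..), one_div,
    ← div_eq_inv_mul, le_div_iff₀ hc0, mul_comm]
  exact hn M

/-- The trend with slope one and a jump of size `κ`. -/
def stdMean (κ : ℝ) (hκ : κ ∈ Set.Icc (1 : ℝ) 3) : MeanModel :=
  trendJump (fun _ => 1) (fun _ => κ) (ne_zero_of_mem_Icc fun _ => hκ)

lemma inClass_stdMean {κ : ℝ} (hκ : κ ∈ Set.Icc (1 : ℝ) 3) {N : NoiseModel.{u}} {q : ℕ}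
    (hN : N.WeaklyDependent) (hU : N.FiniteU q) : DGM.InClass ⟨N, stdMean κ hκ⟩ q :=
  inClass_trendJump (fun _ => by norm_num) (fun _ => hκ) hN hU

lemma isBigO_rate_of_bandwidth {p : ℕ} {f : ℕ → ℝ} (hℓ : bw p =O[atTop] fun n => (ℓ n : ℝ))
    (hf : (fun n : ℕ => (ℓ n : ℝ) / n) =O[atTop] f) : rate p =O[atTop] f := by
  refine IsBigO.trans (EventuallyEq.isBigO ?_) ((isBigO_div_natCast hℓ).trans hf)
  filter_upwards [eventually_ge_atTop 1] with n hn using rate_eq_div p hn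

/-- The upper bound holds throughout the class, and under white noise the variance alone, of order
`ℓ/n`, already matches it. -/
theorem attains_rate (hK : IsKernel K) {q : ℕ} {B : ℝ} (hq : NearOrigin K q B)
    (hd : IsDiffSeq m d) (H : Admissible m ℓ h) {p : ℕ} (hp1 : 1 ≤ p) (hp : p ≤ q)
    (hoff : OffDiag K ℓ h p) (hℓ : (fun n => (ℓ n : ℝ)) =Θ[atTop] bw p)
    (hh : (fun n => (h n : ℝ)) =O[atTop] fun n => bw p n ^ p) :
    Attains.{u} K m d ℓ h q (rate p) := by
  refine ⟨mseBigO_rate hK hq hd H hp hoff hℓ hh, ⟨whiteNoise 1, stdMean 1 (by norm_num)⟩, ?_, ?_, ?_⟩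
  · exact inClass_stdMean _ (twoTapNoise_weaklyDependent _ _ _) (twoTapNoise_finiteU _ _ _ q)
  · exact mseBigO_rate hK hq hd H hp hoff hℓ hh _
      (inClass_stdMean _ (twoTapNoise_weaklyDependent _ _ _) (twoTapNoise_finiteU _ _ _ q))
  · exact isBigO_rate_of_bandwidth hℓ.2
      (isBigO_mse_of_variance hK hq hd H (hoff.mono hK H hp1) (by norm_num) 0 _)

/-- If the bias is of order `ℓ^{-p}` when `ℓ` is small, then no choice of `ℓ` beats the rate. -/
theorem mseLowerBound_of_bias (hK : IsKernel K) {q : ℕ} {B : ℝ} (hq : NearOrigin K q B)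
    (hd : IsDiffSeq m d) (H : Admissible m ℓ h) (hoff : OffDiag K ℓ h 1) {p : ℕ}
    {σ β : ℝ} (hσ : σ + β ≠ 0) {L : ℕ}
    (hbias : ∃ c : ℝ, 0 < c ∧ ∀ᶠ n in atTop, (ℓ n : ℝ) < bw p n →
      c * (1 / (ℓ n : ℝ)) ^ p ≤ |(twoTapNoise σ β L).bias K m d n (ℓ n) (h n)|) :
    MSELowerBound K m d ℓ h q (rate p) := by
  obtain ⟨c, hc0, hc⟩ := hbias
  let b : ℕ → ℝ := fun n => (twoTapNoise σ β L).bias K m d n (ℓ n) (h n)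
  let Q : ℕ → ℝ := fun n =>
    qform K m n (ℓ n) (h n) (trendResponse m d n (h n)) (trendResponse m d n (h n))
      + 2 * qform K m n (ℓ n) (h n) (trendResponse m d n (h n)) (midJump m d n (h n))
      + qform K m n (ℓ n) (h n) (midJump m d n (h n)) (midJump m d n (h n))
  -- Scaling the mean by `r` turns the bias into `b + r² Q`. If `|b + Q| < |b|/2`, then `b + 4Q =
  -- 4(b + Q) - 3b` exceeds `|b|` in absolute value, so one of the scales `1`, `2` rules out
  -- cancellation.
  let r : ℕ → ℝ := fun n => if |b n| / 2 ≤ |b n + Q n| then 1 else 2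
  have hr : ∀ n, r n ∈ Set.Icc (1 : ℝ) 3 := fun n => by
    simp only [r]; split_ifs <;> norm_num
  let G : DGM.{0} := ⟨twoTapNoise σ β L, trendJump r r (ne_zero_of_mem_Icc hr)⟩
  have hG : G.InClass q := inClass_trendJump hr hr (twoTapNoise_weaklyDependent _ _ _)
    (twoTapNoise_finiteU _ _ _ q)
  refine ⟨G, hG, ?_⟩
  have hb : ∀ᶠ n in atTop, (b n / 2) ^ 2 ≤ G.mse K m d ℓ h n := by
    filter_upwards [H.eventually_le, eventually_ge_atTop 2] with n hn hn2
    have h1 := DGM.sq_bias_le_mse (G := G) (d := d) hG.weak (summable_of_finiteU hG.finite_u) hK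
      (H.range_ℓ n (by omega)).1 hn
    refine le_trans (sq_le_sq.2 ?_) h1
    have h2 : G.bias K m d ℓ h n = b n + r n ^ 2 * Q n := by
      change (twoTapNoise σ β L).bias K m d n (ℓ n) (h n) + qform K m n (ℓ n) (h n)
        ((trendJump r r (ne_zero_of_mem_Icc hr)).M m d n (h n))
        ((trendJump r r (ne_zero_of_mem_Icc hr)).M m d n (h n)) = _
      rw [qform_trendJump hK hd _ _ hn2]
      simp only [b, Q]; ring
    rw [h2, abs_div, abs_two]
    simp only [r]
    split_ifs with h3
    · simpa using h3
    · push Not at h3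
      have h4 : |b n + 2 ^ 2 * Q n| = |3 * b n - 4 * (b n + Q n)| := by
        rw [← abs_neg]; congr 1; ring
      rw [h4]
      have h5 := abs_sub_abs_le_abs_sub (3 * b n) (4 * (b n + Q n))
      rw [abs_mul, abs_mul, abs_of_pos (by norm_num : (0 : ℝ) < 3),
        abs_of_pos (by norm_num : (0 : ℝ) < 4)] at h5
      have := abs_nonneg (b n)
      linarith
  obtain ⟨c', hc0', hc'⟩ := (isBigO_mse_of_variance hK hq hd H hoff hσ L
    (trendJump r r (ne_zero_of_mem_Icc hr))).exists_pos
  refine IsBigO.of_bound (c' + 4 / c ^ 2) ?_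
  filter_upwards [hb, hc, hc'.bound, eventually_ge_atTop 1] with n hn hcn hvn hn1
  have hm := G.mse_nonneg K m d ℓ h n
  rw [Real.norm_of_nonneg (by positivity), Real.norm_of_nonneg hm] at hvn
  rw [Real.norm_of_nonneg (rate_pos p hn1).le, Real.norm_of_nonneg hm, add_mul]
  have hpos2 : 0 ≤ 4 / c ^ 2 * G.mse K m d ℓ h n := by positivity
  have hpos1 : 0 ≤ c' * G.mse K m d ℓ h n := by positivity
  -- Small bandwidths are penalized by the bias, large ones by the variance.
  rcases lt_or_ge (ℓ n : ℝ) (bw p n) with hlt | hge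
  · have h1 := hcn hlt
    have hℓ : (0 : ℝ) < ℓ n := by exact_mod_cast (H.range_ℓ n hn1).1
    have h2 : (1 / bw p n) ^ p ≤ (1 / (ℓ n : ℝ)) ^ p :=
      pow_le_pow_left₀ (by have := bw_pos p hn1; positivity)
        (one_div_le_one_div_of_le hℓ hlt.le) p
    have h3 : c * (1 / bw p n) ^ p ≤ |b n| := (mul_le_mul_of_nonneg_left h2 hc0.le).trans h1
    have h4 : (c * (1 / bw p n) ^ p) ^ 2 ≤ b n ^ 2 := by
      rw [← sq_abs (b n)]
      exact pow_le_pow_left₀ (by have := bw_pos p hn1; positivity) h3 2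
    rw [mul_pow, ← rate_eq_sq p hn1] at h4
    have h5 : rate p n ≤ 4 / c ^ 2 * G.mse K m d ℓ h n := by
      rw [div_mul_eq_mul_div, le_div_iff₀ (by positivity)]
      nlinarith
    linarith
  · have h1 : rate p n ≤ (ℓ n : ℝ) / n := by
      rw [rate_eq_div p hn1]; gcongr
    exact (h1.trans hvn).trans (by linarith)

end Attains

/-! ### Weights and difference sequences -/

lemma delta_eq_zero {m : ℕ} (d : ℕ → ℝ) {s : ℕ} (hs : m < s) : delta m d s = 0 := by
  rw [delta, Icc_eq_empty (by omega), sum_empty]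

lemma delta_succ (m : ℕ) (d : ℕ → ℝ) {s : ℕ} (hs : s ≤ m + 1) :
    delta (m + 1) d s = delta m d s + d (m + 1) * d (m + 1 - s) := by
  rw [delta, delta, sum_Icc_succ_top hs]

/-- Pairs are grouped by their difference: `±s` each carry total weight `δ_s`. -/
lemma sum_sum_mul_sub (m : ℕ) (d : ℕ → ℝ) (F : ℤ → ℝ) :
    ∑ j ∈ range (m + 1), ∑ j' ∈ range (m + 1), d j * d j' * F ((j : ℤ) - j')
      = delta m d 0 * F 0 + ∑ s ∈ Icc 1 m, delta m d s * (F s + F (-s)) := by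
  induction m with
  | zero => simp [delta]
  | succ m ih =>
    have e1 : ∑ j ∈ range (m + 1 + 1), ∑ j' ∈ range (m + 1 + 1), d j * d j' * F ((j : ℤ) - j')
        = (∑ j ∈ range (m + 1), ∑ j' ∈ range (m + 1), d j * d j' * F ((j : ℤ) - j'))
          + d (m + 1) * d (m + 1) * F 0
          + ∑ j ∈ range (m + 1), d (m + 1) * d j *
            (F (((m + 1 : ℕ) : ℤ) - j) + F ((j : ℤ) - (m + 1 : ℕ))) := by
      simp only [sum_range_succ _ (m + 1), sum_add_distrib, sub_self, mul_add]
      have : ∀ j : ℕ, d j * d (m + 1) = d (m + 1) * d j := fun j => mul_comm _ _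
      simp only [this]
      ring
    have e2 : ∑ s ∈ Icc 1 (m + 1), delta (m + 1) d s * (F s + F (-s))
        = ∑ s ∈ Icc 1 m, delta m d s * (F s + F (-s))
          + ∑ s ∈ Icc 1 (m + 1), d (m + 1) * d (m + 1 - s) * (F s + F (-s)) := by
      have : ∑ s ∈ Icc 1 m, delta m d s * (F s + F (-s))
          = ∑ s ∈ Icc 1 (m + 1), delta m d s * (F s + F (-s)) := by
        rw [sum_Icc_succ_top (by omega), delta_eq_zero d (Nat.lt_succ_self m), zero_mul, add_zero]
      rw [this, ← sum_add_distrib]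
      refine sum_congr rfl fun s hs => ?_
      rw [delta_succ m d (mem_Icc.1 hs).2]; ring
    have e3 : ∑ s ∈ Icc 1 (m + 1), d (m + 1) * d (m + 1 - s) * (F s + F (-s))
        = ∑ j ∈ range (m + 1), d (m + 1) * d j *
            (F (((m + 1 : ℕ) : ℤ) - j) + F ((j : ℤ) - (m + 1 : ℕ))) := by
      refine sum_nbij' (fun s => m + 1 - s) (fun j => m + 1 - j) ?_ ?_ ?_ ?_ ?_
      · intro s hs; rw [mem_Icc] at hs; rw [mem_range]; omega
      · intro j hj; rw [mem_range] at hj; rw [mem_Icc]; omega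
      · intro s hs; rw [mem_Icc] at hs; omega
      · intro j hj; rw [mem_range] at hj; omega
      · intro s hs
        rw [mem_Icc] at hs
        have h1 : ((m + 1 : ℕ) : ℤ) - ((m + 1 - s : ℕ) : ℤ) = s := by omega
        have h2 : ((m + 1 - s : ℕ) : ℤ) - ((m + 1 : ℕ) : ℤ) = -s := by omega
        rw [h1, h2]
    rw [e1, ih, e2, e3, delta_succ m d (Nat.zero_le _)]
    simp only [Nat.sub_zero]
    ring

lemma IsDiffSeq.delta_zero {m : ℕ} {d : ℕ → ℝ} (hd : IsDiffSeq m d) : delta m d 0 = 1 := by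
  rw [← hd.sum_sq, delta, range_eq_Ico]
  exact sum_congr rfl fun j _ => by rw [Nat.sub_zero, sq]

lemma IsDiffSeq.rawWeight_eq {m : ℕ} {d : ℕ → ℝ} (hd : IsDiffSeq m d) (K : ℝ → ℝ) (ℓ h : ℕ) (x : ℤ) :
    rawWeight K m d ℓ h x = K ((x : ℝ) / ℓ) + ∑ s ∈ Icc 1 m, delta m d s *
      (K (((x - s * h : ℤ) : ℝ) / ℓ) + K (((x + s * h : ℤ) : ℝ) / ℓ)) := by
  have := sum_sum_mul_sub m d fun y => K (((x - y * h : ℤ) : ℝ) / ℓ)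
  simp only [hd.delta_zero, one_mul, zero_mul, sub_zero, neg_mul, sub_neg_eq_add] at this
  exact this

lemma IsDiffSeq.acvfWeight_eq {m : ℕ} {d : ℕ → ℝ} (hd : IsDiffSeq m d) (K : ℝ → ℝ) (n ℓ h : ℕ)
    (x : ℤ) :
    acvfWeight K m d n ℓ h x = wKernel K m n ℓ h x + ∑ s ∈ Icc 1 m, delta m d s *
      (wKernel K m n ℓ h (x - s * h) + wKernel K m n ℓ h (x + s * h)) := by
  have := sum_sum_mul_sub m d fun y => wKernel K m n ℓ h (x - y * h)
  simp only [hd.delta_zero, one_mul, zero_mul, sub_zero, neg_mul, sub_neg_eq_add] at this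
  exact this

/-- All shifted lags `x ± sh` with `s ≥ 1` lie outside the support of the kernel. -/
lemma IsDiffSeq.acvfWeight_eq_wKernel {m : ℕ} {d : ℕ → ℝ} (hd : IsDiffSeq m d) {K : ℝ → ℝ}
    (hK : IsKernel K) {n ℓ h : ℕ} (hℓ : 1 ≤ ℓ) {x : ℤ} (hx0 : 0 ≤ x) (hx : x + ℓ ≤ h) :
    acvfWeight K m d n ℓ h x = wKernel K m n ℓ h x := by
  rw [hd.acvfWeight_eq, add_eq_left]
  refine sum_eq_zero fun s hs => ?_
  have hs1 : (1 : ℤ) ≤ s := by exact_mod_cast (mem_Icc.1 hs).1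
  have hsh : (h : ℤ) ≤ s * h := le_mul_of_one_le_left (by positivity) hs1
  rw [wKernel_zero hK hℓ (by rw [abs_of_nonpos (by linarith)]; linarith),
    wKernel_zero hK hℓ (by rw [abs_of_nonneg (by positivity)]; linarith), add_zero, mul_zero]

/-! ### Differencing at lags of at least the bandwidth -/

section Lags

variable {K : ℝ → ℝ} {m : ℕ} {d : ℕ → ℝ} {ℓ h : ℕ → ℕ}

lemma eventually_lag_ge (H : Admissible m ℓ h) {c : ℝ} (hc : ∀ᶠ n in atTop, c ≤ ratio ℓ h n) :
    ∀ᶠ n in atTop, c * ℓ n ≤ h n := by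
  filter_upwards [hc, eventually_ge_atTop 1] with n hn hn1
  have hℓ : (0 : ℝ) < ℓ n := by exact_mod_cast (H.range_ℓ n hn1).1
  rwa [ratio, le_div_iff₀ hℓ] at hn

/-- Lags up to `δℓ` see no shifted kernel. For larger lags `(1 + |x|)/ℓ` is at least `δ`, so
boundedness of `K` suffices for every `p`. -/
lemma offDiag_of_ratio (hK : IsKernel K) (H : Admissible m ℓ h) {δ : ℝ} (hδ : 0 < δ)
    (hr : ∀ᶠ n in atTop, 1 + δ ≤ ratio ℓ h n) (p : ℕ) : OffDiag K ℓ h p := by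
  obtain ⟨A, hA⟩ := hK.bounded
  have hA0 : 0 ≤ A := (abs_nonneg _).trans (hA 0)
  refine ⟨A / δ ^ p, by positivity, ?_⟩
  filter_upwards [eventually_lag_ge H hr, eventually_ge_atTop 1] with n hn hn1 x s hs
  have hℓ1 := (H.range_ℓ n hn1).1
  have hℓ : (0 : ℝ) < ℓ n := by exact_mod_cast hℓ1
  rcases le_or_gt |(x : ℝ)| (δ * ℓ n) with hx | hx
  · rw [hK.support, abs_zero]
    · positivity
    rw [abs_div, abs_of_pos hℓ, one_le_div hℓ]
    have hs1 : (1 : ℝ) ≤ |(s : ℝ)| := by exact_mod_cast Int.one_le_abs hs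
    have h1 : (h n : ℝ) ≤ |(s : ℝ) * h n| := by
      rw [abs_mul, Nat.abs_cast]
      exact le_mul_of_one_le_left (by positivity) hs1
    have h2 := abs_sub_abs_le_abs_sub ((s : ℝ) * h n) x
    rw [abs_sub_comm] at h2
    push_cast
    linarith
  · refine (hA _).trans ?_
    rw [div_mul_eq_mul_div, le_div_iff₀ (by positivity)]
    refine mul_le_mul_of_nonneg_left (pow_le_pow_left₀ hδ.le ?_ p) hA0
    rw [le_div_iff₀ hℓ]; linarith

lemma NearBoundary.abs_le (hK : IsKernel K) {q' : ℕ} {B' : ℝ} (hq' : NearBoundary K q' B') :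
    ∃ C : ℝ, 0 ≤ C ∧ ∀ t, 0 < t → |K (1 - t)| ≤ C * t ^ q' := by
  obtain ⟨A, hA⟩ := hK.bounded
  have hA0 : 0 ≤ A := (abs_nonneg _).trans (hA 0)
  have h1 : ∀ᶠ t in 𝓝[>] (0 : ℝ), |(K 1 - K (1 - t)) / |t| ^ q'| < |B'| + 1 :=
    hq'.lim.abs.eventually_lt_const (by linarith)
  rw [eventually_nhdsWithin_iff, Metric.eventually_nhds_iff] at h1
  obtain ⟨ε, hε, h1⟩ := h1
  refine ⟨(|B'| + 1) + A / ε ^ q', by positivity, fun t ht => ?_⟩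
  rw [add_mul]
  rcases lt_or_ge t ε with h | h
  · have h2 := h1 (by simpa [abs_of_pos ht] using h) ht
    rw [hK.support 1 (by simp), zero_sub, abs_div, abs_neg, abs_of_pos ht,
      abs_of_pos (by positivity : 0 < t ^ q'), div_lt_iff₀ (by positivity)] at h2
    have : 0 ≤ A / ε ^ q' * t ^ q' := by positivity
    linarith
  · have h2 : A ≤ A / ε ^ q' * t ^ q' := by
      rw [div_mul_eq_mul_div, le_div_iff₀ (by positivity)]
      exact mul_le_mul_of_nonneg_left (pow_le_pow_left₀ hε.le h q') hA0
    have : 0 ≤ (|B'| + 1) * t ^ q' := by positivity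
    linarith [hA (1 - t)]

/-- A shifted argument inside the support is at distance at most `(R + |x|)/ℓ` from the endpoint,
where `K` decays with order `q'`. -/
lemma offDiag_of_nearBoundary (hK : IsKernel K) (H : Admissible m ℓ h) {q' : ℕ} {B' : ℝ}
    (hq' : NearBoundary K q' B') {R : ℕ} (hR : ∀ᶠ n in atTop, |(h n : ℝ) - ℓ n| ≤ R) :
    OffDiag K ℓ h q' := by
  obtain ⟨C, hC0, hC⟩ := hq'.abs_le hK
  refine ⟨C * (R + 1) ^ q', by positivity, ?_⟩
  filter_upwards [hR, eventually_ge_atTop 1] with n hn hn1 x s hs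
  have hℓ : (0 : ℝ) < ℓ n := by exact_mod_cast (H.range_ℓ n hn1).1
  set y : ℝ := |((x - s * h n : ℤ) : ℝ)| / ℓ n with hy
  have hKy : K (((x - s * h n : ℤ) : ℝ) / ℓ n) = K y := by
    rcases abs_cases (((x - s * h n : ℤ) : ℝ)) with ⟨h1, _⟩ | ⟨h1, _⟩
    · rw [hy, h1]
    · rw [hy, h1, neg_div, hK.even]
  rw [hKy]
  rcases lt_or_ge y 1 with h1 | h1
  · have h2 := hC (1 - y) (by linarith)
    rw [sub_sub_cancel] at h2
    refine h2.trans ?_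
    rw [mul_assoc, ← mul_pow]
    refine mul_le_mul_of_nonneg_left (pow_le_pow_left₀ (by linarith) ?_ _) hC0
    have hs1 : (1 : ℝ) ≤ |(s : ℝ)| := by exact_mod_cast Int.one_le_abs hs
    have h3 : (h n : ℝ) ≤ |(s : ℝ) * h n| := by
      rw [abs_mul, Nat.abs_cast]
      exact le_mul_of_one_le_left (by positivity) hs1
    have h4 := abs_sub_abs_le_abs_sub ((s : ℝ) * h n) x
    rw [abs_sub_comm] at h4
    rw [hy, ← mul_div_assoc, le_div_iff₀ hℓ, sub_mul, div_mul_cancel₀ _ hℓ.ne', one_mul]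
    push_cast
    have h5 := (abs_le.1 hn).1
    have h6 : 0 ≤ (R : ℝ) * |(x : ℝ)| := by positivity
    nlinarith
  · rw [hK.support y (h1.trans (le_abs_self _)), abs_zero]
    positivity

/-! ### Inconsistency -/

lemma tendsto_bias_zero (hK : IsKernel K) (H : Admissible m ℓ h) {G : DGM.{u}} {q : ℕ}
    (hG : G.InClass q) (hmse : Tendsto (G.mse K m d ℓ h) atTop (𝓝 0)) :
    Tendsto (G.bias K m d ℓ h) atTop (𝓝 0) := by
  have h1 : Tendsto (fun n => G.bias K m d ℓ h n ^ 2) atTop (𝓝 0) := by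
    refine squeeze_zero' (Eventually.of_forall fun n => sq_nonneg _) ?_ hmse
    filter_upwards [H.eventually_le, eventually_ge_atTop 1] with n hn hn1
    exact DGM.sq_bias_le_mse hG.weak (summable_of_finiteU hG.finite_u) hK (H.range_ℓ n hn1).1 hn
  have h2 := h1.sqrt
  simp only [Real.sqrt_sq_eq_abs, Real.sqrt_zero] at h2
  exact (tendsto_zero_iff_abs_tendsto_zero _).2 h2

lemma tendsto_acvfWeight_sub_rawWeight (hK : IsKernel K) (H : Admissible m ℓ h) (d : ℕ → ℝ) (x : ℤ) :
    Tendsto (fun n => acvfWeight K m d n (ℓ n) (h n) x - rawWeight K m d (ℓ n) (h n) x)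
      atTop (𝓝 0) := by
  obtain ⟨A, hA⟩ := hK.bounded
  have h1 := (H.tendsto_aux.2).const_mul
    ((∑ j ∈ range (m + 1), ∑ j' ∈ range (m + 1), |d j * d j'|) * A)
  rw [mul_zero] at h1
  refine squeeze_zero_norm' ?_ h1
  filter_upwards [eventually_ge_atTop 1] with n hn
  have := abs_acvfWeight_sub_rawWeight_le hK hA m d (h n) (H.range_ℓ n hn).1 hn x
  rwa [add_comm (ℓ n : ℝ)]

/-- White noises of scale `2` and `1` with the same mean have biases differing by `3(w(0) - 1)`. If
the MSE vanished for both, `w(0)` would tend to one. -/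
theorem inconsistent_of_rawWeight (hK : IsKernel K) (H : Admissible m ℓ h) (q : ℕ) {w : ℝ}
    (hw : w ≠ 1) (hlim : Tendsto (fun n => rawWeight K m d (ℓ n) (h n) 0) atTop (𝓝 w)) :
    Inconsistent K m d ℓ h q := by
  by_contra hcon
  simp only [Inconsistent, not_exists, not_and, not_not] at hcon
  let G : ℝ → DGM.{0} := fun σ => ⟨whiteNoise σ, stdMean 1 (by norm_num)⟩
  have hG : ∀ σ, (G σ).InClass q := fun σ =>
    inClass_stdMean _ (twoTapNoise_weaklyDependent _ _ _) (twoTapNoise_finiteU _ _ _ q)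
  have hb : ∀ σ, Tendsto ((G σ).bias K m d ℓ h) atTop (𝓝 0) := fun σ =>
    tendsto_bias_zero hK H (hG σ) (hcon _ (hG σ))
  have h1 := (hb 2).sub (hb 1)
  have h2 : Tendsto (fun n => 3 * (acvfWeight K m d n (ℓ n) (h n) 0 - 1)) atTop (𝓝 0) := by
    refine (h1.congr fun n => ?_).trans (by simp)
    simp only [DGM.bias, G, twoTapNoise_bias hK]
    ring
  have h3 := ((tendsto_acvfWeight_sub_rawWeight hK H d 0).add hlim).sub_const 1
  have h4 := (h3.const_mul 3).congr (f₂ := fun n => 3 * (acvfWeight K m d n (ℓ n) (h n) 0 - 1))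
    fun n => by ring
  have h5 := tendsto_nhds_unique h2 h4
  apply hw
  linarith

/-- All shifted arguments tend to zero, so the weight of `γ_0` tends to `(∑ d_j)² = 0`: differencing
removes the signal of the noise itself. -/
theorem inconsistent_of_ratio_zero (hK : IsKernel K) (hd : IsDiffSeq m d) (H : Admissible m ℓ h)
    (q : ℕ) (hr : Tendsto (ratio ℓ h) atTop (𝓝 0)) : Inconsistent K m d ℓ h q := by
  refine inconsistent_of_rawWeight hK H q (w := 0) (by norm_num) ?_
  have hK0 : Tendsto K (𝓝 0) (𝓝 1) := by
    have := (hK.cont.continuousAt (Ioo_mem_nhds (by norm_num) (by norm_num : (0 : ℝ) < 1))).tendsto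
    rwa [hK.zero] at this
  have h1 : Tendsto (fun n => rawWeight K m d (ℓ n) (h n) 0) atTop
      (𝓝 (∑ j ∈ range (m + 1), ∑ j' ∈ range (m + 1), d j * d j' * 1)) := by
    unfold rawWeight
    refine tendsto_finsetSum _ fun j _ => tendsto_finsetSum _ fun j' _ => ?_
    refine Tendsto.const_mul _ (hK0.comp ?_)
    have h2 := hr.const_mul (-((j : ℝ) - j'))
    rw [mul_zero] at h2
    refine h2.congr fun n => ?_
    rw [ratio]; push_cast; ring
  have h2 : ∑ j ∈ range (m + 1), ∑ j' ∈ range (m + 1), d j * d j' * 1 = 0 := by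
    simp only [mul_one]
    rw [← sum_mul_sum, hd.sum_zero, zero_mul]
  rwa [h2] at h1

theorem inconsistent_of_unambiguous (hK : IsKernel K) (hd : IsDiffSeq m d) (H : Admissible m ℓ h)
    (q : ℕ) (hu : Unambiguous K m d ℓ h) : Inconsistent K m d ℓ h q := by
  obtain ⟨Ω, hΩ, hlim⟩ := hu
  refine inconsistent_of_rawWeight hK H q (w := 1 + Ω) (by simpa using hΩ) ?_
  refine (hlim.const_add 1).congr' ?_
  filter_upwards [eventually_ge_atTop 1] with n hn
  have hℓ : (0 : ℝ) < ℓ n := by exact_mod_cast (H.range_ℓ n hn).1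
  have hh : (0 : ℝ) < h n := by exact_mod_cast (H.range_h n hn).1
  have hr : 0 < ratio ℓ h n := div_pos hh hℓ
  rw [hd.rawWeight_eq, Int.cast_zero, zero_div, hK.zero]
  congr 1
  have e1 : ∀ s ∈ Icc 1 m, delta m d s * (K (((0 - s * h n : ℤ) : ℝ) / ℓ n)
      + K (((0 + s * h n : ℤ) : ℝ) / ℓ n)) = 2 * (delta m d s * K (ratio ℓ h n * s)) := by
    intro s _
    rw [zero_sub, zero_add, hK.even_int, ratio]
    have : (((s : ℤ) * h n : ℤ) : ℝ) / ℓ n = (h n : ℝ) / ℓ n * s := by push_cast; ring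
    rw [this]; ring
  rw [sum_congr rfl e1, ← mul_sum]
  congr 1
  set S := ⌊1 / ratio ℓ h n⌋₊ with hS
  -- Summing to `⌊1/λ⌋` or to `m` is the same, since beyond the former `K(λs)` vanishes and beyond
  -- the latter `δ_s` does.
  have e2 : ∀ T, T ≤ max m S → (∀ s, T < s → delta m d s * K (ratio ℓ h n * s) = 0) →
      ∑ s ∈ Icc 1 T, delta m d s * K (ratio ℓ h n * s)
        = ∑ s ∈ Icc 1 (max m S), delta m d s * K (ratio ℓ h n * s) := fun T hT hz =>
    sum_subset (Icc_subset_Icc_right hT) fun s hs hs' => hz s (by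
      rw [mem_Icc] at hs hs'; omega)
  rw [e2 S (le_max_right _ _), e2 m (le_max_left _ _)]
  · intro s hs; rw [delta_eq_zero d hs, zero_mul]
  · intro s hs
    rw [hK.support, mul_zero]
    have h1 : 1 / ratio ℓ h n < s := (Nat.floor_lt (by positivity)).1 hs
    rw [div_lt_iff₀ hr] at h1
    rw [abs_of_nonneg (by positivity)]; linarith

end Lags

section BiasLower

variable {K : ℝ → ℝ} {m : ℕ} {d : ℕ → ℝ} {ℓ h : ℕ → ℕ}

/-! ### The bias of order `ℓ^{-q}` -/

lemma NearOrigin.tendsto_mul_pow (hK : IsKernel K) {q : ℕ} {B : ℝ} (hq : NearOrigin K q B)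
    (H : Admissible m ℓ h) {x : ℕ} (hx : 1 ≤ x) :
    Tendsto (fun n => (K ((x : ℝ) / ℓ n) - 1) * (ℓ n : ℝ) ^ q) atTop (𝓝 (B * (x : ℝ) ^ q)) := by
  have hx0 : (0 : ℝ) < x := by exact_mod_cast hx
  have h1 : Tendsto (fun n => (x : ℝ) / ℓ n) atTop (𝓝[>] 0) := by
    refine tendsto_nhdsWithin_iff.2 ⟨H.tendsto_bandwidth.const_div_atTop _, ?_⟩
    filter_upwards [eventually_ge_atTop 1] with n hn
    have hℓ : (0 : ℝ) < ℓ n := by exact_mod_cast (H.range_ℓ n hn).1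
    exact div_pos hx0 hℓ
  refine ((hq.lim.comp h1).mul_const ((x : ℝ) ^ q)).congr' ?_
  filter_upwards [eventually_ge_atTop 1] with n hn
  have hℓ : (0 : ℝ) < ℓ n := by exact_mod_cast (H.range_ℓ n hn).1
  simp only [Function.comp]
  rw [hK.zero, abs_of_pos (by positivity), div_pow]
  field_simp

lemma tendsto_kernel_one_div (hK : IsKernel K) (H : Admissible m ℓ h) :
    Tendsto (fun n => K (1 / ℓ n)) atTop (𝓝 1) := by
  have h1 := (hK.cont.continuousAt (Ioo_mem_nhds (by norm_num) (by norm_num : (0 : ℝ) < 1))).tendsto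
  rw [hK.zero] at h1
  exact h1.comp (H.tendsto_bandwidth.const_div_atTop _)

/-- The noise `ε_i + (ς/2) ε_{i-1}` involves only lags `0` and `±1`, where differencing leaves no
shifted kernels. Its bias combines `ς(K(1/ℓ) - 1) ≈ -|B| ℓ^{-q}` with corrections in `t = mh/n` and
`1/n`. -/
theorem mseLowerBound_of_ratio (hK : IsKernel K) {q : ℕ} {B : ℝ} (hq : NearOrigin K q B)
    (hd : IsDiffSeq m d) (H : Admissible m ℓ h) {δ : ℝ} (hδ : 0 < δ)
    (hr : ∀ᶠ n in atTop, 1 + δ ≤ ratio ℓ h n) : MSELowerBound K m d ℓ h q (rate q) := by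
  set ς : ℝ := if 0 < B then -1 else 1 with hς
  have hςB : ς * B = -|B| := by
    rw [hς]; split_ifs with hB
    · rw [abs_of_pos hB]; ring
    · rw [abs_of_nonpos (not_lt.1 hB)]; ring
  have hςabs : |ς| = 1 := by rw [hς]; split_ifs <;> simp
  have hς2 : ς ^ 2 = 1 := by rw [← sq_abs, hςabs, one_pow]
  have hB : 0 < |B| := abs_pos.2 hq.ne
  refine mseLowerBound_of_bias hK hq hd H (offDiag_of_ratio hK H hδ hr 1) (σ := 1) (β := ς / 2)
    (L := 1) (by rw [hς]; split_ifs <;> norm_num) ⟨|B| / 4, by positivity, ?_⟩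
  have hlim := (hq.tendsto_mul_pow hK H le_rfl).const_mul ς
  simp only [Nat.cast_one, one_pow, mul_one, hςB] at hlim
  filter_upwards [eventually_lag_ge H hr, eventually_ge_atTop 1,
    H.tendsto_bandwidth.eventually_ge_atTop (1 / δ), H.tendsto_bandwidth.eventually_ge_atTop (5 / |B|),
    hlim.eventually_lt_const (show -|B| < -(|B| / 2) by linarith),
    (tendsto_kernel_one_div hK H).eventually_lt_const (show (1 : ℝ) < 5 / 4 by norm_num),
    (tendsto_kernel_one_div hK H).eventually_const_lt (show (0 : ℝ) < 1 by norm_num)]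
    with n hh hn1 hℓδ hℓB hb hk1 hk0 hlt
  have hℓ1 := (H.range_ℓ n hn1).1
  have hℓ : (0 : ℝ) < ℓ n := by exact_mod_cast hℓ1
  have hn : (0 : ℝ) < n := by exact_mod_cast hn1
  have hhℓ : ℓ n + 1 ≤ h n := by
    rw [div_le_iff₀ hδ] at hℓδ
    have : (ℓ n : ℝ) + 1 ≤ h n := by linarith
    exact_mod_cast this
  rw [twoTapNoise_bias hK, hd.acvfWeight_eq_wKernel hK hℓ1 le_rfl (by omega),
    hd.acvfWeight_eq_wKernel hK hℓ1 (by positivity) (by push_cast; omega)]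
  simp only [wKernel, Int.cast_zero, zero_div, hK.zero, abs_zero, Nat.cast_one, Int.cast_one, abs_one,
    sub_zero, one_mul, one_pow, mul_one]
  set k := K (1 / ℓ n)
  set t : ℝ := m * h n / n with ht
  have ht0 : 0 ≤ t := by positivity
  have e1 : ((n : ℝ) - m * h n) / n = 1 - t := by rw [ht]; field_simp
  have e2 : ((n : ℝ) - m * h n - 1) / n = 1 - t - 1 / n := by rw [ht]; field_simp
  rw [e1, e2]
  have hpow : (0 : ℝ) < ℓ n ^ q := by positivity
  -- As `ℓ < bw`, `ℓ^{q+1} ≤ ℓ^{1+2q} ≤ n`, so `1/n` is negligible against `ℓ^{-q}`.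
  have hn2 : 5 / 4 * (1 / (n : ℝ)) ≤ |B| / 4 * (1 / (ℓ n : ℝ)) ^ q := by
    have h1 : (ℓ n : ℝ) ^ (1 + 2 * q) ≤ n := by
      rw [← bw_pow q n]
      exact pow_le_pow_left₀ hℓ.le hlt.le _
    have h2 : (ℓ n : ℝ) * (ℓ n : ℝ) ^ q ≤ n := by
      refine le_trans ?_ h1
      rw [← pow_succ']
      exact pow_le_pow_right₀ (by exact_mod_cast hℓ1) (by omega)
    rw [div_le_iff₀ hB] at hℓB
    rw [one_div, one_div, inv_pow, ← div_eq_mul_inv, ← div_eq_mul_inv, div_le_div_iff₀ hn hpow]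
    nlinarith
  have hb' : ς * (k - 1) ≤ -(|B| / 2) * (1 / (ℓ n : ℝ)) ^ q := by
    rw [one_div, inv_pow, ← div_eq_mul_inv, le_div_iff₀ hpow]
    linarith
  have hinv : (0 : ℝ) < 1 / n := by positivity
  have hςk : -(ς * (k * (t + 1 / n))) ≤ k * (t + 1 / n) := by
    have h1 : 0 ≤ k * (t + 1 / n) := by positivity
    have h2 := (abs_le.1 hςabs.le).1
    nlinarith
  have hkt : k * (t + 1 / n) ≤ 5 / 4 * (t + 1 / n) :=
    mul_le_mul_of_nonneg_right hk1.le (by positivity)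
  refine le_trans ?_ (neg_le_abs _)
  -- `h`, and hence `t`, is not controlled by `ℓ`. Lag zero contributes `-(5/4)t`, which outweighs
  -- the `t`-term at lag one because `K(1/ℓ) < 5/4`; so `t` cannot offset the kernel term.
  have e3 : (1 + (ς / 2) ^ 2) * (1 - t - 1) + 2 * (ς / 2) * (k * (1 - t - 1 / n) - 1)
      = -(1 + ς ^ 2 / 4) * t + ς * (k - 1) - ς * (k * (t + 1 / n)) := by ring
  rw [e3, hς2]
  linarith

/-! ### Lags next to the bandwidth -/

/-- The positive part appears because `K` vanishes at and beyond the endpoint, whereas inside `K(1 -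
u) ≈ -B' u^{q'}`. -/
lemma NearBoundary.tendsto_mul_pow (hK : IsKernel K) {q' : ℕ} {B' : ℝ} (hq' : NearBoundary K q' B')
    (H : Admissible m ℓ h) (y : ℤ) :
    Tendsto (fun n => K (1 - (y : ℝ) / ℓ n) * (ℓ n : ℝ) ^ q') atTop
      (𝓝 (-B' * (max y 0 : ℤ) ^ q')) := by
  rcases le_or_gt y 0 with hy | hy
  · rw [max_eq_right hy, Int.cast_zero, zero_pow (by have := hq'.pos; omega), mul_zero]
    refine tendsto_const_nhds.congr' ?_
    filter_upwards [eventually_ge_atTop 1] with n hn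
    have hℓ : (0 : ℝ) < ℓ n := by exact_mod_cast (H.range_ℓ n hn).1
    have : (y : ℝ) / ℓ n ≤ 0 := div_nonpos_of_nonpos_of_nonneg (by exact_mod_cast hy) hℓ.le
    rw [hK.support, zero_mul]
    rw [abs_of_nonneg (by linarith)]; linarith
  · rw [max_eq_left hy.le]
    have hy0 : (0 : ℝ) < y := by exact_mod_cast hy
    have h1 : Tendsto (fun n => (y : ℝ) / ℓ n) atTop (𝓝[>] 0) := by
      refine tendsto_nhdsWithin_iff.2 ⟨H.tendsto_bandwidth.const_div_atTop _, ?_⟩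
      filter_upwards [eventually_ge_atTop 1] with n hn
      have hℓ : (0 : ℝ) < ℓ n := by exact_mod_cast (H.range_ℓ n hn).1
      exact div_pos hy0 hℓ
    have h2 := ((hq'.lim.comp h1).neg.mul_const ((y : ℝ) ^ q'))
    refine h2.congr' ?_
    filter_upwards [eventually_ge_atTop 1] with n hn
    have hℓ : (0 : ℝ) < ℓ n := by exact_mod_cast (H.range_ℓ n hn).1
    simp only [Function.comp]
    rw [hK.support 1 (by simp), abs_of_pos (by positivity), div_pow]
    field_simp
    ring

lemma tendsto_mul_pow_of_le {f : ℕ → ℝ} (H : Admissible m ℓ h) {p r : ℕ} (hp : p ≤ r) {c : ℝ}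
    (hf : Tendsto (fun n => f n * (ℓ n : ℝ) ^ r) atTop (𝓝 c)) :
    Tendsto (fun n => f n * (ℓ n : ℝ) ^ p) atTop (𝓝 (if r = p then c else 0)) := by
  split_ifs with h1
  · rwa [← h1]
  · have h2 : Tendsto (fun n => ((ℓ n : ℝ) ^ (r - p))⁻¹) atTop (𝓝 0) :=
      ((tendsto_pow_atTop (by omega)).comp H.tendsto_bandwidth).inv_tendsto_atTop
    have h3 := hf.mul h2
    rw [mul_zero] at h3
    refine h3.congr' ?_
    filter_upwards [eventually_ge_atTop 1] with n hn
    have hℓ : (0 : ℝ) < ℓ n := by exact_mod_cast (H.range_ℓ n hn).1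
    rw [← Nat.sub_add_cancel hp, pow_add, Nat.add_sub_cancel]
    field_simp

/-- The leading coefficient of the bias for the noise `ε_i + ε_{i-L}` when `ℓ - h = y`. -/
def boundaryCoeff (α β : ℝ) (p L : ℕ) (y : ℤ) : ℝ :=
  α * (L : ℝ) ^ p - β * (2 * ((max y 0 : ℤ) : ℝ) ^ p + ((max (y + L) 0 : ℤ) : ℝ) ^ p)

/-- For fixed `y` the coefficient behaves like `(α - β) L^p` as `L` grows, and only finitely many
`y` are involved. -/
lemma exists_boundaryCoeff_ne_zero {α β : ℝ} (hαβ : α ≠ β) {p : ℕ} (hp : 1 ≤ p) (R : ℕ) :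
    ∃ L : ℕ, R < L ∧ ∀ y ∈ Icc (-(R : ℤ)) R, boundaryCoeff α β p L y ≠ 0 := by
  have h1 : ∀ y ∈ Icc (-(R : ℤ)) R, ∀ᶠ L : ℕ in atTop, boundaryCoeff α β p L y ≠ 0 := by
    intro y _
    have hz : Tendsto (fun L : ℕ => ((max y 0 : ℤ) : ℝ) / L) atTop (𝓝 0) :=
      tendsto_natCast_atTop_atTop.const_div_atTop _
    have hw : Tendsto (fun L : ℕ => (y : ℝ) / L) atTop (𝓝 0) :=
      tendsto_natCast_atTop_atTop.const_div_atTop _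
    have hlim : Tendsto (fun L : ℕ => α - β * (2 * (((max y 0 : ℤ) : ℝ) / L) ^ p + ((y : ℝ) / L + 1) ^ p))
        atTop (𝓝 (α - β * (2 * 0 ^ p + (0 + 1) ^ p))) :=
      ((((hz.pow p).const_mul 2).add ((hw.add_const 1).pow p)).const_mul β).const_sub α
    rw [zero_pow (by omega), zero_add, mul_zero, zero_add, one_pow, mul_one] at hlim
    filter_upwards [hlim.eventually_ne (sub_ne_zero.2 hαβ), eventually_ge_atTop (y.natAbs + 1)] with L hL hL1
    have hL0 : (0 : ℝ) < L := by exact_mod_cast (show 0 < L by omega)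
    have e : boundaryCoeff α β p L y
        = (α - β * (2 * (((max y 0 : ℤ) : ℝ) / L) ^ p + ((y : ℝ) / L + 1) ^ p)) * (L : ℝ) ^ p := by
      rw [boundaryCoeff, max_eq_left (show (0 : ℤ) ≤ y + L by omega), sub_mul, mul_assoc, add_mul,
        mul_assoc, ← mul_pow, ← mul_pow, div_mul_cancel₀ _ hL0.ne', add_mul, div_mul_cancel₀ _ hL0.ne']
      push_cast; ring
    rw [e]
    exact mul_ne_zero hL (by positivity)
  have h2 := (eventually_all_finset _).2 h1
  obtain ⟨L, hL1, hL2⟩ := (h2.and (eventually_gt_atTop R)).exists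
  exact ⟨L, hL2, hL1⟩

/-- With `h = O(ℓ)` the correction is `O(ℓ/n)`, and `ℓ < bw` gives `ℓ^{p+2} ≤ ℓ^{1+2p} ≤ n`; this
uses `p ≥ 1`. -/
lemma tendsto_size_correction (hK : IsKernel K) (H : Admissible m ℓ h) (d : ℕ → ℝ) {p : ℕ} (hp : 1 ≤ p)
    {C : ℝ} (hh : ∀ᶠ n in atTop, (h n : ℝ) ≤ C * ℓ n) (x : ℤ) {ε : ℝ} (hε : 0 < ε) :
    ∀ᶠ n in atTop, (ℓ n : ℝ) < bw p n →
      |acvfWeight K m d n (ℓ n) (h n) x - rawWeight K m d (ℓ n) (h n) x| * (ℓ n : ℝ) ^ p ≤ ε := by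
  obtain ⟨A, hA⟩ := hK.bounded
  have hA0 : 0 ≤ A := (abs_nonneg _).trans (hA 0)
  set D : ℝ := (∑ j ∈ range (m + 1), ∑ j' ∈ range (m + 1), |d j * d j'|) * A
  have hD : 0 ≤ D := by positivity
  filter_upwards [hh, eventually_ge_atTop 1,
    H.tendsto_bandwidth.eventually_ge_atTop (D * (m * C + 1) / ε)] with n hn hn1 hℓε hlt
  have hℓ1 := (H.range_ℓ n hn1).1
  have hℓ : (0 : ℝ) < ℓ n := by exact_mod_cast hℓ1
  have hnpos : (0 : ℝ) < n := by exact_mod_cast hn1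
  have h1 := abs_acvfWeight_sub_rawWeight_le hK hA m d (h n) hℓ1 hn1 x
  have h2 : (ℓ n : ℝ) ^ (p + 2) ≤ n := by
    rw [← bw_pow p n]
    exact (pow_le_pow_right₀ (by exact_mod_cast hℓ1) (by omega)).trans
      (pow_le_pow_left₀ hℓ.le hlt.le (1 + 2 * p))
  have h3 : ((m : ℝ) * h n + ℓ n) / n * (ℓ n : ℝ) ^ p ≤ (m * C + 1) / ℓ n := by
    rw [div_mul_eq_mul_div, div_le_div_iff₀ hnpos hℓ]
    have h4 : (m : ℝ) * h n + ℓ n ≤ (m * C + 1) * ℓ n := by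
      have : (m : ℝ) * h n ≤ m * (C * ℓ n) := mul_le_mul_of_nonneg_left hn (by positivity)
      linarith
    have h5 : 0 ≤ (m * C + 1 : ℝ) := by
      by_contra hneg
      push Not at hneg
      have : 0 ≤ (m : ℝ) * h n + ℓ n := by positivity
      nlinarith
    calc ((m : ℝ) * h n + ℓ n) * (ℓ n : ℝ) ^ p * ℓ n
        ≤ (m * C + 1) * ℓ n * (ℓ n : ℝ) ^ p * ℓ n := by gcongr
      _ = (m * C + 1) * (ℓ n : ℝ) ^ (p + 2) := by ring
      _ ≤ _ := mul_le_mul_of_nonneg_left h2 h5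
  calc _ ≤ D * ((m * h n + ℓ n) / n) * (ℓ n : ℝ) ^ p := mul_le_mul_of_nonneg_right h1 (by positivity)
    _ = D * (((m : ℝ) * h n + ℓ n) / n * (ℓ n : ℝ) ^ p) := by ring
    _ ≤ D * ((m * C + 1) / ℓ n) := mul_le_mul_of_nonneg_left h3 hD
    _ ≤ ε := by
      rw [div_le_iff₀ hε] at hℓε
      rw [← mul_div_assoc, div_le_iff₀ hℓ]; linarith

end BiasLower

section NearBandwidth

variable {K : ℝ → ℝ} {m : ℕ} {d : ℕ → ℝ} {ℓ h : ℕ → ℕ}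

/-- Only shifts by `±h` can reach the support. At lag zero both do, while at lag `L` in
`rawWeight_sub_one` just `L - h` does, which explains the factor `2` here. -/
lemma IsDiffSeq.rawWeight_zero_sub_one (hd : IsDiffSeq m d) (hK : IsKernel K) (hm : 0 < m) {ℓ h : ℕ}
    (hℓ : 1 ≤ ℓ) (hh : ℓ ≤ 2 * h) {y : ℤ} (hy : (ℓ : ℤ) - h = y) :
    rawWeight K m d ℓ h 0 - 1 = 2 * (delta m d 1 * K (1 - (y : ℝ) / ℓ)) := by
  have hℓ0 : (0 : ℝ) < ℓ := by exact_mod_cast hℓ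
  rw [hd.rawWeight_eq, Int.cast_zero, zero_div, hK.zero, add_sub_cancel_left,
    sum_eq_single_of_mem 1 (mem_Icc.2 ⟨le_rfl, hm⟩)]
  · rw [zero_sub, zero_add, hK.even_int]
    have : (((1 : ℕ) : ℤ) * (h : ℤ) : ℤ) = (ℓ : ℤ) - y := by push_cast; linarith
    rw [this]
    push_cast
    rw [sub_div, div_self hℓ0.ne']; ring
  · intro s hs hs1
    have hs2 : (2 : ℤ) ≤ s := by have := (mem_Icc.1 hs).1; omega
    have h1 : (2 : ℤ) * h ≤ s * h := mul_le_mul_of_nonneg_right hs2 (by positivity)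
    rw [zero_sub, zero_add, hK.even_int, hK.support_int hℓ, add_zero, mul_zero]
    rw [abs_of_nonneg (by positivity)]
    have : (ℓ : ℤ) ≤ 2 * h := by exact_mod_cast hh
    linarith

lemma IsDiffSeq.rawWeight_sub_one (hd : IsDiffSeq m d) (hK : IsKernel K) (hm : 0 < m) {ℓ h L : ℕ}
    (hℓ : 1 ≤ ℓ) (hh : ℓ + L ≤ 2 * h) (hL : ℓ ≤ h + L) {y : ℤ} (hy : (ℓ : ℤ) - h = y) :
    rawWeight K m d ℓ h L - 1 = (K ((L : ℝ) / ℓ) - 1) + delta m d 1 * K (1 - ((y + L : ℤ) : ℝ) / ℓ) := by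
  have hℓ0 : (0 : ℝ) < ℓ := by exact_mod_cast hℓ
  rw [hd.rawWeight_eq, sum_eq_single_of_mem 1 (mem_Icc.2 ⟨le_rfl, hm⟩)]
  · have e1 : ((L : ℤ) - ((1 : ℕ) : ℤ) * (h : ℤ) : ℤ) = -((ℓ : ℤ) - (y + L)) := by push_cast; linarith
    rw [e1, hK.even_int, hK.support_int hℓ (k := (L : ℤ) + ((1 : ℕ) : ℤ) * h) (by
      rw [abs_of_nonneg (by positivity)]; push_cast; linarith)]
    push_cast
    rw [sub_div (ℓ : ℝ), div_self hℓ0.ne']; ring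
  · intro s hs hs1
    have hs2 : (2 : ℤ) ≤ s := by have := (mem_Icc.1 hs).1; omega
    have h1 : (2 : ℤ) * h ≤ s * h := mul_le_mul_of_nonneg_right hs2 (by positivity)
    have h2 : (ℓ : ℤ) + L ≤ 2 * h := by exact_mod_cast hh
    rw [hK.support_int hℓ, hK.support_int hℓ, add_zero, mul_zero]
    · rw [abs_of_nonneg (by positivity)]; linarith
    · rw [abs_of_nonpos (by linarith)]; linarith

lemma lag_le_of_abs_sub_le (H : Admissible m ℓ h) {R : ℕ} (hR : ∀ᶠ n in atTop, |(h n : ℝ) - ℓ n| ≤ R) :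
    ∀ᶠ n in atTop, (h n : ℝ) ≤ 2 * ℓ n := by
  filter_upwards [hR, H.tendsto_bandwidth.eventually_ge_atTop (R : ℝ)] with n hn hn2
  linarith [(abs_le.1 hn).2]

/-- The noise is `ε_i + ε_{i-L}` with `L` so large that the leading bias coefficient is nonzero for
every value of `ℓ - h`. That difference takes finitely many integer values, so the coefficient is
bounded away from zero. -/
theorem mseLowerBound_of_nearBoundary (hK : IsKernel K) {q : ℕ} {B : ℝ} (hq : NearOrigin K q B)
    (hd : IsDiffSeq m d) (hm : 0 < m) (H : Admissible m ℓ h) {q' : ℕ} {B' : ℝ}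
    (hq' : NearBoundary K q' B') {R : ℕ} (hR : ∀ᶠ n in atTop, |(h n : ℝ) - ℓ n| ≤ R)
    (hδ : q' < q → delta m d 1 ≠ 0) (hB : q = q' → B ≠ delta m d 1 * B') :
    MSELowerBound K m d ℓ h q (rate (min q q')) := by
  set p := min q q' with hp
  have hp1 : 1 ≤ p := le_min hq.pos hq'.pos
  set α : ℝ := if q = p then B else 0 with hα
  set β : ℝ := if q' = p then delta m d 1 * B' else 0 with hβ
  have hαβ : α ≠ β := by
    rcases lt_trichotomy q q' with h1 | h1 | h1
    · rw [hα, hβ, if_pos (by omega), if_neg (by omega)]; exact hq.ne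
    · rw [hα, hβ, if_pos (by omega), if_pos (by omega)]; exact hB h1
    · rw [hα, hβ, if_neg (by omega), if_pos (by omega)]
      exact (mul_ne_zero (hδ h1) hq'.ne).symm
  obtain ⟨L, hRL, hL⟩ := exists_boundaryCoeff_ne_zero hαβ hp1 R
  obtain ⟨y₀, hy₀, hmin⟩ := exists_min_image (Icc (-(R : ℤ)) R) (fun y => |boundaryCoeff α β p L y|)
    ⟨0, by simp⟩
  set c := |boundaryCoeff α β p L y₀| with hc
  have hc0 : 0 < c := abs_pos.2 (hL y₀ hy₀)
  refine mseLowerBound_of_bias hK hq hd H ((offDiag_of_nearBoundary hK H hq' hR).mono hK H hq'.pos)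
    (σ := 1) (β := 1) (L := L) (by norm_num) ⟨c / 2, by positivity, ?_⟩
  -- The noise bias, without sample-size corrections, times `ℓ^p` when `ℓ - h = y`.
  let F : ℤ → ℕ → ℝ := fun y n => (2 * (K ((L : ℝ) / ℓ n) - 1) + 2 * (delta m d 1 *
    (2 * K (1 - (y : ℝ) / ℓ n) + K (1 - ((y + L : ℤ) : ℝ) / ℓ n)))) * (ℓ n : ℝ) ^ p
  have hF : ∀ y, Tendsto (F y) atTop (𝓝 (2 * boundaryCoeff α β p L y)) := by
    intro y
    have h1 := tendsto_mul_pow_of_le H (min_le_left q q') (hq.tendsto_mul_pow hK H (x := L) (by omega))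
    have h2 := tendsto_mul_pow_of_le H (min_le_right q q') (hq'.tendsto_mul_pow hK H y)
    have h3 := tendsto_mul_pow_of_le H (min_le_right q q') (hq'.tendsto_mul_pow hK H (y + L))
    have h4 := (h1.const_mul 2).add ((((h2.const_mul 2).add h3).const_mul (delta m d 1)).const_mul 2)
    have e : 2 * boundaryCoeff α β p L y = 2 * (if q = p then B * (L : ℝ) ^ q else 0) +
        2 * (delta m d 1 * (2 * (if q' = p then -B' * ((max y 0 : ℤ) : ℝ) ^ q' else 0)
          + if q' = p then -B' * ((max (y + L) 0 : ℤ) : ℝ) ^ q' else 0)) := by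
      rw [boundaryCoeff, hα, hβ]
      split_ifs with i1 i2 i2
      · simp only [i1, i2]; ring
      · simp only [i1]; ring
      · simp only [i2]; ring
      · ring
    rw [e]
    refine h4.congr fun n => ?_
    simp only [F]; ring
  have hFev : ∀ᶠ n in atTop, ∀ y ∈ Icc (-(R : ℤ)) R, c < |F y n| :=
    (eventually_all_finset _).2 fun y hy => by
      refine (hF y).abs.eventually_const_lt ?_
      rw [abs_mul, abs_two]
      linarith [hmin y hy]
  have hlag := lag_le_of_abs_sub_le H hR
  filter_upwards [hFev, hR, eventually_ge_atTop 1,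
    H.tendsto_bandwidth.eventually_ge_atTop (2 * R + L : ℝ),
    tendsto_size_correction hK H d hp1 hlag 0 (show 0 < c / 8 by positivity),
    tendsto_size_correction hK H d hp1 hlag L (show 0 < c / 8 by positivity)]
    with n hFn hRn hn1 hℓn h0 hLn hlt
  specialize h0 hlt
  specialize hLn hlt
  have hℓ1 := (H.range_ℓ n hn1).1
  have hℓ : (0 : ℝ) < ℓ n := by exact_mod_cast hℓ1
  set y : ℤ := (ℓ n : ℤ) - h n with hy
  have hyR : -(R : ℤ) ≤ y ∧ y ≤ R := by
    have h1 := abs_le.1 hRn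
    have h2 : (-(R : ℝ)) ≤ (h n : ℝ) - ℓ n := h1.1
    have h3 : (h n : ℝ) - ℓ n ≤ R := h1.2
    have h2' : (-(R : ℤ)) ≤ (h n : ℤ) - ℓ n := by exact_mod_cast h2
    have h3' : (h n : ℤ) - ℓ n ≤ R := by exact_mod_cast h3
    constructor <;> omega
  have hℓ2 : 2 * R + L ≤ ℓ n := by exact_mod_cast hℓn
  have hFy := hFn y (mem_Icc.2 hyR)
  rw [twoTapNoise_bias hK]
  set u := acvfWeight K m d n (ℓ n) (h n) 0
  set w := acvfWeight K m d n (ℓ n) (h n) L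
  have e0 := hd.rawWeight_zero_sub_one hK hm hℓ1 (by omega) hy.symm
  have eL := hd.rawWeight_sub_one hK hm (L := L) hℓ1 (by omega) (by omega) hy.symm
  have hpow : (0 : ℝ) < (ℓ n : ℝ) ^ p := by positivity
  rw [one_div, inv_pow, ← div_eq_mul_inv, div_le_iff₀ hpow]
  have e1 : ((1 ^ 2 + 1 ^ 2) * (u - 1) + 2 * 1 * 1 * (w - 1)) * (ℓ n : ℝ) ^ p
      = F y n + 2 * ((u - rawWeight K m d (ℓ n) (h n) 0) * (ℓ n : ℝ) ^ p)
        + 2 * ((w - rawWeight K m d (ℓ n) (h n) L) * (ℓ n : ℝ) ^ p) := by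
    have : F y n = (2 * (rawWeight K m d (ℓ n) (h n) 0 - 1) +
        2 * (rawWeight K m d (ℓ n) (h n) L - 1)) * (ℓ n : ℝ) ^ p := by
      rw [e0, eL]; simp only [F]; ring
    rw [this]; ring
  rw [← abs_of_pos hpow, ← abs_mul, e1]
  rw [← abs_of_pos hpow, ← abs_mul] at h0 hLn
  set s := (u - rawWeight K m d (ℓ n) (h n) 0) * (ℓ n : ℝ) ^ p
  set t := (w - rawWeight K m d (ℓ n) (h n) L) * (ℓ n : ℝ) ^ p
  have h0' := abs_le.1 h0
  have hLn' := abs_le.1 hLn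
  rcases abs_cases (F y n) with ⟨h1, _⟩ | ⟨h1, _⟩
  · exact le_trans (by linarith) (le_abs_self _)
  · exact le_trans (by linarith) (neg_le_abs _)

end NearBandwidth

/-! ### Uniform boundedness of the weights -/

section UniformBoundedness

lemma summable_mul_of_bounded {β w : ℕ → ℝ} {C : ℝ} (hβ : ∀ k, |β k| ≤ C) (hw : Summable fun k => |w k|) :
    Summable fun k => β k * w k :=
  Summable.of_norm_bounded (hw.mul_left C) fun k => by
    rw [Real.norm_eq_abs, abs_mul]
    exact mul_le_mul_of_nonneg_right (hβ k) (abs_nonneg _)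

lemma summable_abs_lp (w : lp (fun _ : ℕ => ℝ) 1) : Summable fun k => |w k| := by
  simpa using (memℓp_gen_iff (p := 1) (by simp)).1 (lp.memℓp w)

lemma norm_lp_one (w : lp (fun _ : ℕ => ℝ) 1) : ‖w‖ = ∑' k, |w k| := by
  simpa using lp.norm_eq_tsum_rpow (p := 1) (by simp) w

/-- The functional on `ℓ¹` defined by a bounded sequence. -/
def pairing (β : ℕ → ℝ) {C : ℝ} (hβ : ∀ k, |β k| ≤ C) : lp (fun _ : ℕ => ℝ) 1 →L[ℝ] ℝ :=
  LinearMap.mkContinuous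
    { toFun := fun w => ∑' k, β k * w k
      map_add' := fun v w => by
        rw [← (summable_mul_of_bounded hβ (summable_abs_lp v)).tsum_add
          (summable_mul_of_bounded hβ (summable_abs_lp w))]
        exact tsum_congr fun k => by simp [mul_add]
      map_smul' := fun c w => by
        rw [RingHom.id_apply, smul_eq_mul, ← tsum_mul_left]
        exact tsum_congr fun k => by simp; ring } C fun w => by
    rw [norm_lp_one, ← tsum_mul_left]
    refine tsum_of_norm_bounded ((summable_abs_lp w).mul_left C).hasSum fun k => ?_
    rw [Real.norm_eq_abs, abs_mul]
    exact mul_le_mul_of_nonneg_right (hβ k) (abs_nonneg _)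

/-- Banach–Steinhaus on `ℓ¹`: pointwise bounded functionals are uniformly bounded, and unit vectors
return the individual coefficients. -/
lemma exists_uniform_bound {β : ℕ → ℕ → ℝ} (hβ : ∀ n, ∃ C, ∀ k, |β n k| ≤ C)
    (hpt : ∀ w : ℕ → ℝ, (Summable fun k => |w k|) → ∃ C, ∀ n, |∑' k, β n k * w k| ≤ C) :
    ∃ C, ∀ n k, |β n k| ≤ C := by
  choose C hC using hβ
  obtain ⟨C', hC'⟩ := banach_steinhaus (g := fun n => pairing (β n) (hC n)) fun w =>
    hpt w (summable_abs_lp w)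
  refine ⟨C', fun n k => ?_⟩
  have h1 := (pairing (β n) (hC n)).le_opNorm (lp.single 1 k (1 : ℝ))
  have h2 : pairing (β n) (hC n) (lp.single 1 k (1 : ℝ)) = β n k := by
    change ∑' i, β n i * (lp.single 1 k (1 : ℝ) : ℕ → ℝ) i = β n k
    rw [tsum_eq_single k]
    · simp
    · intro i hi; simp [hi]
  rw [h2, lp.norm_single (by simp), norm_one, mul_one] at h1
  exact h1.trans (hC' n)

end UniformBoundedness

/-! ### The bias as a linear functional of a perturbation of the filter -/

section Perturbation

variable {K : ℝ → ℝ} {m : ℕ} {d : ℕ → ℝ}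

lemma acvfWeight_eq_zero (hK : IsKernel K) (d : ℕ → ℝ) {n ℓ h : ℕ} (hℓ : 1 ≤ ℓ) {x : ℤ}
    (hx : (m : ℤ) * h + ℓ ≤ |x|) : acvfWeight K m d n ℓ h x = 0 := by
  refine sum_eq_zero fun j hj => sum_eq_zero fun j' hj' => ?_
  rw [wKernel_zero hK hℓ, mul_zero]
  have hj1 : (j : ℤ) ≤ m := by exact_mod_cast Nat.lt_succ_iff.1 (mem_range.1 hj)
  have hj1' : (j' : ℤ) ≤ m := by exact_mod_cast Nat.lt_succ_iff.1 (mem_range.1 hj')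
  have h1 : |((j : ℤ) - j') * h| ≤ m * h := by
    rw [abs_mul, Nat.abs_cast]
    refine mul_le_mul_of_nonneg_right ?_ (by positivity)
    rw [abs_le]; constructor <;> omega
  have h2 := abs_sub_abs_le_abs_sub x (((j : ℤ) - j') * h)
  linarith

lemma exists_acvfWeight_bound (hK : IsKernel K) (d : ℕ → ℝ) (n : ℕ) {ℓ : ℕ} (h : ℕ) (hℓ : 1 ≤ ℓ) :
    ∃ C, ∀ x : ℤ, |acvfWeight K m d n ℓ h x - 1| ≤ C := by
  refine ⟨(∑ x ∈ Icc (-((m : ℤ) * h + ℓ)) (m * h + ℓ), |acvfWeight K m d n ℓ h x|) + 1, fun x => ?_⟩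
  refine (abs_sub _ _).trans (add_le_add ?_ (by simp))
  by_cases hx : x ∈ Icc (-((m : ℤ) * h + ℓ)) (m * h + ℓ)
  · exact single_le_sum (f := fun x => |acvfWeight K m d n ℓ h x|) (fun _ _ => abs_nonneg _) hx
  · rw [acvfWeight_eq_zero hK d hℓ, abs_zero]
    · exact sum_nonneg fun _ _ => abs_nonneg _
    · by_contra hlt
      push Not at hlt
      exact hx (mem_Icc.2 ⟨by linarith [(abs_lt.1 hlt).1], by linarith [(abs_lt.1 hlt).2]⟩)

/-- The unit filter, perturbed by `b`. -/
def perturb (b : ℕ → ℝ) (j : ℕ) : ℝ := (if j = 0 then 1 else 0) + b j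

lemma summable_abs_perturb {b : ℕ → ℝ} (hb : Summable fun j => |b j|) :
    Summable fun j => |perturb b j| := by
  have h1 : Summable fun j : ℕ => |if j = 0 then (1 : ℝ) else 0| :=
    summable_of_ne_finset_zero (s := {0}) fun j hj => by
      rw [if_neg (by simpa using hj), abs_zero]
  exact Summable.of_nonneg_of_le (fun _ => abs_nonneg _) (fun j => abs_add_le _ _) (h1.add hb)

lemma summable_pow_mul_perturb {b : ℕ → ℝ} {q : ℕ} (hb : Summable fun j : ℕ => (j : ℝ) ^ q * |b j|) :
    Summable fun j : ℕ => (j : ℝ) ^ q * |perturb b j| := by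
  have h1 : Summable fun j : ℕ => (j : ℝ) ^ q * |if j = 0 then (1 : ℝ) else 0| :=
    summable_of_ne_finset_zero (s := {0}) fun j hj => by
      rw [if_neg (by simpa using hj), abs_zero, mul_zero]
  refine Summable.of_nonneg_of_le (fun _ => by positivity) (fun j => ?_) (h1.add hb)
  rw [← mul_add]
  exact mul_le_mul_of_nonneg_left (abs_add_le _ _) (by positivity)

lemma zext_perturb (b : ℕ → ℝ) (z : ℤ) : zext (perturb b) z = (if z = 0 then 1 else 0) + zext b z := by
  unfold zext perturb
  split_ifs <;> first | rfl | omega | simp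

lemma summable_mul_zext {a b : ℕ → ℝ} (ha : Summable fun j => |a j|) (hb : Summable fun j => |b j|)
    (x : ℤ) : Summable fun j : ℕ => a j * zext b (x + j) := by
  have h1 : ∀ j : ℕ, |zext b (x + j)| ≤ ∑' j, |b j| := fun j => by
    rw [zext]
    split_ifs
    · exact hb.le_tsum _ fun _ _ => abs_nonneg _
    · rw [abs_zero]; exact tsum_nonneg fun _ => abs_nonneg _
  exact (summable_mul_of_bounded h1 ha).congr fun j => mul_comm _ _

/-- Comparing the filters `1 + b` and `1 - b` cancels the part quadratic in `b`. -/
lemma acvf_perturb_sub {b : ℕ → ℝ} (hb : Summable fun j => |b j|)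
    (hb' : Summable fun j => |(-b) j|) (x : ℤ) :
    (linNoise (perturb b) (summable_abs_perturb hb)).acvf x
      - (linNoise (perturb (-b)) (summable_abs_perturb hb')).acvf x = 2 * (zext b x + zext b (-x)) := by
  rw [linNoise_acvf, linNoise_acvf, ← (summable_mul_zext (summable_abs_perturb hb)
    (summable_abs_perturb hb) x).tsum_sub (summable_mul_zext (summable_abs_perturb hb')
    (summable_abs_perturb hb') x)]
  have hneg : ∀ z, zext (-b) z = -zext b z := fun z => by
    unfold zext; split_ifs <;> simp
  have h1 : HasSum (fun j : ℕ => (if j = 0 then (1 : ℝ) else 0) * zext b (x + j)) (zext b x) := by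
    have := hasSum_single (f := fun j : ℕ => (if j = 0 then (1 : ℝ) else 0) * zext b (x + j)) 0
      fun j hj => by rw [if_neg hj, zero_mul]
    simpa using this
  have h2 : HasSum (fun j : ℕ => b j * (if -x - (j : ℤ) = 0 then (1 : ℝ) else 0)) (zext b (-x)) := by
    have hs : Summable fun j : ℕ => b j * (if -x - (j : ℤ) = 0 then (1 : ℝ) else 0) :=
      Summable.of_norm_bounded hb fun l => by split_ifs <;> simp
    have := hs.hasSum
    rwa [tsum_mul_ite_eq, sub_zero] at this
  rw [← ((h1.add h2).mul_left 2).tsum_eq]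
  refine tsum_congr fun j => ?_
  simp only [zext_perturb, hneg, perturb, Pi.neg_apply]
  have : (-x - (j : ℤ) = 0) ↔ (x + (j : ℤ) = 0) := by omega
  simp only [this]
  ring

/-- The difference of the two biases is linear in `b`, as the uniform boundedness principle
requires. -/
lemma bias_perturb_sub (hK : IsKernel K) (d : ℕ → ℝ) (n : ℕ) {ℓ : ℕ} (h : ℕ) (hℓ : 1 ≤ ℓ) {b : ℕ → ℝ}
    (hb : Summable fun j => |b j|) (hb' : Summable fun j => |(-b) j|)
    (hγ : Summable (linNoise (perturb b) (summable_abs_perturb hb)).acvf)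
    (hγ' : Summable (linNoise (perturb (-b)) (summable_abs_perturb hb')).acvf) :
    (linNoise (perturb b) (summable_abs_perturb hb)).bias K m d n ℓ h
      - (linNoise (perturb (-b)) (summable_abs_perturb hb')).bias K m d n ℓ h
      = 4 * ∑' k : ℕ, b k * (acvfWeight K m d n ℓ h k - 1) := by
  obtain ⟨C, hC⟩ := exists_acvfWeight_bound hK d n h hℓ (m := m)
  have hs : ∀ γ : ℤ → ℝ, Summable γ → Summable fun x => γ x * (acvfWeight K m d n ℓ h x - 1) :=
    fun γ hγ => Summable.of_norm_bounded (hγ.abs.mul_right C) fun x => by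
      rw [Real.norm_eq_abs, abs_mul]
      exact mul_le_mul_of_nonneg_left (hC x) (abs_nonneg _)
  have hz : Summable (zext b) := summable_zext (Summable.of_norm hb)
  have h1 := (hs _ hz).hasSum
  have h2 := (Equiv.neg ℤ).hasSum_iff.2 h1
  have h3 := (h1.add h2).mul_left 2
  rw [NoiseModel.bias, NoiseModel.bias, ← (hs _ hγ).tsum_sub (hs _ hγ')]
  have h4 : ∑' x, zext b x * (acvfWeight K m d n ℓ h x - 1)
      = ∑' k : ℕ, b k * (acvfWeight K m d n ℓ h k - 1) := by
    rw [← (Nat.cast_injective (R := ℤ)).tsum_eq]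
    · exact tsum_congr fun k => by rw [zext_natCast]
    · intro z hz
      by_contra hr
      refine hz ?_
      change zext b z * _ = 0
      rw [zext, if_neg, zero_mul]
      exact fun h0 => hr ⟨z.toNat, Int.toNat_of_nonneg h0⟩
  rw [← h4]
  refine (HasSum.tsum_eq ?_).trans (show 2 * (_ + _) = _ by ring)
  refine h3.congr_fun fun x => ?_
  rw [← sub_mul, acvf_perturb_sub hb hb']
  simp only [Function.comp, Equiv.neg_apply, acvfWeight_neg hK]
  ring

end Perturbation

/-! ### Necessary conditions on the weights and the bandwidth -/

section Necessary

variable {K : ℝ → ℝ} {m : ℕ} {d : ℕ → ℝ} {ℓ h : ℕ → ℕ}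

lemma isBigO_bias (hK : IsKernel K) (H : Admissible m ℓ h) {G : DGM.{u}} {q : ℕ} (hG : G.InClass q)
    {r : ℕ → ℝ} (hr : ∀ n, 1 ≤ n → 0 < r n) (hO : G.mse K m d ℓ h =O[atTop] r) :
    G.bias K m d ℓ h =O[atTop] fun n => √(r n) := by
  obtain ⟨C, hC0, hC⟩ := hO.exists_pos
  refine IsBigO.of_bound (√C) ?_
  filter_upwards [hC.bound, H.eventually_le, eventually_ge_atTop 1] with n hn hn2 hn1
  have h1 := DGM.sq_bias_le_mse (G := G) (d := d) hG.weak (summable_of_finiteU hG.finite_u) hK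
    (H.range_ℓ n hn1).1 hn2
  rw [Real.norm_of_nonneg (G.mse_nonneg ..), Real.norm_of_nonneg (hr n hn1).le] at hn
  rw [Real.norm_eq_abs, Real.norm_of_nonneg (Real.sqrt_nonneg _), ← Real.sqrt_mul hC0.le,
    ← Real.sqrt_sq_eq_abs]
  exact Real.sqrt_le_sqrt (h1.trans hn)

/-- If the MSE is `O(r_n)` throughout the class, then the weights of the autocovariances differ from
one by `O(k^q √r_n)`, uniformly in the lag `k`. -/
theorem exists_acvfWeight_le_of_mseBigO (hK : IsKernel K) (H : Admissible m ℓ h) {q : ℕ} {r : ℕ → ℝ}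
    (hr : ∀ n, 1 ≤ n → 0 < r n) (hO : MSEBigO.{0} K m d ℓ h q r) :
    ∃ C : ℝ, ∀ n, 1 ≤ n → ∀ k : ℕ, 1 ≤ k →
      |acvfWeight K m d n (ℓ n) (h n) k - 1| ≤ C * ((k : ℝ) ^ q * √(r n)) := by
  let β : ℕ → ℕ → ℝ := fun n k => if 1 ≤ n ∧ 1 ≤ k then
    (acvfWeight K m d n (ℓ n) (h n) k - 1) / ((k : ℝ) ^ q * √(r n)) else 0
  have hβ : ∀ n, ∃ C, ∀ k, |β n k| ≤ C := by
    intro n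
    by_cases hn : 1 ≤ n
    · obtain ⟨C, hC⟩ := exists_acvfWeight_bound hK d n (h n) (H.range_ℓ n hn).1 (m := m)
      have hC0 : 0 ≤ C := (abs_nonneg _).trans (hC 0)
      have hs : 0 < √(r n) := Real.sqrt_pos.2 (hr n hn)
      refine ⟨C / √(r n), fun k => ?_⟩
      simp only [β]
      split_ifs with hk
      · have hk1 : (1 : ℝ) ≤ (k : ℝ) ^ q := one_le_pow₀ (by exact_mod_cast hk.2)
        rw [abs_div, abs_of_pos (by positivity : 0 < (k : ℝ) ^ q * √(r n))]
        exact div_le_div₀ hC0 (hC k) hs (le_mul_of_one_le_left hs.le hk1)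
      · rw [abs_zero]; positivity
    · exact ⟨0, fun k => by simp [β, hn]⟩
  obtain ⟨C, hC⟩ := exists_uniform_bound hβ fun w hw => by
    refine (isBigO_one_nat_atTop_iff (f := fun n => ∑' k, β n k * w k)).1 ?_
    -- Dividing an arbitrary absolutely summable `w` by `k^q` gives a perturbation that stays in the
    -- class; the same mean is used for both signs, so its part of the bias cancels.
    let b : ℕ → ℝ := fun k => if k = 0 then 0 else w k / (k : ℝ) ^ q
    have hb0 : ∀ k : ℕ, (k : ℝ) ^ q * |b k| ≤ |w k| ∧ |b k| ≤ |w k| := by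
      intro k
      simp only [b]
      split_ifs with hk
      · simp
      · have hk1 : (1 : ℝ) ≤ (k : ℝ) ^ q := one_le_pow₀ (by exact_mod_cast Nat.one_le_iff_ne_zero.2 hk)
        have hk0 : (0 : ℝ) < (k : ℝ) ^ q := by linarith
        rw [abs_div, abs_of_pos hk0]
        exact ⟨by rw [mul_div_cancel₀ _ hk0.ne'], div_le_self (abs_nonneg _) hk1⟩
    have hb : Summable fun j => |b j| :=
      Summable.of_nonneg_of_le (fun _ => abs_nonneg _) (fun k => (hb0 k).2) hw
    have hbq : Summable fun j : ℕ => (j : ℝ) ^ q * |b j| :=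
      Summable.of_nonneg_of_le (fun _ => by positivity) (fun k => (hb0 k).1) hw
    have hb' : Summable fun j => |(-b) j| := by simpa using hb
    have hbq' : Summable fun j : ℕ => (j : ℝ) ^ q * |(-b) j| := by simpa using hbq
    have hU := linNoise_finiteU (summable_abs_perturb hb) (summable_pow_mul_perturb hbq)
    have hU' := linNoise_finiteU (summable_abs_perturb hb') (summable_pow_mul_perturb hbq')
    have hG1 := inClass_stdMean (κ := 1) (by norm_num) (linNoise_weaklyDependent _) hU
    have hG2 := inClass_stdMean (κ := 1) (by norm_num) (linNoise_weaklyDependent _) hU'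
    have h1 := ((isBigO_bias hK H hG1 hr (hO _ hG1)).sub (isBigO_bias hK H hG2 hr (hO _ hG2)))
    have h2 := (h1.const_mul_left (1 / 4)).mul (isBigO_refl (fun n => (√(r n))⁻¹) atTop)
    refine IsBigO.trans (EventuallyEq.isBigO ?_) (h2.trans (EventuallyEq.isBigO ?_))
    · filter_upwards [eventually_ge_atTop 1] with n hn
      have h3 := bias_perturb_sub hK d n (h n) (H.range_ℓ n hn).1 hb hb' (summable_of_finiteU hU)
        (summable_of_finiteU hU') (m := m)
      simp only [DGM.bias, add_sub_add_right_eq_sub]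
      rw [h3, ← mul_assoc, one_div, inv_mul_cancel₀ (by norm_num), one_mul, ← tsum_mul_right]
      refine tsum_congr fun k => ?_
      by_cases hk : k = 0
      · simp [β, b, hk]
      · have : 1 ≤ n ∧ 1 ≤ k := ⟨hn, Nat.one_le_iff_ne_zero.2 hk⟩
        simp only [β, b, if_pos this, if_neg hk]
        rw [div_eq_mul_inv, mul_inv]; ring
    · filter_upwards [eventually_ge_atTop 1] with n hn
      exact mul_inv_cancel₀ (Real.sqrt_pos.2 (hr n hn)).ne'
  refine ⟨C, fun n hn k hk => ?_⟩
  have h1 := hC n k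
  have hpos : 0 < (k : ℝ) ^ q * √(r n) := by
    have : (0 : ℝ) < k := by exact_mod_cast hk
    have := Real.sqrt_pos.2 (hr n hn)
    positivity
  simp only [β, if_pos (And.intro hn hk)] at h1
  rwa [abs_div, abs_of_pos hpos, div_le_iff₀ hpos] at h1

lemma sqrt_rate (q : ℕ) {n : ℕ} (hn : 1 ≤ n) : √(rate q n) = (1 / bw q n) ^ q := by
  have := bw_pos q hn
  rw [rate_eq_sq q hn, Real.sqrt_sq (by positivity)]

/-- If the MSE is `O(n^{-2q/(1+2q)})` throughout the class and the weights vanish at a lag of the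
order of `ℓ`, then `ℓ` is at least of the order of `n^{1/(1+2q)}`. -/
lemma isBigO_bandwidth_of_acvfWeight_eq_zero (hK : IsKernel K) (H : Admissible m ℓ h) {q : ℕ}
    (hq : 1 ≤ q) (hO : MSEBigO.{0} K m d ℓ h q (rate q)) {k : ℕ → ℕ} {c : ℝ}
    (hk : ∀ᶠ n in atTop, (k n : ℝ) ≤ c * ℓ n) (hk1 : ∀ᶠ n in atTop, 1 ≤ k n)
    (hz : ∀ᶠ n in atTop, acvfWeight K m d n (ℓ n) (h n) (k n) = 0) :
    bw q =O[atTop] fun n => (ℓ n : ℝ) := by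
  obtain ⟨C, hC⟩ := exists_acvfWeight_le_of_mseBigO hK H (fun n hn => rate_pos q hn) hO
  have hpow : (fun n => bw q n ^ q) =O[atTop] fun n => (ℓ n : ℝ) ^ q := by
    refine IsBigO.of_bound (|C| * c ^ q) ?_
    filter_upwards [hk, hk1, hz, eventually_ge_atTop 1] with n hkn hk1n hzn hn
    -- A vanishing weight turns the uniform bound into `1 ≤ C k^q bw^{-q}`.
    have h1 := hC n hn (k n) hk1n
    have hb := bw_pos q hn
    rw [hzn, zero_sub, abs_neg, abs_one, sqrt_rate q hn, one_div, inv_pow, ← div_eq_mul_inv,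
      ← mul_div_assoc, le_div_iff₀ (by positivity), one_mul] at h1
    rw [Real.norm_of_nonneg (by positivity), Real.norm_of_nonneg (by positivity), mul_assoc, ← mul_pow]
    refine h1.trans (mul_le_mul (le_abs_self C) (pow_le_pow_left₀ (by positivity) hkn q)
      (by positivity) (abs_nonneg _))
  exact hpow.of_pow (by omega)

/-- No bias computation is needed: if the MSE were of smaller order for every mechanism, then `ℓ`
would be at least of order `bw`, and the variance `ℓ/n` would already be of the order of the rate.
-/
theorem notSmaller_rate (hK : IsKernel K) {q : ℕ} {B : ℝ} (hq : NearOrigin K q B)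
    (hd : IsDiffSeq m d) (H : Admissible m ℓ h) (hoff : OffDiag K ℓ h 1)
    (hh : ∀ᶠ n in atTop, (h n : ℝ) ≤ 2 * ℓ n) : NotSmaller K m d ℓ h q (rate q) := by
  by_contra hcon
  simp only [NotSmaller, not_exists, not_and, not_not] at hcon
  have hbw : bw q =O[atTop] fun n => (ℓ n : ℝ) := by
    refine isBigO_bandwidth_of_acvfWeight_eq_zero hK H hq.pos (fun G hG => (hcon G hG).isBigO) (d := d)
      (k := fun n => m * h n + ℓ n) (c := 2 * m + 1) ?_ ?_ ?_
    · filter_upwards [hh] with n hn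
      have := mul_le_mul_of_nonneg_left hn (Nat.cast_nonneg (α := ℝ) m)
      push_cast; linarith
    · filter_upwards [eventually_ge_atTop 1] with n hn
      have := (H.range_ℓ n hn).1
      omega
    · filter_upwards [eventually_ge_atTop 1] with n hn
      refine acvfWeight_eq_zero hK d (H.range_ℓ n hn).1 ?_
      rw [Nat.abs_cast]; push_cast; rfl
  let G : DGM.{0} := ⟨whiteNoise 1, stdMean 1 (by norm_num)⟩
  have hG : G.InClass q :=
    inClass_stdMean _ (twoTapNoise_weaklyDependent _ _ _) (twoTapNoise_finiteU _ _ _ q)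
  have h1 : rate q =O[atTop] G.mse K m d ℓ h := isBigO_rate_of_bandwidth hbw
    (isBigO_mse_of_variance hK hq hd H hoff (by norm_num) 0 _)
  have h2 := h1.trans_isLittleO (hcon G hG)
  refine isLittleO_irrefl ?_ h2
  exact ((eventually_ge_atTop 1).mono fun n hn => (rate_pos q hn).ne').frequently

lemma notSmaller_of_mseLowerBound {q p : ℕ} (hlow : MSELowerBound K m d ℓ h q (rate p)) :
    NotSmaller K m d ℓ h q (rate p) := by
  obtain ⟨G, hG, hO⟩ := hlow
  refine ⟨G, hG, fun ho => isLittleO_irrefl ?_ (hO.trans_isLittleO ho)⟩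
  exact ((eventually_ge_atTop 1).mono fun n hn => (rate_pos p hn).ne').frequently

end Necessary

/-! ### Riemann sums of the kernel -/

section Riemann

variable {K : ℝ → ℝ}

lemma tendsto_floor_mul_div (t : ℝ) :
    Tendsto (fun L : ℕ => ((⌊(L : ℝ) * t⌋ : ℤ) : ℝ) / L) atTop (𝓝 t) := by
  have h1 : Tendsto (fun L : ℕ => t - 1 / (L : ℝ)) atTop (𝓝 t) := by
    simpa using (tendsto_one_div_atTop_nhds_zero_nat (𝕜 := ℝ)).const_sub t
  refine tendsto_of_tendsto_of_tendsto_of_le_of_le' h1 tendsto_const_nhds ?_ ?_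
  · filter_upwards [eventually_ge_atTop 1] with L hL
    have hL0 : (0 : ℝ) < L := by exact_mod_cast hL
    rw [le_div_iff₀ hL0, sub_mul, one_div, inv_mul_cancel₀ hL0.ne']
    have := Int.lt_floor_add_one ((L : ℝ) * t)
    linarith
  · filter_upwards [eventually_ge_atTop 1] with L hL
    have hL0 : (0 : ℝ) < L := by exact_mod_cast hL
    rw [div_le_iff₀ hL0]
    have := Int.floor_le ((L : ℝ) * t)
    linarith

lemma integral_kernel_floor (hK : IsKernel K) {L : ℕ} (hL : 1 ≤ L) :
    ∫ t : ℝ, K (((⌊(L : ℝ) * t⌋ : ℤ) : ℝ) / L)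
      = 1 / L * ∑ k ∈ Ioo (-(L : ℤ)) L, K ((k : ℝ) / L) := by
  have hL0 : (0 : ℝ) < L := by exact_mod_cast hL
  have h1 : ∀ t : ℝ, K (((⌊(L : ℝ) * t⌋ : ℤ) : ℝ) / L) = ∑ k ∈ Ioo (-(L : ℤ)) L,
      Set.indicator (Set.Ico ((k : ℝ) / L) (((k : ℝ) + 1) / L)) (fun _ => K ((k : ℝ) / L)) t := by
    intro t
    have hmem : ∀ k : ℤ, t ∈ Set.Ico ((k : ℝ) / L) (((k : ℝ) + 1) / L) ↔ ⌊(L : ℝ) * t⌋ = k := by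
      intro k
      rw [Int.floor_eq_iff, Set.mem_Ico, div_le_iff₀ hL0, lt_div_iff₀ hL0, mul_comm t]
    simp only [Set.indicator_apply, hmem]
    rw [sum_ite_eq]
    split_ifs with h
    · rfl
    · refine hK.support_int hL ?_
      by_contra hlt
      push Not at hlt
      exact h (mem_Ioo.2 (abs_lt.1 hlt))
  simp only [h1]
  rw [integral_finsetSum _ fun k _ => (integrable_indicator_iff measurableSet_Ico).2
    (integrableOn_const (by simp [Real.volume_Ico])), mul_sum]
  refine sum_congr rfl fun k _ => ?_
  rw [integral_indicator_const _ measurableSet_Ico, Real.volume_real_Ico_of_le (by gcongr; linarith),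
    smul_eq_mul, ← sub_div, add_sub_cancel_left]

/-- `K` may jump at `±1`, so the sum is written as the integral of a step function and dominated
convergence is applied off these two points. -/
lemma tendsto_riemann_sum (hK : IsKernel K) :
    Tendsto (fun L : ℕ => 1 / (L : ℝ) * ∑ k ∈ Ioo (-(L : ℤ)) L, K ((k : ℝ) / L)) atTop
      (𝓝 (∫ t in (-1 : ℝ)..1, K t)) := by
  obtain ⟨A, hA⟩ := hK.bounded
  have hKint : ∫ t in (-1 : ℝ)..1, K t = ∫ t, K t := by
    rw [intervalIntegral.integral_of_le (by norm_num)]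
    refine setIntegral_eq_integral_of_forall_compl_eq_zero fun t ht => hK.support t ?_
    by_contra hlt
    push Not at hlt
    exact ht ⟨(abs_lt.1 hlt).1, (abs_lt.1 hlt).2.le⟩
  rw [hKint]
  have hlim : Tendsto (fun L : ℕ => ∫ t : ℝ, K (((⌊(L : ℝ) * t⌋ : ℤ) : ℝ) / L)) atTop (𝓝 (∫ t, K t)) := by
    -- `⌊Lt⌋/L` differs from `t` by less than `1/L ≤ 1`, hence the dominating interval `[-2, 2]`.
    refine tendsto_integral_filter_of_dominated_convergence
      (Set.indicator (Set.Icc (-2 : ℝ) 2) fun _ => A) ?_ ?_ ?_ ?_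
    · refine Eventually.of_forall fun L => ?_
      exact ((measurable_from_top (f := fun k : ℤ => K ((k : ℝ) / L))).comp
        (Int.measurable_floor.comp (measurable_const_mul (L : ℝ)))).aestronglyMeasurable
    · filter_upwards [eventually_ge_atTop 1] with L hL
      refine Eventually.of_forall fun t => ?_
      have hL1 : (1 : ℝ) ≤ L := by exact_mod_cast hL
      have hL0 : (0 : ℝ) < L := by linarith
      rw [Set.indicator_apply]
      split_ifs with ht
      · exact hA _
      · rw [hK.support, norm_zero]
        rw [Set.mem_Icc, not_and_or, not_le, not_le] at ht
        rw [abs_div, abs_of_pos hL0, one_le_div hL0]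
        rcases ht with ht | ht
        · have := Int.floor_le ((L : ℝ) * t)
          refine le_trans ?_ (neg_le_abs _)
          nlinarith
        · have := Int.lt_floor_add_one ((L : ℝ) * t)
          refine le_trans ?_ (le_abs_self _)
          nlinarith
    · exact (integrable_indicator_iff measurableSet_Icc).2 (integrableOn_const (by simp))
    · have hae : ∀ᵐ t : ℝ, t ∉ ({1, -1} : Set ℝ) :=
        compl_mem_ae_iff.2 ((Set.toFinite ({1, -1} : Set ℝ)).measure_zero volume)
      filter_upwards [hae] with t ht
      simp only [Set.mem_insert_iff, Set.mem_singleton_iff, not_or] at ht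
      have hf := tendsto_floor_mul_div t
      rcases lt_or_ge |t| 1 with h1 | h1
      · exact (hK.cont.continuousAt (Ioo_mem_nhds (abs_lt.1 h1).1 (abs_lt.1 h1).2)).tendsto.comp hf
      · have h2 : 1 < |t| := lt_of_le_of_ne h1 fun h => by
          rcases abs_eq_abs.1 ((abs_one).trans h) with h | h
          · exact ht.1 h.symm
          · exact ht.2 (by linarith)
        rw [hK.support t h1]
        refine tendsto_const_nhds.congr' ?_
        filter_upwards [hf.abs.eventually_const_lt h2] with L hL
        exact (hK.support _ hL.le).symm
  refine hlim.congr' ?_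
  filter_upwards [eventually_ge_atTop 1] with L hL using integral_kernel_floor hK hL

end Riemann

/-! ### The contribution of a jump to the bias -/

section Jump

variable {K : ℝ → ℝ} {m : ℕ} {d : ℕ → ℝ}

lemma sum_abs_step_sub_le (I : Finset ℤ) (c k : ℤ) :
    ∑ i ∈ I, |(if 0 ≤ i + k - c then (1 : ℝ) else 0) - if 0 ≤ i - c then 1 else 0| ≤ |(k : ℝ)| := by
  have h1 : ∀ i ∈ I, |(if 0 ≤ i + k - c then (1 : ℝ) else 0) - if 0 ≤ i - c then 1 else 0|
      = if i ∈ Ico (min (c - k) c) (max (c - k) c) then 1 else 0 := by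
    intro i _
    simp only [mem_Ico]
    rcases le_total 0 k with hk | hk
    · rw [min_eq_left (by omega), max_eq_right (by omega)]
      split_ifs <;> first | omega | simp
    · rw [min_eq_right (by omega), max_eq_left (by omega)]
      split_ifs <;> first | omega | simp
  rw [sum_congr rfl h1, sum_ite_mem, sum_const, nsmul_eq_mul, mul_one]
  have h2 : #(I ∩ Ico (min (c - k) c) (max (c - k) c)) ≤ k.natAbs := by
    refine (card_le_card inter_subset_right).trans ?_
    rw [Int.card_Ico]; omega
  calc ((#(I ∩ Ico (min (c - k) c) (max (c - k) c)) : ℕ) : ℝ) ≤ (k.natAbs : ℝ) := by exact_mod_cast h2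
    _ = |(k : ℝ)| := by rw [Nat.cast_natAbs, Int.cast_abs]

lemma sum_abs_jumpResponse_sub_le (I : Finset ℤ) (m : ℕ) (d : ℕ → ℝ) (h : ℕ) (T k : ℤ) :
    ∑ i ∈ I, |jumpResponse m d h (i + k - T) - jumpResponse m d h (i - T)|
      ≤ (∑ j ∈ range (m + 1), |d j|) * |(k : ℝ)| := by
  calc ∑ i ∈ I, |jumpResponse m d h (i + k - T) - jumpResponse m d h (i - T)|
      ≤ ∑ i ∈ I, ∑ j ∈ range (m + 1), |d j| * |(if 0 ≤ i + k - (T + (j : ℤ) * h) then (1 : ℝ) else 0)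
          - if 0 ≤ i - (T + (j : ℤ) * h) then 1 else 0| := by
        refine sum_le_sum fun i _ => ?_
        rw [jumpResponse, jumpResponse, ← sum_sub_distrib]
        refine (abs_sum_le_sum_abs _ _).trans (le_of_eq (sum_congr rfl fun j _ => ?_))
        rw [← mul_sub, abs_mul, sub_sub, sub_sub]
    _ = ∑ j ∈ range (m + 1), |d j| * ∑ i ∈ I,
          |(if 0 ≤ i + k - (T + (j : ℤ) * h) then (1 : ℝ) else 0)
          - if 0 ≤ i - (T + (j : ℤ) * h) then 1 else 0| := by
        rw [sum_comm]
        exact sum_congr rfl fun j _ => by rw [mul_sum]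
    _ ≤ ∑ j ∈ range (m + 1), |d j| * |(k : ℝ)| :=
        sum_le_sum fun j _ => mul_le_mul_of_nonneg_left (sum_abs_step_sub_le I _ k) (abs_nonneg _)
    _ = _ := by rw [sum_mul]

lemma sum_kernel_mul_eq (hK : IsKernel K) {ℓ : ℕ} (hℓ : 1 ≤ ℓ) {I : Finset ℤ} {r : ℤ → ℝ}
    (hr : ∀ i, i ∉ I → r i = 0) (i : ℤ) :
    ∑ j ∈ I, K (((i - j : ℤ) : ℝ) / ℓ) * r j
      = ∑ k ∈ Ioo (-(ℓ : ℤ)) ℓ, K ((k : ℝ) / ℓ) * r (i + k) := by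
  have h1 : ∑ j ∈ I, K (((i - j : ℤ) : ℝ) / ℓ) * r j
      = ∑ j ∈ I ∪ Ioo (i - (ℓ : ℤ)) (i + ℓ), K (((i - j : ℤ) : ℝ) / ℓ) * r j :=
    sum_subset subset_union_left fun j _ hj => by rw [hr j hj, mul_zero]
  have h2 : ∑ j ∈ Ioo (i - (ℓ : ℤ)) (i + ℓ), K (((i - j : ℤ) : ℝ) / ℓ) * r j
      = ∑ j ∈ I ∪ Ioo (i - (ℓ : ℤ)) (i + ℓ), K (((i - j : ℤ) : ℝ) / ℓ) * r j :=
    sum_subset subset_union_right fun j _ hj => by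
      rw [hK.support_int hℓ, zero_mul]
      by_contra hlt
      push Not at hlt
      exact hj (mem_Ioo.2 ⟨by linarith [(abs_lt.1 hlt).2], by linarith [(abs_lt.1 hlt).1]⟩)
  rw [h1, ← h2]
  refine sum_nbij' (fun j => j - i) (fun k => i + k) ?_ ?_ ?_ ?_ ?_
  · intro j hj; rw [mem_Ioo] at hj ⊢; constructor <;> linarith
  · intro k hk; rw [mem_Ioo] at hk ⊢; constructor <;> linarith
  · intro j _; ring
  · intro k _; ring
  · intro j _
    rw [← hK.even_int, neg_sub, add_sub_cancel]

/-- Within a band of width `ℓ`, `r (i + k)` is replaced by `r i`. The response has bounded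
variation, so each of the `O(ℓ)` lags costs `O(ℓ)`. -/
lemma abs_qform_midJump_sub_le (hK : IsKernel K) (hd : IsDiffSeq m d) {A : ℝ} (hA : ∀ t, |K t| ≤ A)
    {n ℓ h : ℕ} (hℓ : 1 ≤ ℓ) (hn : 1 ≤ n) (hmh : 2 * (m * h) ≤ n) :
    |(n : ℝ) * qform K m n ℓ h (midJump m d n h) (midJump m d n h)
      - (∑ k ∈ Ioo (-(ℓ : ℤ)) ℓ, K ((k : ℝ) / ℓ)) *
        ∑ i ∈ Icc ((m : ℤ) * h + 1) n, midJump m d n h i ^ 2|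
      ≤ 2 * A * (∑ j ∈ range (m + 1), |d j|) ^ 2 * (ℓ : ℝ) ^ 2 := by
  have hA0 : 0 ≤ A := (abs_nonneg _).trans (hA 0)
  have hn0 : (n : ℝ) ≠ 0 := by exact_mod_cast (show n ≠ 0 by omega)
  set D := ∑ j ∈ range (m + 1), |d j| with hD
  have hD0 : 0 ≤ D := sum_nonneg fun _ _ => abs_nonneg _
  set I := Icc ((m : ℤ) * h + 1) (n : ℤ) with hI
  set r := midJump m d n h with hr
  have hmh' : 2 * ((m : ℤ) * h) ≤ n := by exact_mod_cast hmh
  -- `2mh ≤ n` places the whole response to the middle jump inside the window, so sums over shifted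
  -- times lose nothing.
  have hzero : ∀ i, i ∉ I → r i = 0 := by
    intro i hi
    refine jumpResponse_eq_zero hd ?_
    rw [hI, mem_Icc, not_and_or, not_le, not_le] at hi
    push_cast
    rcases hi with hi | hi
    · left; omega
    · right; omega
  have e1 : (n : ℝ) * qform K m n ℓ h r r
      = ∑ k ∈ Ioo (-(ℓ : ℤ)) ℓ, K ((k : ℝ) / ℓ) * ∑ i ∈ I, r i * r (i + k) := by
    rw [qform, mul_sum]
    have : ∀ i ∈ I, (n : ℝ) * ∑ j ∈ I, (1 / (n : ℝ) * K (((i - j : ℤ) : ℝ) / ℓ)) * (r i * r j)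
        = ∑ k ∈ Ioo (-(ℓ : ℤ)) ℓ, K ((k : ℝ) / ℓ) * (r i * r (i + k)) := by
      intro i _
      have h1 := sum_kernel_mul_eq hK hℓ hzero i
      calc _ = r i * ∑ j ∈ I, K (((i - j : ℤ) : ℝ) / ℓ) * r j := by
            rw [mul_sum, mul_sum]
            exact sum_congr rfl fun j _ => by field_simp
        _ = _ := by
            rw [h1, mul_sum]
            exact sum_congr rfl fun k _ => by ring
    rw [sum_congr rfl this, sum_comm]
    exact sum_congr rfl fun k _ => by rw [mul_sum]
  have e2 : (n : ℝ) * qform K m n ℓ h r r - (∑ k ∈ Ioo (-(ℓ : ℤ)) ℓ, K ((k : ℝ) / ℓ)) * ∑ i ∈ I, r i ^ 2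
      = ∑ k ∈ Ioo (-(ℓ : ℤ)) ℓ, K ((k : ℝ) / ℓ) * ∑ i ∈ I, r i * (r (i + k) - r i) := by
    rw [e1, sum_mul, ← sum_sub_distrib]
    refine sum_congr rfl fun k _ => ?_
    rw [← mul_sub, ← sum_sub_distrib]
    congr 1
    exact sum_congr rfl fun i _ => by ring
  rw [e2]
  have hterm : ∀ k ∈ Ioo (-(ℓ : ℤ)) ℓ, |K ((k : ℝ) / ℓ) * ∑ i ∈ I, r i * (r (i + k) - r i)|
      ≤ A * (D * (D * ℓ)) := by
    intro k hk
    rw [abs_mul]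
    refine mul_le_mul (hA _) ?_ (abs_nonneg _) hA0
    calc |∑ i ∈ I, r i * (r (i + k) - r i)| ≤ ∑ i ∈ I, D * |r (i + k) - r i| := by
          refine (abs_sum_le_sum_abs _ _).trans (sum_le_sum fun i _ => ?_)
          rw [abs_mul]
          exact mul_le_mul_of_nonneg_right (abs_jumpResponse_le m d h _) (abs_nonneg _)
      _ = D * ∑ i ∈ I, |r (i + k) - r i| := by rw [mul_sum]
      _ ≤ D * (D * |(k : ℝ)|) :=
          mul_le_mul_of_nonneg_left (sum_abs_jumpResponse_sub_le I m d h _ k) hD0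
      _ ≤ D * (D * ℓ) := by
          have : |(k : ℝ)| ≤ ℓ := by
            have h1 := (abs_lt.2 (mem_Ioo.1 hk)).le
            exact_mod_cast h1
          gcongr
  refine (abs_sum_le_sum_abs _ _).trans ((sum_le_card_nsmul _ _ _ hterm).trans ?_)
  rw [nsmul_eq_mul]
  have hcard : ((#(Ioo (-(ℓ : ℤ)) ℓ) : ℕ) : ℝ) ≤ 2 * ℓ := by
    have : #(Ioo (-(ℓ : ℤ)) ℓ) ≤ 2 * ℓ := by rw [Int.card_Ioo]; omega
    exact_mod_cast this
  calc _ ≤ 2 * (ℓ : ℝ) * (A * (D * (D * ℓ))) := mul_le_mul_of_nonneg_right hcard (by positivity)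
    _ = _ := by ring

/-- The first nonzero coefficient cannot be the last one, since the coefficients sum to zero. -/
lemma IsDiffSeq.exists_first (hd : IsDiffSeq m d) : ∃ p < m, d p ≠ 0 ∧ ∀ k < p, d k = 0 := by
  classical
  have hex : ∃ p, p < m + 1 ∧ d p ≠ 0 := by
    by_contra hcon
    push Not at hcon
    have := hd.sum_sq
    rw [sum_eq_zero fun j hj => by rw [hcon j (mem_range.1 hj)]; norm_num] at this
    norm_num at this
  have hp := Nat.find_spec hex
  set p := Nat.find hex
  have hmin : ∀ k < p, d k = 0 := fun k hk => by
    have := Nat.find_min hex hk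
    by_contra hne
    exact this ⟨by omega, hne⟩
  refine ⟨p, ?_, hp.2, hmin⟩
  by_contra hge
  have hpm : p = m := by omega
  have := hd.sum_zero
  rw [sum_range_succ, sum_eq_zero fun j hj => hmin j (by rw [hpm]; exact mem_range.1 hj), zero_add,
    ← hpm] at this
  exact hp.2 this

/-- At distances from `ph` to `(p+1)h` past the jump the response is the partial sum up to `p`, that
is `d p`. -/
lemma mul_le_sum_sq_midJump {p : ℕ} (hp : p < m) (hzero : ∀ k < p, d k = 0)
    {n h : ℕ} (hmh : 2 * (m * h) ≤ n) :
    d p ^ 2 * h ≤ ∑ i ∈ Icc ((m : ℤ) * h + 1) (n : ℤ), midJump m d n h i ^ 2 := by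
  set T : ℤ := ((n / 2 + 1 : ℕ) : ℤ) with hT
  have hmh' : 2 * ((m : ℤ) * h) ≤ n := by exact_mod_cast hmh
  have hph : ((p : ℤ) + 1) * h ≤ m * h :=
    mul_le_mul_of_nonneg_right (by omega) (by positivity)
  have hph0 : 0 ≤ (p : ℤ) * h := by positivity
  rw [add_mul, one_mul] at hph
  have hsub : Ico (T + (p : ℤ) * h) (T + p * h + h) ⊆ Icc ((m : ℤ) * h + 1) (n : ℤ) := by
    intro i hi
    rw [mem_Ico] at hi
    rw [mem_Icc]
    constructor <;> omega
  have hval : ∀ i ∈ Ico (T + (p : ℤ) * h) (T + p * h + h), midJump m d n h i ^ 2 = d p ^ 2 := by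
    intro i hi
    rw [mem_Ico] at hi
    congr 1
    rw [midJump, jumpResponse, sum_eq_single_of_mem p (mem_range.2 (by omega))]
    · rw [if_pos (by omega), mul_one]
    · intro k _ hk
      rcases lt_or_gt_of_ne hk with h1 | h1
      · rw [hzero k h1, zero_mul]
      · rw [if_neg, mul_zero]
        have : ((p : ℤ) + 1) * h ≤ k * h := mul_le_mul_of_nonneg_right (by omega) (by positivity)
        rw [add_mul, one_mul] at this
        omega
  calc d p ^ 2 * h = ∑ i ∈ Ico (T + (p : ℤ) * h) (T + p * h + h), midJump m d n h i ^ 2 := by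
        rw [sum_congr rfl hval, sum_const, Int.card_Ico, nsmul_eq_mul, add_sub_cancel_left, Int.toNat_natCast,
          mul_comm]
    _ ≤ _ := sum_le_sum_of_subset_of_nonneg hsub fun _ _ _ => sq_nonneg _

theorem isBigO_qform_midJump (hK : IsKernel K) (hd : IsDiffSeq m d) {ℓ h : ℕ → ℕ}
    (H : Admissible m ℓ h) (hr : Tendsto (ratio ℓ h) atTop atTop)
    (hInt : (∫ t in (-1 : ℝ)..1, K t) ≠ 0) :
    (fun n : ℕ => (ℓ n : ℝ) * h n / n) =O[atTop]
      fun n => qform K m n (ℓ n) (h n) (midJump m d n (h n)) (midJump m d n (h n)) := by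
  obtain ⟨A, hA⟩ := hK.bounded
  obtain ⟨p, hp, hdp, hzero⟩ := hd.exists_first
  set κ := |∫ t in (-1 : ℝ)..1, K t| with hκ
  have hκ0 : 0 < κ := abs_pos.2 hInt
  set D := ∑ j ∈ range (m + 1), |d j|
  have he : 0 < d p ^ 2 := by positivity
  have hℓnat : Tendsto ℓ atTop atTop := tendsto_natCast_atTop_iff.1 H.tendsto_bandwidth
  have hS := ((tendsto_riemann_sum hK).comp hℓnat).abs.eventually_const_lt
    (show κ / 2 < |∫ t in (-1 : ℝ)..1, K t| by rw [← hκ]; linarith)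
  have hsmall : ∀ᶠ n : ℕ in atTop, ((ℓ n : ℝ) + m * h n) / n < 1 / 2 :=
    H.tendsto_aux.2.eventually_lt_const (by norm_num)
  -- The main term is at least `(κ/2) ℓ d_p² h`, and the requirement on `h/ℓ` below makes the
  -- `O(ℓ²)` error at most half of it.
  refine IsBigO.of_bound (4 / (κ * d p ^ 2)) ?_
  filter_upwards [hS, hsmall, eventually_ge_atTop 1,
    hr.eventually_ge_atTop (8 * A * D ^ 2 / (κ * d p ^ 2))] with n hSn hsn hn1 hrn
  have hℓ1 := (H.range_ℓ n hn1).1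
  have hℓ : (0 : ℝ) < ℓ n := by exact_mod_cast hℓ1
  have hn : (0 : ℝ) < n := by exact_mod_cast hn1
  have hmh : 2 * (m * h n) ≤ n := by
    rw [div_lt_iff₀ hn] at hsn
    have : (2 * (m * h n) : ℝ) ≤ n := by linarith
    exact_mod_cast this
  have h1 := abs_qform_midJump_sub_le hK hd hA hℓ1 hn1 hmh
  have h2 := mul_le_sum_sq_midJump (n := n) hp hzero hmh
  set Q := qform K m n (ℓ n) (h n) (midJump m d n (h n)) (midJump m d n (h n))
  set S := ∑ k ∈ Ioo (-(ℓ n : ℤ)) (ℓ n), K ((k : ℝ) / ℓ n) with hSdef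
  set V := ∑ i ∈ Icc ((m : ℤ) * h n + 1) (n : ℤ), midJump m d n (h n) i ^ 2
  simp only [Function.comp] at hSn
  rw [← hSdef, abs_mul, abs_of_pos (by positivity : (0 : ℝ) < 1 / ℓ n), one_div, ← div_eq_inv_mul,
    lt_div_iff₀ hℓ] at hSn
  have hV0 : 0 ≤ V := sum_nonneg fun _ _ => sq_nonneg _
  have h3 : κ / 2 * ℓ n * (d p ^ 2 * h n) ≤ |S * V| := by
    rw [abs_mul, abs_of_nonneg hV0]
    exact mul_le_mul hSn.le h2 (by positivity) (abs_nonneg _)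
  have h4 : |S * V| - |n * Q| ≤ 2 * A * D ^ 2 * (ℓ n : ℝ) ^ 2 := by
    refine le_trans ?_ h1
    rw [abs_sub_comm]
    exact abs_sub_abs_le_abs_sub _ _
  have h5 : 8 * A * D ^ 2 * ℓ n ≤ κ * d p ^ 2 * h n := by
    rw [ratio, div_le_div_iff₀ (by positivity) hℓ] at hrn
    linarith
  have h6 : 8 * A * D ^ 2 * (ℓ n : ℝ) ^ 2 ≤ κ * d p ^ 2 * h n * ℓ n := by
    have := mul_le_mul_of_nonneg_right h5 hℓ.le
    nlinarith
  rw [abs_mul (n : ℝ), abs_of_pos hn] at h4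
  rw [Real.norm_of_nonneg (by positivity), Real.norm_eq_abs, div_le_iff₀ hn, div_mul_eq_mul_div,
    div_mul_eq_mul_div, le_div_iff₀ (by positivity)]
  nlinarith

end Jump

/-! ### Assembly of the regimes -/

section Main

variable {K : ℝ → ℝ} {m : ℕ} {d : ℕ → ℝ} {ℓ h : ℕ → ℕ}

/-- The second difference of the bias over the jump sizes `1, 2, 3` isolates the coefficient of
`κ²`. -/
lemma isBigO_qform_midJump_of_rateOptimal (hK : IsKernel K) (hd : IsDiffSeq m d)
    (H : Admissible m ℓ h) {q : ℕ} (hO : RateOptimal.{0} K m d ℓ h q) :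
    (fun n => qform K m n (ℓ n) (h n) (midJump m d n (h n)) (midJump m d n (h n)))
      =O[atTop] fun n => √(rate q n) := by
  have hb : ∀ (κ : ℝ) (hκ : κ ∈ Set.Icc (1 : ℝ) 3),
      DGM.bias ⟨whiteNoise 1, stdMean κ hκ⟩ K m d ℓ h =O[atTop] fun n => √(rate q n) := fun κ hκ =>
    have hG := inClass_stdMean hκ (twoTapNoise_weaklyDependent 1 0 0) (twoTapNoise_finiteU 1 0 0 q)
    isBigO_bias hK H hG (fun n hn => rate_pos q hn) (hO _ hG)
  have h1 := ((hb 1 (by norm_num)).sub ((hb 2 (by norm_num)).const_mul_left 2)).add (hb 3 (by norm_num))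
  refine IsBigO.trans (EventuallyEq.isBigO ?_) (h1.const_mul_left (1 / 2))
  filter_upwards [eventually_ge_atTop 2] with n hn
  simp only [DGM.bias, stdMean]
  rw [qform_trendJump hK hd _ _ hn, qform_trendJump hK hd _ _ hn, qform_trendJump hK hd _ _ hn]
  ring

/-- The variance bounds `ℓ` from above; the vanishing weight at lag `ℓ` bounds it from below. The
jump then forces `ℓh/n ≲ bw^{-q}`, hence `h ≲ bw^q`. -/
theorem bandwidth_and_lag_of_rateOptimal (hK : IsKernel K) {q : ℕ} {B : ℝ} (hq : NearOrigin K q B)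
    (hd : IsDiffSeq m d) (H : Admissible m ℓ h) (hr : Tendsto (ratio ℓ h) atTop atTop)
    (hInt : (∫ t in (-1 : ℝ)..1, K t) ≠ 0) (hO : RateOptimal.{0} K m d ℓ h q) :
    ((fun n => (ℓ n : ℝ)) =Θ[atTop] bw q) ∧
      (fun n => (h n : ℝ)) =O[atTop] fun n => bw q n ^ q := by
  have hr2 : ∀ᶠ n in atTop, 1 + 1 ≤ ratio ℓ h n := hr.eventually_ge_atTop _
  have hoff := offDiag_of_ratio hK H one_pos hr2 1
  have hlag := eventually_lag_ge H hr2
  have hup : (fun n => (ℓ n : ℝ)) =O[atTop] bw q := by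
    have hG := inClass_stdMean (κ := 1) (by norm_num) (twoTapNoise_weaklyDependent 1 0 0)
      (twoTapNoise_finiteU 1 0 0 q)
    have h1 := (isBigO_mse_of_variance hK hq hd H hoff (σ := 1) (β := 0) (by norm_num) 0
      (stdMean 1 (by norm_num))).trans (hO _ hG)
    have h2 := h1.mul (isBigO_refl (fun n : ℕ => (n : ℝ)) atTop)
    refine (IsBigO.trans (EventuallyEq.isBigO ?_) h2).trans (EventuallyEq.isBigO ?_)
    · filter_upwards [eventually_ge_atTop 1] with n hn
      have : (n : ℝ) ≠ 0 := by exact_mod_cast (show n ≠ 0 by omega)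
      rw [div_mul_cancel₀ _ this]
    · filter_upwards [eventually_ge_atTop 1] with n hn
      have : (n : ℝ) ≠ 0 := by exact_mod_cast (show n ≠ 0 by omega)
      rw [rate_eq_div q hn, div_mul_cancel₀ _ this]
  have hlow : bw q =O[atTop] fun n => (ℓ n : ℝ) := by
    refine isBigO_bandwidth_of_acvfWeight_eq_zero hK H hq.pos hO (k := ℓ) (c := 1) (by simp) ?_ ?_
    · filter_upwards [eventually_ge_atTop 1] with n hn using (H.range_ℓ n hn).1
    · filter_upwards [hlag, eventually_ge_atTop 1] with n hn hn1
      have hhn : (ℓ n : ℤ) + ℓ n ≤ h n := by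
        have : (ℓ n : ℝ) + ℓ n ≤ h n := by linarith
        exact_mod_cast this
      rw [hd.acvfWeight_eq_wKernel hK (H.range_ℓ n hn1).1 (by positivity) hhn,
        wKernel_zero hK (H.range_ℓ n hn1).1 (by simp)]
  refine ⟨⟨hup, hlow⟩, ?_⟩
  have h1 := (isBigO_qform_midJump hK hd H hr hInt).trans (isBigO_qform_midJump_of_rateOptimal hK hd H hO)
  have h2 := (isBigO_div_natCast (hlow.mul (isBigO_refl (fun n => (h n : ℝ)) atTop))).trans h1
  have h3 := h2.mul (isBigO_refl (fun n => bw q n ^ (2 * q)) atTop)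
  refine (IsBigO.trans (EventuallyEq.isBigO ?_) h3).trans (EventuallyEq.isBigO ?_)
  · filter_upwards [eventually_ge_atTop 1] with n hn
    have := bw_pos q hn
    rw [← bw_pow q n, pow_add, pow_one]
    field_simp
  · filter_upwards [eventually_ge_atTop 1] with n hn
    have := bw_pos q hn
    rw [sqrt_rate q hn, one_div, inv_pow, two_mul, pow_add]
    field_simp

lemma isBigO_bw_pow {p : ℕ} (hp : 1 ≤ p) : bw p =O[atTop] fun n => bw p n ^ p := by
  refine IsBigO.of_bound 1 ?_
  filter_upwards [eventually_ge_atTop 1] with n hn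
  have h1 := one_le_bw p hn
  rw [one_mul, Real.norm_of_nonneg (by linarith), Real.norm_of_nonneg (by positivity)]
  exact le_self_pow₀ h1 (by omega)

theorem nearBandwidth (hK : IsKernel K) {q : ℕ} {B : ℝ} (hq : NearOrigin K q B) (hm : 0 < m)
    (hd : IsDiffSeq m d) (H : Admissible m ℓ h) {q' : ℕ} {B' : ℝ} (hq' : NearBoundary K q' B')
    (hO : (fun n => (h n : ℝ) - ℓ n) =O[atTop] fun _ => (1 : ℝ)) :
    (((fun n => (ℓ n : ℝ)) =Θ[atTop] bw (min q q')) →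
        Attains.{u} K m d ℓ h q (rate (min q q'))) ∧
      ((q' < q → delta m d 1 ≠ 0) →
        NotSmaller K m d ℓ h q (rate (min q q')) ∧
        ((q = q' → B ≠ delta m d 1 * B') →
          MSELowerBound K m d ℓ h q (rate (min q q')))) := by
  obtain ⟨C, hC⟩ := hO.bound
  have hR : ∀ᶠ n in atTop, |(h n : ℝ) - ℓ n| ≤ (⌈C⌉₊ : ℕ) := hC.mono fun n hn => by
    rw [norm_one, mul_one, Real.norm_eq_abs] at hn
    exact hn.trans (Nat.le_ceil C)
  have hoff := offDiag_of_nearBoundary hK H hq' hR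
  have hlag := lag_le_of_abs_sub_le H hR
  have hp1 : 1 ≤ min q q' := le_min hq.pos hq'.pos
  refine ⟨fun hℓ => ?_, fun hδ => ⟨?_, fun hB => ?_⟩⟩
  · refine attains_rate hK hq hd H hp1 (min_le_left _ _) (hoff.mono hK H (min_le_right _ _)) hℓ ?_
    refine IsBigO.trans (IsBigO.of_bound 2 (hlag.mono fun n hn => ?_)) (hℓ.1.trans (isBigO_bw_pow hp1))
    simpa using hn
  · by_cases hB : q = q' → B ≠ delta m d 1 * B'
    · exact notSmaller_of_mseLowerBound (mseLowerBound_of_nearBoundary hK hq hd hm H hq' hR hδ hB)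
    -- Here `α = β` in `boundaryCoeff`, and the bias argument is not available.
    · push Not at hB
      rw [← hB.1, min_self]
      exact notSmaller_rate hK hq hd H (hoff.mono hK H hq'.pos) hlag
  · exact mseLowerBound_of_nearBoundary hK hq hd hm H hq' hR hδ hB

theorem largeLag (hK : IsKernel K) {q : ℕ} {B : ℝ} (hq : NearOrigin K q B)
    (hd : IsDiffSeq m d) (H : Admissible m ℓ h) {lam : ℝ} (hlam : 1 < lam)
    (hr : Tendsto (ratio ℓ h) atTop (𝓝 lam)) :
    (((fun n => (ℓ n : ℝ)) =Θ[atTop] bw q) → Attains.{u} K m d ℓ h q (rate q)) ∧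
      MSELowerBound K m d ℓ h q (rate q) := by
  have hδ : 0 < (lam - 1) / 2 := by linarith
  have hr1 : ∀ᶠ n in atTop, 1 + (lam - 1) / 2 ≤ ratio ℓ h n :=
    (hr.eventually_const_lt (by linarith)).mono fun n hn => hn.le
  refine ⟨fun hℓ => ?_, mseLowerBound_of_ratio hK hq hd H hδ hr1⟩
  refine attains_rate hK hq hd H hq.pos le_rfl (offDiag_of_ratio hK H hδ hr1 q) hℓ ?_
  refine IsBigO.trans (IsBigO.of_bound (lam + 1) ?_) (hℓ.1.trans (isBigO_bw_pow hq.pos))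
  filter_upwards [hr.eventually_lt_const (lt_add_one lam), eventually_ge_atTop 1] with n hn hn1
  have hℓ0 : (0 : ℝ) < ℓ n := by exact_mod_cast (H.range_ℓ n hn1).1
  rw [ratio, div_lt_iff₀ hℓ0] at hn
  rw [Real.norm_of_nonneg (by positivity), Real.norm_of_nonneg (by positivity)]
  exact hn.le

/-- For `q = 1` the necessary conditions give `h ≲ bw ≍ ℓ`, contradicting `h/ℓ → ∞`. -/
theorem not_rateOptimal_of_divergent_ratio (hK : IsKernel K) {B : ℝ} (hq : NearOrigin K 1 B)
    (hd : IsDiffSeq m d) (H : Admissible m ℓ h) (hr : Tendsto (ratio ℓ h) atTop atTop)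
    (hInt : (∫ t in (-1 : ℝ)..1, K t) ≠ 0) : ¬ RateOptimal.{0} K m d ℓ h 1 := by
  intro hO
  obtain ⟨hℓ, hh⟩ := bandwidth_and_lag_of_rateOptimal hK hq hd H hr hInt hO
  simp only [pow_one] at hh
  obtain ⟨C, hC⟩ := (hh.trans hℓ.2).bound
  obtain ⟨n, ⟨h1, h2⟩, h3⟩ := ((hC.and (hr.eventually_gt_atTop C)).and (eventually_ge_atTop 1)).exists
  have hℓ0 : (0 : ℝ) < ℓ n := by exact_mod_cast (H.range_ℓ n h3).1
  rw [ratio, lt_div_iff₀ hℓ0] at h2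
  rw [Real.norm_of_nonneg (by positivity), Real.norm_of_nonneg (by positivity)] at h1
  linarith

end Main

end DiffVar

end

theorem theorem2
    (K : ℝ → ℝ) (hK : IsKernel K)
    (q : ℕ) (B : ℝ) (hq : NearOrigin K q B)
    (m : ℕ) (hm : 0 < m) (d : ℕ → ℝ) (hd : IsDiffSeq m d)
    (ℓ h : ℕ → ℕ) (hℓh : Admissible m ℓ h) :
    -- h/ℓ → 0
    (Tendsto (ratio ℓ h) atTop (𝓝 0) → Inconsistent K m d ℓ h q) ∧
    -- h/ℓ → λ∞ ∈ (0,1)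
    (∀ lam : ℝ, 0 < lam → lam < 1 → Tendsto (ratio ℓ h) atTop (𝓝 lam) →
      Unambiguous K m d ℓ h → Inconsistent K m d ℓ h q) ∧
    -- h/ℓ → 1 with |h - ℓ| = O(1)
    (∀ (q' : ℕ) (B' : ℝ), NearBoundary K q' B' → Tendsto (ratio ℓ h) atTop (𝓝 1) →
      ((fun n => (h n : ℝ) - ℓ n) =O[atTop] fun _ => (1 : ℝ)) →
      (((fun n => (ℓ n : ℝ)) =Θ[atTop] bw (min q q')) →
        Attains.{u} K m d ℓ h q (rate (min q q'))) ∧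
      ((q' < q → delta m d 1 ≠ 0) →
        NotSmaller K m d ℓ h q (rate (min q q')) ∧
        ((q = q' → B ≠ delta m d 1 * B') →
          MSELowerBound K m d ℓ h q (rate (min q q'))))) ∧
    -- h/ℓ → λ∞ ∈ (1,∞)
    (∀ lam : ℝ, 1 < lam → Tendsto (ratio ℓ h) atTop (𝓝 lam) →
      (((fun n => (ℓ n : ℝ)) =Θ[atTop] bw q) → Attains.{u} K m d ℓ h q (rate q)) ∧
      MSELowerBound K m d ℓ h q (rate q)) ∧
    -- h/ℓ → ∞
    (Tendsto (ratio ℓ h) atTop atTop →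
      (q = 1 → (∫ t in (-1 : ℝ)..1, K t) ≠ 0 → ¬ RateOptimal.{0} K m d ℓ h q) ∧
      (1 < q →
        (((fun n => (ℓ n : ℝ)) =Θ[atTop] bw q) →
          (bw q =o[atTop] fun n => (h n : ℝ)) →
          ((fun n => (h n : ℝ)) =O[atTop]
            fun n : ℕ => (n : ℝ) ^ ((q : ℝ) / (1 + 2 * (q : ℝ)))) →
          Attains.{u} K m d ℓ h q (rate q)) ∧
        MSELowerBound K m d ℓ h q (rate q) ∧
        ((∫ t in (-1 : ℝ)..1, K t) ≠ 0 → RateOptimal.{0} K m d ℓ h q →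
          ((fun n => (ℓ n : ℝ)) =Θ[atTop] bw q) ∧
          ((fun n => (h n : ℝ)) =O[atTop]
            fun n : ℕ => (n : ℝ) ^ ((q : ℝ) / (1 + 2 * (q : ℝ))))))) := by
  refine ⟨inconsistent_of_ratio_zero hK hd hℓh q, fun lam _ _ _ hu =>
    inconsistent_of_unambiguous hK hd hℓh q hu, fun q' B' hq' _ hO =>
    nearBandwidth hK hq hm hd hℓh hq' hO, fun lam hlam hr => largeLag hK hq hd hℓh hlam hr,
    fun hr => ⟨?_, fun _ => ⟨?_, ?_, ?_⟩⟩⟩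
  · rintro rfl hInt
    exact not_rateOptimal_of_divergent_ratio hK hq hd hℓh hr hInt
  · intro hℓ _ hh
    simp only [← bw_pow_self] at hh
    exact attains_rate hK hq hd hℓh hq.pos le_rfl
      (offDiag_of_ratio hK hℓh one_pos (hr.eventually_ge_atTop _) q) hℓ hh
  · exact mseLowerBound_of_ratio hK hq hd hℓh one_pos (hr.eventually_ge_atTop _)
  · intro hInt hO
    simp only [← bw_pow_self]
    exact bandwidth_and_lag_of_rateOptimal hK hq hd hℓh hr hInt hO
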